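/- Knot diagrams are immersed oriented closed curves in $S^2$ or $\mathbb R^2$ whose only singularities are finitely many transverse double points (crossings), with over/under information at each crossing, considered up to isotopy. For two such diagrams $D,E$ in the same surface, $d(D,E)\in\mathbb N\cup\{\infty\}$ denotes the least number of Reidemeister moves (of types RI, RII, RIII, in either direction) that transform $D$ into $E$. The trivial diagram $U$ is an embedded circle; in $\mathbb R^2$ it has two versions, the clockwise circle $U_{\mathrm{cw}}$ and the counterclockwise circle $U_{\mathrm{ccw}}$. For $n\ge 1$ let $D_n$ be the following diagram. Two parallel strands run clockwise. They twist about one another with $2n-1$ positive crossings $t_1,\dots,t_{2n-1}$ along the top, then go down side by side on the right, as the middle and the right vertical strand, and cross over $n$ horizontal strands, and then twist about one another with $2n$ negative crossings $b_1,\dots,b_{2n}$ along the bottom. Then one of the two goes up as the left vertical strand, crosses over the $n$ horizontal strands and closes up at the top, while the other one first winds $n$ times clockwise around, passing outside below the bottom and thus forming the $n$ horizontal strands, which are numbered from below and run from left to right under the three vertical strands, and then closes up at the top from the outside. Let $l_j$, $m_j$, $r_j$ be the crossings of the left, middle and right vertical strands with the $j$-th horizontal strand; $l_j$ is negative, $m_j$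 and $r_j$ are positive. Precisely, with $x^{+}$ and $x^{-}$ denoting the passage over and under the crossing $x$, the curve passes in cyclic order through $$\begin{aligned}&t_1^{+}t_2^{-}t_3^{+}\cdots t_{2n-1}^{+}\;\; m_n^{+}\cdots m_1^{+}\;\; b_1^{+}b_2^{-}\cdots b_{2n}^{-}\;\; l_1^{+}\cdots l_n^{+}\\ &t_1^{-}t_2^{+}t_3^{-}\cdots t_{2n-1}^{-}\;\; r_n^{+}\cdots r_1^{+}\;\; b_1^{-}b_2^{+}\cdots b_{2n}^{+}\;\; (l_1^{-}m_1^{-}r_1^{-})\cdots(l_n^{-}m_n^{-}r_n^{-}),\end{aligned}$$ and in $\mathbb R^2$ the unbounded region lies to the left of the arc from $r_n^{-}$ to $t_1^{+}$. **Theorem.** For every $n\ge 1$, $D_n$ is a knot diagram with $7n-1$ crossings, and $$2n^2+3n-2\ \le\ d(D_n,U)\ \le\ 2n^2+3n$$ holds in $S^2$ and, with $U=U_{\mathrm{cw}}$, in $\mathbb R^2$; moreover $d(D_n,U_{\mathrm{ccw}})\ge 2n^2+3n-2$ in $\mathbb R^2$. In particular, $D_n$ is a diagram of the unknot. -/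

import Mathlib

namespace KnotDiag

/-! ## Knot diagrams as signed Gauss words

An oriented knot diagram is recorded, up to isotopy, by the cyclic word of crossing passages met
when the curve is traversed once. The word determines the 4-valent graph of the diagram together
with the cyclic order of the strands at each crossing, hence its faces, and the diagram lies in
the 2-sphere exactly when Euler's formula holds. The crossingless circle is the empty word. -/

/-- Names for crossings (a countably infinite supply). -/
abbrev CrossingName := ℕ × ℕ

/-- A passage of the curve through a crossing: the name of the crossing, whether the curve passes
over there, and whether the crossing is a positive one. -/
structure Passage where
  crossing : CrossingName
  isOver : Bool
  positive : Bool
  deriving DecidableEq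

/-- The other passage through the same crossing. -/
def Passage.mate (p : Passage) : Passage := ⟨p.crossing, !p.isOver, p.positive⟩

/-- At this passage the other strand crosses from right to left. At a positive crossing the
understrand crosses the overstrand from right to left, at a negative one from left to right. -/
def Passage.crossedToLeft (p : Passage) : Bool := p.isOver == p.positive

/-- A word of passages, read from a base point on the curve that is not a crossing. Read
cyclically: the edges of the diagram lead from each passage to the cyclically next one. The edge
from the last passage to the first one is the base edge, which carries the base point. -/
abbrev Word := List Passage

/-- A directed edge: `(p, true)` is the edge that leaves the passage `p`, run forwards;
`(p, false)` is the same edge, run backwards. It stands for the face on its left. -/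
abbrev Dart := Passage × Bool

/-- The next directed edge on the boundary of the face that lies on the left: run to the end of
the edge and turn left there. Here `w.formPerm` sends each passage to the cyclically next one. -/
def faceNext (w : Word) : Dart → Dart
  | (p, true) =>
    let q := w.formPerm p
    if q.crossedToLeft then (q.mate, true) else (w.formPerm.symm q.mate, false)
  | (p, false) =>
    if p.crossedToLeft then (w.formPerm.symm p.mate, false) else (p.mate, true)

/-- Two directed edges have the same face on their left. -/
def SameFace (w : Word) (d e : Dart) : Prop := ∃ k : ℕ, (faceNext w)^[k] d = e

/-- The number of faces (for a nonempty word). -/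
noncomputable def faceCount (w : Word) : ℕ :=
  Set.ncard {F : Set Dart | ∃ d : Dart, d.1 ∈ w ∧ F = {e | SameFace w d e}}

/-- The number of crossings. -/
def crossingCount (w : Word) : ℕ := (w.map Passage.crossing).toFinset.card

/-- The words of knot diagrams in the sphere: every crossing is passed exactly twice, once over and
once under, and with the same sign; and `V - E + F = 2`, where `E = 2 V` (so `F = V + 2`). -/
structure IsKnotDiagram (w : Word) : Prop where
  nodup : (w.map fun p => (p.crossing, p.isOver)).Nodup
  mate_mem : ∀ p ∈ w, p.mate ∈ w
  planar : w ≠ [] → faceCount w = crossingCount w + 2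

/-! ## Reidemeister moves -/

/-- Six passages, the consecutive pairs `a₁ a₂`, `b₁ b₂`, `c₁ c₂`, form the vertices of a triangle
to which a third Reidemeister move applies:
the three edges `a₁ a₂`, `b₁ b₂`, `c₁ c₂` pairwise meet in three crossings; these edges bound a
triangular face; and one of the three strands is above the other two.
For a passage `u` on one of the edges, the edge of the other strand through that crossing departs
to the left iff: it starts at `u.mate` and that strand crosses to the left, or it ends at `u.mate`
and that strand crosses to the right. The triangle is a face when at both ends of each edge the
other edge departs to the same side. -/
structure IsTriangle (a₁ a₂ b₁ b₂ c₁ c₂ : Passage) : Prop where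
  mate_mem : ∀ u ∈ [a₁, a₂, b₁, b₂, c₁, c₂], u.mate ∈ [a₁, a₂, b₁, b₂, c₁, c₂]
  not_mate : a₁.mate ≠ a₂ ∧ b₁.mate ≠ b₂ ∧ c₁.mate ≠ c₂
  side_a : (a₁.crossedToLeft = true ↔ a₁.mate ∈ [a₁, b₁, c₁]) ↔
    (a₂.crossedToLeft = true ↔ a₂.mate ∈ [a₁, b₁, c₁])
  side_b : (b₁.crossedToLeft = true ↔ b₁.mate ∈ [a₁, b₁, c₁]) ↔
    (b₂.crossedToLeft = true ↔ b₂.mate ∈ [a₁, b₁, c₁])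
  side_c : (c₁.crossedToLeft = true ↔ c₁.mate ∈ [a₁, b₁, c₁]) ↔
    (c₂.crossedToLeft = true ↔ c₂.mate ∈ [a₁, b₁, c₁])
  top : (a₁.isOver = true ∧ a₂.isOver = true) ∨ (b₁.isOver = true ∧ b₂.isOver = true) ∨
    (c₁.isOver = true ∧ c₂.isOver = true)

/-- One Reidemeister move, in one of its two directions, performed away from the base point. -/
inductive Move : Word → Word → Prop
  /-- First move: remove a kink, that is, two consecutive passages through one crossing. -/
  | r1 (l₁ l₂ : Word) (p : Passage) :
      Move (l₁ ++ [p, p.mate] ++ l₂) (l₁ ++ l₂)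
  /-- Second move, strands running in the same direction: one strand passes over both crossings
  of a bigon, and these have opposite signs. -/
  | r2_parallel (l₁ l₂ l₃ : Word) (p q : Passage) :
      p.isOver = q.isOver → p.positive ≠ q.positive →
      Move (l₁ ++ [p, q] ++ l₂ ++ [p.mate, q.mate] ++ l₃) (l₁ ++ l₂ ++ l₃)
  /-- Second move, strands running in opposite directions. -/
  | r2_antiparallel (l₁ l₂ l₃ : Word) (p q : Passage) :
      p.isOver = q.isOver → p.positive ≠ q.positive →
      Move (l₁ ++ [p, q] ++ l₂ ++ [q.mate, p.mate] ++ l₃) (l₁ ++ l₂ ++ l₃)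
  /-- Third move: each of the three strands meets the other two in the opposite order. -/
  | r3 (l₁ l₂ l₃ l₄ : Word) (a₁ a₂ b₁ b₂ c₁ c₂ : Passage) :
      IsTriangle a₁ a₂ b₁ b₂ c₁ c₂ →
      Move (l₁ ++ [a₁, a₂] ++ l₂ ++ [b₁, b₂] ++ l₃ ++ [c₁, c₂] ++ l₄)
        (l₁ ++ [a₂, a₁] ++ l₂ ++ [b₂, b₁] ++ l₃ ++ [c₂, c₁] ++ l₄)

/-- Renaming the crossings. -/
def rename (f : Equiv.Perm CrossingName) (w : Word) : Word :=
  w.map fun p => ⟨f p.crossing, p.isOver, p.positive⟩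

/-! ## Reidemeister distance in the sphere -/

/-- Two words describe the same diagram in the sphere: they differ in the names of the crossings,
or in the base point. -/
inductive SphereIso : Word → Word → Prop
  | rename (f : Equiv.Perm CrossingName) (w : Word) : SphereIso w (rename f w)
  | rebase (u v : Word) : SphereIso (u ++ v) (v ++ u)

/-- `SphereReach k w v`: some sequence of `k` Reidemeister moves on knot diagrams in the sphere
leads from `w` to `v`. -/
inductive SphereReach : ℕ → Word → Word → Prop
  | refl (w : Word) : IsKnotDiagram w → SphereReach 0 w w
  | iso {k : ℕ} {w v u : Word} : SphereReach k w v → SphereIso v u → SphereReach k w u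
  | move {k : ℕ} {w v u : Word} : SphereReach k w v → Move v u ∨ Move u v → IsKnotDiagram u →
      SphereReach (k + 1) w u

/-- Reidemeister distance in the sphere: the least number of moves (`⊤` if there is none). -/
noncomputable def sphereDist (w v : Word) : ℕ∞ :=
  ⨅ (k : ℕ) (_ : SphereReach k w v), (k : ℕ∞)

/-! ## Reidemeister distance in the plane -/

/-- A knot diagram in the plane is one in the sphere with a distinguished face, the unbounded one.
The base point is chosen on the boundary of that face, and one records whether it lies to the
left of the base edge or to the right. -/
structure PlaneWord where
  word : Word
  outerLeft : Bool

/-- Two words describe the same diagram in the plane: they differ in the names of the crossings,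
or in the base point, which may be any point on the boundary of the unbounded face. -/
inductive PlaneIso : PlaneWord → PlaneWord → Prop
  | rename (f : Equiv.Perm CrossingName) (w : Word) (s : Bool) : PlaneIso ⟨w, s⟩ ⟨rename f w, s⟩
  | rebase (u v : Word) (x y : Passage) (s t : Bool) :
      SameFace (u ++ [x] ++ v ++ [y]) (y, s) (x, t) →
      PlaneIso ⟨u ++ [x] ++ v ++ [y], s⟩ ⟨v ++ [y] ++ u ++ [x], t⟩

/-- `PlaneReach k w v`: some sequence of `k` Reidemeister moves on knot diagrams in the plane leads
from `w` to `v`. The moves happen away from the base point, so that the monogon, bigon or triangle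
is not the unbounded face, and the unbounded face stays on its side of the base edge. -/
inductive PlaneReach : ℕ → PlaneWord → PlaneWord → Prop
  | refl (w : PlaneWord) : IsKnotDiagram w.word → PlaneReach 0 w w
  | iso {k : ℕ} {w v u : PlaneWord} : PlaneReach k w v → PlaneIso v u → PlaneReach k w u
  | move {k : ℕ} {w : PlaneWord} {v u : Word} {s : Bool} : PlaneReach k w ⟨v, s⟩ →
      Move v u ∨ Move u v → IsKnotDiagram u → PlaneReach (k + 1) w ⟨u, s⟩

/-- Reidemeister distance in the plane: the least number of moves (`⊤` if there is none). -/
noncomputable def planeDist (w v : PlaneWord) : ℕ∞ :=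
  ⨅ (k : ℕ) (_ : PlaneReach k w v), (k : ℕ∞)

/-! ## The diagrams -/

/-- The trivial diagram in the sphere. -/
def U : Word := []

/-- The trivial diagram in the plane, a round circle: clockwise if the unbounded face is on its
left, counterclockwise if not. -/
def planeU (outerLeft : Bool) : PlaneWord := ⟨[], outerLeft⟩

/-- Crossing number `i` of the upper twisted pair of strands (positive crossings). -/
def top (i : ℕ) (isOver : Bool) : Passage := ⟨(0, i), isOver, true⟩

/-- Crossing number `i` of the lower twisted pair of strands (negative crossings). -/
def bottom (i : ℕ) (isOver : Bool) : Passage := ⟨(1, i), isOver, false⟩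

/-- The crossing of the left vertical strand with horizontal strand `j` (negative). -/
def left (j : ℕ) (isOver : Bool) : Passage := ⟨(2, j), isOver, false⟩

/-- The crossing of the middle vertical strand with horizontal strand `j` (positive). -/
def middle (j : ℕ) (isOver : Bool) : Passage := ⟨(3, j), isOver, true⟩

/-- The crossing of the right vertical strand with horizontal strand `j` (positive). -/
def right (j : ℕ) (isOver : Bool) : Passage := ⟨(4, j), isOver, true⟩

/-- The diagram with `7 n - 1` crossings. Two parallel strands run clockwise: they twist about one
another `2 n - 1` times along the top, go down as the middle and the right vertical strand, over
`n` horizontal strands, and twist `2 n` times along the bottom in the opposite sense. One of them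
then goes up as the left vertical strand, over the horizontal strands, and back to the top; the
other one winds clockwise `n` times, and so forms the `n` horizontal strands, numbered from below
and running to the right. -/
def D (n : ℕ) : Word :=
  (List.range (2 * n - 1)).map (fun i => top i (decide (Even i))) ++
  (List.range n).reverse.map (fun j => middle j true) ++
  (List.range (2 * n)).map (fun i => bottom i (decide (Even i))) ++
  (List.range n).map (fun j => left j true) ++
  (List.range (2 * n - 1)).map (fun i => top i (decide (Odd i))) ++
  (List.range n).reverse.map (fun j => right j true) ++
  (List.range (2 * n)).map (fun i => bottom i (decide (Odd i))) ++
  (List.range n).flatMap (fun j => [left j false, middle j false, right j false])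

/-- The same diagram in the plane. The base edge leads from the end of the uppermost horizontal
strand round the outside of the whole diagram, clockwise, to the top; so the unbounded face is on
its left. -/
def planeD (n : ℕ) : PlaneWord := ⟨D n, true⟩

end KnotDiag

namespace KnotDiag

/-! ## Euler characteristic and exactness -/

/-! Upper bound. The horizontal strands are removed one by one, the uppermost first. Each is pulled
under the `2 n - 1` crossings of the upper twist by third moves; then its crossings with the left
and the right vertical strand form a bigon and disappear by one second move
(`reduces_partialD_succ`). Now nothing separates the two twists, and `2 n - 1` second moves cancel
the upper twist against the lower one (`reduces_twists`). One lower crossing is left over; it is a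
kink, and after its removal the crossings `middle j` are nested kinks (`reduces_kinks`). The total
is `n * (2 n) + (2 n - 1) + 1 + n`.

Every intermediate word has to be planar. Counting faces along the moves is awkward, so Euler's
formula is replaced by a homological condition, `Exact`: every rational circulation on the edges is
the difference of the face labels on the two sides. Rank-nullity gives `F ≤ V + 2` for every
nonempty Gauss word, with equality exactly under this condition (`IsGaussWord.euler`). It is
inherited along moves by extending circulations and restricting or correcting labels
(`Exact.remove_kink`, `Exact.remove_bigon`, `Exact.slide_of_frame`). For `D n` itself, a labelling
with `V + 2` different face labels suffices (`isFaceLabelling_D`).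

Lower bound. Smoothing a crossing `c` yields a two-component link, whose linking number `lk c` is
half the sum of the signs of the crossings interlaced with `c`. The invariant `weight` is `8` times
the sum of `sign c * (|lk c| + 1)` over all crossings. It vanishes on the circle, and each move
changes it by at most `8`: a kink has `lk = 0`; the two crossings of a bigon have opposite signs and
linking numbers that differ by at most `1`; in a third move at most one of the three linking numbers
changes, and by at most `1`, because two of the three smoothings change only by an isotopy
(`IsTriangle.signs`). In `D n` the positive crossings `middle j` and `right j` have linking numbers
`n` and `-n`. The absolute value makes these add up to the quadratic term, and `weight_D` gives `8 *
(2 n ^ 2 + 3 n - 2)`. -/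

theorem finrank_ker_eq_one_of_constants {V M : Type*} [Fintype V] [Nonempty V] [AddCommGroup M]
    [Module ℚ M] (d : (V → ℚ) →ₗ[ℚ] M) (h1 : d 1 = 0)
    (h : ∀ f, d f = 0 → ∀ x y, f x = f y) : Module.finrank ℚ (LinearMap.ker d) = 1 := by
  have hspan : LinearMap.ker d = Submodule.span ℚ {(1 : V → ℚ)} := by
    ext f
    rw [LinearMap.mem_ker, Submodule.mem_span_singleton]
    constructor
    · intro hf
      refine ⟨f (Classical.arbitrary V), ?_⟩
      ext x
      simp [h f hf x (Classical.arbitrary V)]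
    · rintro ⟨a, rfl⟩
      simp [h1]
  rw [hspan, finrank_span_singleton one_ne_zero]

/-- A finite connected graph with edges `E` and vertices `V`, drawn on a surface with faces `Q`:
every circulation is a boundary as soon as Euler's formula holds, and conversely. -/
theorem circulations_are_boundaries {E V Q : Type*} [Fintype E] [Fintype V] [Fintype Q]
    [DecidableEq V] [Nonempty V] [Nonempty Q] (s t : E → V) (l r : E → Q)
    (hV : ∀ f : V → ℚ, (∀ e, f (s e) = f (t e)) → ∀ x y, f x = f y)
    (hQ : ∀ g : Q → ℚ, (∀ e, g (l e) = g (r e)) → ∀ x y, g x = g y)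
    (hcyc : ∀ (g : Q → ℚ) (x : V), ∑ e with s e = x, (g (l e) - g (r e)) =
      ∑ e with t e = x, (g (l e) - g (r e))) :
    Fintype.card Q + Fintype.card V ≤ Fintype.card E + 2 ∧
    ((∀ v : E → ℚ, (∀ x, ∑ e with s e = x, v e = ∑ e with t e = x, v e) →
      ∃ g : Q → ℚ, ∀ e, g (l e) - g (r e) = v e) ↔
    Fintype.card Q + Fintype.card V = Fintype.card E + 2) := by
  classical
  let M : Matrix V E ℚ :=
    Matrix.of fun x e => (if s e = x then 1 else 0) - (if t e = x then 1 else 0)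
  let b : (Q → ℚ) →ₗ[ℚ] (E → ℚ) := LinearMap.funLeft ℚ ℚ l - LinearMap.funLeft ℚ ℚ r
  have hb : ∀ g e, b g e = g (l e) - g (r e) := fun g e => rfl
  have hM : ∀ v x, M.mulVecLin v x = ∑ e with s e = x, v e - ∑ e with t e = x, v e := by
    intro v x
    rw [Matrix.mulVecLin_apply]
    simp [M, Matrix.mulVec, dotProduct, sub_mul, Finset.sum_filter, Finset.sum_sub_distrib]
  have hMt : ∀ f e, M.transpose.mulVecLin f e = f (s e) - f (t e) := by
    intro f e
    rw [Matrix.mulVecLin_apply]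
    simp [M, Matrix.mulVec, dotProduct, sub_mul, Finset.sum_sub_distrib]
  have kerb : Module.finrank ℚ (LinearMap.ker b) = 1 := by
    apply finrank_ker_eq_one_of_constants
    · ext e; simp [hb]
    · intro g hg
      exact hQ g fun e => sub_eq_zero.1 (by rw [← hb, hg]; rfl)
  have kerMt : Module.finrank ℚ (LinearMap.ker M.transpose.mulVecLin) = 1 := by
    apply finrank_ker_eq_one_of_constants
    · ext e; rw [hMt]; simp
    · intro g hg
      exact hV g fun e => sub_eq_zero.1 (by rw [← hMt, hg]; rfl)
  -- Rank-nullity three times: the image of `b` has dimension `|Q| - 1`; `M` has the rank `|V| - 1`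
  -- of its transpose, so its kernel has dimension `|E| - |V| + 1`. As the image of `b` lies in this
  -- kernel, the inequality follows, with equality exactly when the two spaces agree.
  have e1 := LinearMap.finrank_range_add_finrank_ker b
  have e2 := LinearMap.finrank_range_add_finrank_ker M.transpose.mulVecLin
  have e3 := LinearMap.finrank_range_add_finrank_ker M.mulVecLin
  have e4 : Module.finrank ℚ (LinearMap.range M.transpose.mulVecLin) =
    Module.finrank ℚ (LinearMap.range M.mulVecLin) := Matrix.rank_transpose M
  rw [kerb] at e1
  rw [kerMt, e4] at e2
  simp only [Module.finrank_fintype_fun_eq_card] at e1 e2 e3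
  have hle : LinearMap.range b ≤ LinearMap.ker M.mulVecLin := by
    rintro _ ⟨g, rfl⟩
    rw [LinearMap.mem_ker]
    ext x
    rw [hM]
    simp only [hb, hcyc g x, sub_self, Pi.zero_apply]
  have hfin := Submodule.finrank_mono hle
  refine ⟨by omega, ?_, ?_⟩
  · intro hex
    have hge : LinearMap.ker M.mulVecLin ≤ LinearMap.range b := by
      intro v hv
      obtain ⟨g, hg⟩ := hex v fun x => sub_eq_zero.1 (by rw [← hM, LinearMap.mem_ker.1 hv]; rfl)
      exact ⟨g, funext hg⟩
    have := Submodule.finrank_mono hge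
    omega
  · intro hcard v hv
    have heq : LinearMap.range b = LinearMap.ker M.mulVecLin :=
      Submodule.eq_of_le_of_finrank_eq hle (by omega)
    have hmem : v ∈ LinearMap.range b := by
      rw [heq, LinearMap.mem_ker]
      ext x
      rw [hM, hv x, sub_self]; rfl
    obtain ⟨g, hg⟩ := hmem
    exact ⟨g, fun e => by rw [← hb, hg]⟩

/-! ## Values on the edges of a word -/

/-- Reading `w` from an edge with value `a`, one meets edges with the values that `i` and `o` give
to the edges into and out of each passage, and ends on an edge with value `b`. -/
def Path {A : Type*} (i o : Passage → A) : A → Word → A → Prop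
  | a, [], b => a = b
  | a, p :: w, b => i p = a ∧ Path i o (o p) w b

section Path
variable {A : Type*} {i o i' o' : Passage → A} {a b : A} {u v w : Word} {p : Passage}

@[simp] theorem path_nil : Path i o a [] b ↔ a = b := Iff.rfl

@[simp] theorem path_cons : Path i o a (p :: w) b ↔ i p = a ∧ Path i o (o p) w b := Iff.rfl

theorem path_append : Path i o a (u ++ v) b ↔ ∃ c, Path i o a u c ∧ Path i o c v b := by
  induction u generalizing a with
  | nil => simp
  | cons p u ih => simp [ih, and_assoc]

theorem Path.congr (h : Path i o a w b) (hi : ∀ p ∈ w, i' p = i p) (ho : ∀ p ∈ w, o' p = o p) :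
    Path i' o' a w b := by
  induction w generalizing a with
  | nil => exact h
  | cons p w ih =>
    simp only [List.mem_cons, forall_eq_or_imp] at hi ho
    rw [path_cons, hi.1, ho.1]
    exact ⟨h.1, ih h.2 hi.2 ho.2⟩

theorem path_map_range (f : ℕ → Passage) (e : ℕ → A) (m : ℕ)
    (h : ∀ k < m, i (f k) = e k ∧ o (f k) = e (k + 1)) :
    Path i o (e 0) ((List.range m).map f) (e m) := by
  induction m with
  | zero => simp
  | succ m ih =>
    rw [List.range_succ, List.map_append, path_append]
    exact ⟨e m, ih fun k hk => h k (by omega), by simpa using h m (by omega)⟩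

theorem path_map_reverse_range (f : ℕ → Passage) (e : ℕ → A) (m : ℕ)
    (h : ∀ k < m, i (f k) = e (k + 1) ∧ o (f k) = e k) :
    Path i o (e m) ((List.range m).reverse.map f) (e 0) := by
  induction m with
  | zero => simp
  | succ m ih =>
    rw [List.range_succ, List.reverse_append, List.map_append, path_append]
    exact ⟨e m, by simpa using h m (by omega), ih fun k hk => h k (by omega)⟩

theorem path_flatMap_range (f : ℕ → Word) (e : ℕ → A) (m : ℕ)
    (h : ∀ k < m, Path i o (e k) (f k) (e (k + 1))) :
    Path i o (e 0) ((List.range m).flatMap f) (e m) := by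
  induction m with
  | zero => simp
  | succ m ih =>
    rw [List.range_succ, List.flatMap_append, path_append]
    exact ⟨e m, ih fun k hk => h k (by omega), by simpa using h m (by omega)⟩

theorem Path.getElem (h : Path i o a w b) :
    (∀ hw : 0 < w.length, i w[0] = a ∧ o w[w.length - 1] = b) ∧
    ∀ (k : ℕ) (hk : k + 1 < w.length), i w[k + 1] = o w[k] := by
  induction w generalizing a with
  | nil => simp
  | cons p w ih =>
    obtain ⟨h1, h2⟩ := ih h.2
    refine ⟨fun _ => ⟨h.1, ?_⟩, ?_⟩
    · rcases w with _ | ⟨q, w⟩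
      · exact h.2
      · simpa using (h1 (by simp)).2
    · rintro (_ | k) hk
      · exact (h1 (by simpa using hk)).1
      · simpa using h2 k (by simpa using hk)

/-- Paths are convenient for cutting and pasting words, `formPerm` for running round faces. This
lemma and `exists_path_of_formPerm` translate between the two descriptions of a function on the
edges. -/
theorem Path.formPerm (h : Path i o a w a) (hw : w.Nodup) (hp : p ∈ w) :
    i (w.formPerm p) = o p := by
  obtain ⟨k, hk, rfl⟩ := List.getElem_of_mem hp
  rw [List.formPerm_apply_getElem _ hw]
  obtain ⟨h1, h2⟩ := h.getElem
  rcases Nat.lt_or_ge (k + 1) w.length with hlt | hge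
  · simp only [Nat.mod_eq_of_lt hlt]
    exact h2 k hlt
  · have hk' : k + 1 = w.length := by omega
    obtain ⟨h3, h4⟩ := h1 (by omega)
    simp only [hk', Nat.mod_self, h3, ← h4]
    congr 2
    omega

theorem path_of_getElem (h : ∀ (k : ℕ) (hk : k + 1 < w.length), i w[k + 1] = o w[k])
    (hw : 0 < w.length) : Path i o (i w[0]) w (o w[w.length - 1]) := by
  induction w with
  | nil => simp at hw
  | cons p w ih =>
    rcases w with _ | ⟨q, w⟩
    · simp
    · have := ih (fun k hk => h (k + 1) (by simpa using hk)) (by simp)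
      refine ⟨rfl, ?_⟩
      have h0 := h 0 (by simp)
      simp only [List.getElem_cons_zero, List.getElem_cons_succ, zero_add] at h0 this
      rw [← h0]
      simpa using this

theorem exists_path_of_formPerm (hw : w.Nodup) (hne : w ≠ [])
    (h : ∀ p ∈ w, i (w.formPerm p) = o p) :
    ∃ q ∈ w, Path i o (o q) w (o q) := by
  have hpos : 0 < w.length := List.length_pos_iff.2 hne
  -- The path begins and ends on the base edge, which leaves the last letter.
  refine ⟨w[w.length - 1], List.getElem_mem _, ?_⟩
  have h0 := h w[w.length - 1] (List.getElem_mem _)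
  rw [List.formPerm_apply_getElem _ hw] at h0
  have : w.length - 1 + 1 = w.length := by omega
  simp only [this, Nat.mod_self] at h0
  have hpath : Path i o (i w[0]) w (o w[w.length - 1]) := by
    refine path_of_getElem (fun k hk => ?_) hpos
    have := h w[k] (List.getElem_mem _)
    rw [List.formPerm_apply_getElem _ hw] at this
    simpa only [Nat.mod_eq_of_lt hk] using this
  rwa [h0] at hpath

/-- A function that is constant along the edges is constant. -/
theorem eq_of_formPerm_eq {f : Passage → A} (hw : w.Nodup) (h : ∀ p ∈ w, f (w.formPerm p) = f p)
    {q : Passage} (hp : p ∈ w) (hq : q ∈ w) : f p = f q := by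
  have key : ∀ (k : ℕ) (hk : k < w.length), f w[k] = f (w[0]'(by omega)) := by
    intro k
    induction k with
    | zero => intro _; rfl
    | succ k ih =>
      intro hk
      rw [← ih (by omega), ← h w[k] (List.getElem_mem _), List.formPerm_apply_getElem _ hw]
      simp only [Nat.mod_eq_of_lt hk]
  obtain ⟨k, hk, rfl⟩ := List.getElem_of_mem hp
  obtain ⟨m, hm, rfl⟩ := List.getElem_of_mem hq
  rw [key k hk, key m hm]

end Path

section

/-! ## Passages and Gauss words -/

@[simp] theorem Passage.mate_mate (p : Passage) : p.mate.mate = p := by simp [Passage.mate]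

@[simp] theorem Passage.mate_crossing (p : Passage) : p.mate.crossing = p.crossing := rfl

@[simp] theorem Passage.mate_isOver (p : Passage) : p.mate.isOver = !p.isOver := rfl

@[simp] theorem Passage.mate_positive (p : Passage) : p.mate.positive = p.positive := rfl

theorem Passage.mate_ne (p : Passage) : p.mate ≠ p := fun h => by
  have := congrArg Passage.isOver h
  simp at this

@[simp] theorem Passage.mate_crossedToLeft (p : Passage) :
    p.mate.crossedToLeft = !p.crossedToLeft := by
  rcases p with ⟨c, o, s⟩
  cases o <;> cases s <;> rfl

theorem Passage.mate_injective : Function.Injective Passage.mate := fun p q h => by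
  rw [← p.mate_mate, h, q.mate_mate]

/-- Every crossing is passed exactly twice, once over and once under, and with the same sign. -/
structure IsGaussWord (w : Word) : Prop where
  nodup : (w.map fun p => (p.crossing, p.isOver)).Nodup
  mate_mem : ∀ p ∈ w, p.mate ∈ w

theorem IsKnotDiagram.isGaussWord {w : Word} (h : IsKnotDiagram w) : IsGaussWord w :=
  ⟨h.nodup, h.mate_mem⟩

theorem IsGaussWord.isKnotDiagram {w : Word} (h : IsGaussWord w)
    (hp : w ≠ [] → faceCount w = crossingCount w + 2) : IsKnotDiagram w :=
  ⟨h.nodup, h.mate_mem, hp⟩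

variable {w : Word}

theorem IsGaussWord.nodup_word (h : IsGaussWord w) : w.Nodup := List.Nodup.of_map _ h.nodup

theorem IsGaussWord.eq_or_eq_mate (h : IsGaussWord w) {p q : Passage} (hp : p ∈ w) (hq : q ∈ w)
    (hc : p.crossing = q.crossing) : p = q ∨ p = q.mate := by
  have hinj := List.inj_on_of_nodup_map h.nodup
  by_cases ho : p.isOver = q.isOver
  · exact Or.inl (hinj hp hq (by simp [hc, ho]))
  · refine Or.inr (hinj hp (h.mate_mem q hq) ?_)
    simp only [Passage.mate_crossing, Passage.mate_isOver, hc, Prod.mk.injEq, true_and]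
    revert ho
    cases p.isOver <;> cases q.isOver <;> simp

theorem IsGaussWord.length_eq (h : IsGaussWord w) : w.length = 2 * crossingCount w := by
  classical
  rw [← List.toFinset_card_of_nodup h.nodup_word,
    Finset.card_eq_sum_card_image Passage.crossing w.toFinset]
  have himg : w.toFinset.image Passage.crossing = (w.map Passage.crossing).toFinset := by
    ext; simp
  rw [himg, Finset.sum_const_nat (m := 2), crossingCount, mul_comm]
  intro c hc
  obtain ⟨p, hp, rfl⟩ := by simpa using hc
  have : ({q ∈ w.toFinset | q.crossing = p.crossing} : Finset Passage) = {p, p.mate} := by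
    ext q
    simp only [Finset.mem_filter, List.mem_toFinset, Finset.mem_insert, Finset.mem_singleton]
    constructor
    · rintro ⟨hq, hc⟩
      exact h.eq_or_eq_mate hq hp hc
    · rintro (rfl | rfl)
      · exact ⟨hp, rfl⟩
      · exact ⟨h.mate_mem _ hp, rfl⟩
  rw [this, Finset.card_pair p.mate_ne.symm]

/-! ## Faces -/

/-- On the finitely many darts of a word an injective map is a permutation. Hence its forward orbits
are cycles, and `SameFace` is symmetric there although it only iterates forwards. -/
theorem faceNext_injective (w : Word) : Function.Injective (faceNext w) := by
  have hf := w.formPerm.injective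
  have hs := w.formPerm.symm.injective
  rintro ⟨p, b⟩ ⟨q, c⟩ h
  cases b <;> cases c <;> simp only [faceNext] at h <;> split_ifs at h with h1 h2 h2 <;>
    simp only [Prod.mk.injEq, and_true, Bool.false_eq_true, Bool.true_eq_false, and_false, hs.eq_iff,
      hf.eq_iff, Passage.mate_injective.eq_iff] at h <;> simp_all

theorem formPerm_symm_mem {p : Passage} (hp : p ∈ w) : w.formPerm.symm p ∈ w := by
  have := (List.formPerm_mem_iff_mem (l := w) (x := w.formPerm.symm p))
  rw [← this]
  simpa using hp

theorem IsGaussWord.faceNext_mem (h : IsGaussWord w) {d : Dart} (hd : d.1 ∈ w) :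
    (faceNext w d).1 ∈ w := by
  obtain ⟨p, b⟩ := d
  have hq : w.formPerm p ∈ w := List.formPerm_apply_mem_of_mem hd
  cases b <;> simp only [faceNext] <;> split_ifs
  · exact formPerm_symm_mem (h.mate_mem _ hd)
  · exact h.mate_mem _ hd
  · exact h.mate_mem _ hq
  · exact formPerm_symm_mem (h.mate_mem _ hq)

theorem IsGaussWord.exists_iterate_faceNext (h : IsGaussWord w) {d : Dart} (hd : d.1 ∈ w) :
    ∃ k, (faceNext w)^[k] (faceNext w d) = d := by
  let S := {d : Dart | d.1 ∈ w}
  have hS : S.Finite := by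
    refine Set.Finite.subset (Set.Finite.prod (List.finite_toSet w) (Set.finite_univ (α := Bool))) ?_
    rintro ⟨p, b⟩ hp
    exact ⟨hp, Set.mem_univ _⟩
  have : Finite S := hS
  have hm : Set.MapsTo (faceNext w) S S := fun e he => h.faceNext_mem he
  have hinj : Function.Injective (hm.restrict (faceNext w) S S) := fun a b hab =>
    Subtype.ext (faceNext_injective w (congrArg Subtype.val hab))
  obtain ⟨n, hn, hper⟩ := hinj.mem_periodicPts ⟨d, hd⟩
  obtain ⟨k, rfl⟩ : ∃ k, n = k + 1 := ⟨n - 1, by omega⟩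
  refine ⟨k, ?_⟩
  have h1 := congrArg Subtype.val hper
  rw [hm.iterate_restrict] at h1
  rw [← Function.iterate_succ_apply]
  exact h1

/-- The face to the left of a directed edge. -/
def faceOf (w : Word) (d : Dart) : Set Dart := {e | SameFace w d e}

/-- The orbit returns to `d`, so moving the starting point one step forwards loses nothing. -/
theorem IsGaussWord.faceOf_faceNext (h : IsGaussWord w) {d : Dart} (hd : d.1 ∈ w) :
    faceOf w (faceNext w d) = faceOf w d := by
  obtain ⟨k, hk⟩ := h.exists_iterate_faceNext hd
  ext e
  constructor
  · rintro ⟨m, hm⟩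
    exact ⟨m + 1, by rw [Function.iterate_succ_apply, hm]⟩
  · rintro ⟨m, hm⟩
    exact ⟨m + k, by rw [Function.iterate_add_apply, hk, hm]⟩

/-- At each crossing, the edges that bound the same corner have the same value there. -/
def Corners {A : Type*} (li lo ri ro : Passage → A) (p : Passage) : Prop :=
  li p = lo p.mate ∧ li p.mate = ri p ∧ ro p = ri p.mate ∧ ro p.mate = lo p

/-- The faces carry labels: `li p` and `ri p` to the left and to the right of the edge into the
passage `p`, and `lo p` and `ro p` to the left and to the right of the edge out of it. -/
structure IsFaceLabelling {A : Type*} (w : Word) (a b : A) (li lo ri ro : Passage → A) : Prop where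
  left : Path li lo a w a
  right : Path ri ro b w b
  corner : ∀ p ∈ w, p.crossedToLeft = true → Corners li lo ri ro p

/-- Each of the four corners at a crossing is one left turn of `faceNext`, and the four equations
come from these turns. -/
theorem corners_of_faceNext {A : Type*} {φ : Dart → A}
    (hφ : ∀ d : Dart, d.1 ∈ w → φ (faceNext w d) = φ d) (h : IsGaussWord w) {p : Passage}
    (hp : p ∈ w) (hl : p.crossedToLeft = true) :
    Corners (fun p => φ (w.formPerm.symm p, true)) (fun p => φ (p, true))
      (fun p => φ (w.formPerm.symm p, false)) (fun p => φ (p, false)) p := by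
  have h1 := hφ (w.formPerm.symm p, true) (formPerm_symm_mem hp)
  have h2 := hφ (w.formPerm.symm p.mate, true) (formPerm_symm_mem (h.mate_mem _ hp))
  have h3 := hφ (p, false) hp
  have h4 := hφ (p.mate, false) (h.mate_mem _ hp)
  simp [faceNext, hl] at h1 h2 h3 h4
  exact ⟨h1.symm, h2.symm, h3.symm, h4.symm⟩

/-- The label of the face on the left of a directed edge. -/
def dartLabel {A : Type*} (lo ro : Passage → A) : Dart → A
  | (p, true) => lo p
  | (p, false) => ro p

/-- Converse to `corners_of_faceNext`: each branch of `faceNext` turns through a corner listed in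
`Corners`. Thus labels are functions of the face, and different labels detect different faces. -/
theorem IsFaceLabelling.apply_faceNext {A : Type*} {a b : A} {li lo ri ro : Passage → A}
    (hL : IsFaceLabelling w a b li lo ri ro) (h : IsGaussWord w) (d : Dart) (hd : d.1 ∈ w) :
    dartLabel lo ro (faceNext w d) = dartLabel lo ro d := by
  have hl : ∀ q ∈ w, lo (w.formPerm.symm q) = li q := fun q hq => by
    rw [← hL.left.formPerm h.nodup_word (formPerm_symm_mem hq), Equiv.apply_symm_apply]
  have hr : ∀ q ∈ w, ro (w.formPerm.symm q) = ri q := fun q hq => by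
    rw [← hL.right.formPerm h.nodup_word (formPerm_symm_mem hq), Equiv.apply_symm_apply]
  obtain ⟨p, b⟩ := d
  simp only at hd
  have hq : w.formPerm p ∈ w := List.formPerm_apply_mem_of_mem hd
  have hl' := hL.left.formPerm h.nodup_word hd
  cases b <;> simp only [faceNext]
  · split <;> rename_i hc
    · simp only [dartLabel]
      rw [hr _ (h.mate_mem _ hd), (hL.corner p hd hc).2.2.1]
    · have := hL.corner p.mate (h.mate_mem _ hd) (by simpa using hc)
      simpa [dartLabel] using this.2.2.2.symm
  · split <;> rename_i hc
    · simpa [hl', dartLabel] using (hL.corner _ hq hc).1.symm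
    · have := hL.corner _ (h.mate_mem _ hq) (by simpa using hc)
      simp only [dartLabel]
      rw [hr _ (h.mate_mem _ hq), ← this.2.1, Passage.mate_mate, hl']

/-! ### Exactness as a form of Euler's formula -/

/-- Every circulation on the edges is the difference of face labels. -/
def Exact (w : Word) : Prop :=
  ∀ (i o : Passage → ℚ) (a : ℚ), Path i o a w a → (∀ p ∈ w, i p + i p.mate = o p + o p.mate) →
    ∃ (x y : ℚ) (li lo ri ro : Passage → ℚ), IsFaceLabelling w x y li lo ri ro ∧ x - y = a ∧
      ∀ p ∈ w, li p - ri p = i p ∧ lo p - ro p = o p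

/-- The faces of a word. -/
abbrev Face (w : Word) := {F : Set Dart // ∃ d : Dart, d.1 ∈ w ∧ F = {e | SameFace w d e}}

instance (w : Word) : Finite (Face w) := by
  have : Finite {p // p ∈ w} := List.finite_toSet w
  refine Finite.of_surjective
    (fun d : {p // p ∈ w} × Bool => (⟨faceOf w (d.1, d.2), _, d.1.2, rfl⟩ : Face w)) ?_
  rintro ⟨F, ⟨p, b⟩, hp, rfl⟩
  exact ⟨⟨⟨p, hp⟩, b⟩, rfl⟩

/-- This is `circulations_are_boundaries` for the 4-valent graph of the diagram: an edge is named by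
the passage it leaves, so there are twice as many edges as crossings, and the graph is connected
because a single curve runs through all of it. -/
theorem IsGaussWord.euler (h : IsGaussWord w) (hne : w ≠ []) :
    faceCount w ≤ crossingCount w + 2 ∧ (faceCount w = crossingCount w + 2 ↔ Exact w) := by
  classical
  have hFin : Fintype (Face w) := Fintype.ofFinite _
  have hcard : faceCount w = Fintype.card (Face w) := by
    rw [← Nat.card_eq_fintype_card]; rfl
  let V := {c // c ∈ (w.map Passage.crossing).toFinset}
  have hVcard : Fintype.card V = crossingCount w := Fintype.card_coe _
  let E := {p // p ∈ w}
  have hEcard : Fintype.card E = 2 * crossingCount w := by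
    rw [← h.length_eq, ← List.toFinset_card_of_nodup h.nodup_word, Fintype.card_of_subtype]
    simp
  obtain ⟨p₀, hp₀⟩ := List.exists_mem_of_ne_nil w hne
  let cr : E → V := fun p => ⟨p.1.crossing, by simpa using ⟨p.1, p.2, rfl⟩⟩
  let nx : E → E := fun p => ⟨w.formPerm p.1, List.formPerm_apply_mem_of_mem p.2⟩
  let pv : E → E := fun p => ⟨w.formPerm.symm p.1, formPerm_symm_mem p.2⟩
  let mt : E → E := fun p => ⟨p.1.mate, h.mate_mem _ p.2⟩
  let l : E → Face w := fun p => ⟨faceOf w (p.1, true), _, p.2, rfl⟩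
  let r : E → Face w := fun p => ⟨faceOf w (p.1, false), _, p.2, rfl⟩
  have hfib : ∀ p : E, (Finset.univ.filter fun e => cr e = cr p) = {p, mt p} := by
    intro p
    ext q
    simp only [Finset.mem_filter, Finset.mem_univ, true_and, Finset.mem_insert,
      Finset.mem_singleton]
    constructor
    · intro hc
      exact (h.eq_or_eq_mate q.2 p.2 (congrArg Subtype.val hc)).imp Subtype.ext Subtype.ext
    · rintro (rfl | rfl) <;> rfl
  have hne_mt : ∀ p : E, p ≠ mt p := fun p hp => p.1.mate_ne (congrArg Subtype.val hp).symm
  have hsum : ∀ (v : E → ℚ) (p : E), ∑ e with cr e = cr p, v e = v p + v (mt p) := by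
    intro v p
    rw [hfib, Finset.sum_pair (hne_mt p)]
  have hnx : ∀ p, nx (pv p) = p := fun p => Subtype.ext (by simp [nx, pv])
  have hpv : ∀ p, pv (nx p) = p := fun p => Subtype.ext (by simp [nx, pv])
  have hsum' : ∀ (v : E → ℚ) (p : E),
      ∑ e with cr (nx e) = cr p, v e = v (pv p) + v (pv (mt p)) := by
    intro v p
    have hinj : Function.Injective pv := fun a b hab => by rw [← hnx a, hab, hnx]
    have : (Finset.univ.filter fun e => cr (nx e) = cr p) = {pv p, pv (mt p)} := by
      ext q
      have h1 : nx q ∈ (Finset.univ.filter fun e => cr e = cr p) ↔ nx q ∈ ({p, mt p} : Finset E) := by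
        rw [hfib]
      simp only [Finset.mem_filter, Finset.mem_univ, true_and, Finset.mem_insert,
        Finset.mem_singleton] at h1 ⊢
      have h2 : ∀ a b : E, nx a = b ↔ a = pv b := fun a b =>
        ⟨fun hab => by rw [← hab, hpv], fun hab => by rw [hab, hnx]⟩
      rw [h1, h2, h2]
    rw [this, Finset.sum_pair (hinj.ne (hne_mt p))]
  have corner : ∀ g : Face w → ℚ, ∀ p : E, p.1.crossedToLeft = true →
      g (l (pv p)) = g (l (mt p)) ∧ g (l (pv (mt p))) = g (r (pv p)) ∧
      g (r p) = g (r (pv (mt p))) ∧ g (r (mt p)) = g (l p) := by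
    intro g p hl
    have hc := corners_of_faceNext (φ := faceOf w) (fun d hd => h.faceOf_faceNext hd) h p.2 hl
    refine ⟨?_, ?_, ?_, ?_⟩ <;> congr 1 <;> apply Subtype.ext
    exacts [hc.1, hc.2.1, hc.2.2.1, hc.2.2.2]
  have hmt : ∀ p : E, mt (mt p) = p := fun p => Subtype.ext p.1.mate_mate
  -- Of the two passages through a crossing exactly one is crossed to the left, so it suffices to
  -- treat both passages from the point of view of that one.
  have cornerBoth : ∀ (P : E → Prop), (∀ p : E, p.1.crossedToLeft = true → P p ∧ P (mt p)) →
      ∀ p, P p := by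
    intro P hP p
    by_cases hl : p.1.crossedToLeft = true
    · exact (hP p hl).1
    · have := (hP (mt p) (by simpa [mt] using hl)).2
      rwa [hmt] at this
  have hVsurj : ∀ x : V, ∃ p : E, cr p = x := by
    rintro ⟨c, hc⟩
    obtain ⟨p, hp, rfl⟩ := List.mem_map.1 (List.mem_toFinset.1 hc)
    exact ⟨⟨p, hp⟩, rfl⟩
  have : Nonempty V := ⟨cr ⟨p₀, hp₀⟩⟩
  have : Nonempty (Face w) := ⟨l ⟨p₀, hp₀⟩⟩
  have constant : ∀ f : E → ℚ, (∀ p, f (nx p) = f p) → ∀ p q, f p = f q := by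
    intro f hf p q
    let f' : Passage → ℚ := fun p => if hp : p ∈ w then f ⟨p, hp⟩ else 0
    have := eq_of_formPerm_eq (f := f') h.nodup_word (fun p hp => by
      have := hf ⟨p, hp⟩
      simp only [f', hp, List.formPerm_apply_mem_of_mem hp, dif_pos]
      exact this) p.2 q.2
    simpa [f', p.2, q.2] using this
  have main := circulations_are_boundaries (E := E) (V := V) (Q := Face w) cr (fun e => cr (nx e))
    l r ?_ ?_ ?_
  · rw [← hcard, hVcard, hEcard] at main
    refine ⟨by omega, ?_⟩
    have e1 : faceCount w = crossingCount w + 2 ↔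
      faceCount w + crossingCount w = 2 * crossingCount w + 2 := by omega
    rw [e1, ← main.2]
    constructor
    · intro hE i o a hpath hk
      have hstep := fun p hp => hpath.formPerm h.nodup_word (p := p) hp
      have hin : ∀ p ∈ w, o (w.formPerm.symm p) = i p := fun p hp => by
        rw [← hstep _ (formPerm_symm_mem hp), Equiv.apply_symm_apply]
      obtain ⟨g, hg⟩ := hE (fun e => o e.1) (by
        intro x
        obtain ⟨p, rfl⟩ := hVsurj x
        rw [hsum, hsum']
        have := hk p.1 p.2
        rw [← hin p.1 p.2, ← hin _ (h.mate_mem _ p.2)] at this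
        exact this.symm)
      -- The face function is pulled back to darts. The default `0` only concerns darts off the
      -- diagram, and since the definition depends on `faceOf w d` alone, invariance under
      -- `faceNext` is immediate.
      let φ : Dart → ℚ := fun d =>
        if hF : ∃ d' : Dart, d'.1 ∈ w ∧ faceOf w d = {e | SameFace w d' e} then g ⟨_, hF⟩ else 0
      have hφl : ∀ e : E, φ (e.1, true) = g (l e) := fun e => dif_pos ⟨_, e.2, rfl⟩
      have hφr : ∀ e : E, φ (e.1, false) = g (r e) := fun e => dif_pos ⟨_, e.2, rfl⟩
      have hφ : ∀ d : Dart, d.1 ∈ w → φ (faceNext w d) = φ d := fun d hd => by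
        simp only [φ, h.faceOf_faceNext hd]
      obtain ⟨q, hq, hqp⟩ := exists_path_of_formPerm (w := w)
        (i := fun p => (φ (w.formPerm.symm p, true), φ (w.formPerm.symm p, false)))
        (o := fun p => (φ (p, true), φ (p, false))) h.nodup_word hne (by simp)
      have proj : ∀ (f : ℚ × ℚ → ℚ) (i o : Passage → ℚ × ℚ) (a b : ℚ × ℚ) (u : Word),
          Path i o a u b → Path (f ∘ i) (f ∘ o) (f a) u (f b) := by
        intro f i o a b u
        induction u generalizing a with
        | nil => exact congrArg f
        | cons p u ih => exact fun hh => ⟨congrArg f hh.1, ih _ hh.2⟩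
      refine ⟨φ (q, true), φ (q, false), _, _, _, _,
        ⟨proj Prod.fst _ _ _ _ _ hqp, proj Prod.snd _ _ _ _ _ hqp,
          fun p hp hl => corners_of_faceNext hφ h hp hl⟩, ?_, ?_⟩
      · rw [hφl ⟨q, hq⟩, hφr ⟨q, hq⟩, hg]
        -- Both paths start on the base edge; comparing them at the first letter shows that the
        -- labels there differ by `a`.
        obtain ⟨k, hk, rfl⟩ := List.getElem_of_mem hq
        have h1 := (hpath.getElem.1 (by omega)).1
        have h2 := (hqp.getElem.1 (by omega)).1
        have h3 := hin w[0] (List.getElem_mem _)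
        rw [h1] at h3
        rw [← h3, ← hg ⟨_, formPerm_symm_mem (List.getElem_mem (by omega))⟩, ← hg ⟨_, hq⟩, ← hφl,
          ← hφr, ← hφl, ← hφr]
        simp only [Prod.mk.injEq] at h2
        simp only [h2]
      · intro p hp
        have h1 := hg ⟨p, hp⟩
        have h2 := hg (pv ⟨p, hp⟩)
        rw [← hφl, ← hφr] at h1 h2
        exact ⟨h2.trans (hin p hp), h1⟩
    · intro hE v hv
      let v' : Passage → ℚ := fun p => if hp : p ∈ w then v ⟨p, hp⟩ else 0
      have hv' : ∀ e : E, v' e.1 = v e := fun e => dif_pos e.2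
      obtain ⟨q, hq, hqp⟩ := exists_path_of_formPerm (w := w)
        (i := fun p => v' (w.formPerm.symm p)) (o := v') h.nodup_word hne (by simp)
      obtain ⟨x, y, li, lo, ri, ro, hL, -, hd⟩ := hE _ _ _ hqp (by
        intro p hp
        have := hv (cr ⟨p, hp⟩)
        rw [hsum, hsum'] at this
        simp only [← hv'] at this
        exact this.symm)
      let φ : Dart → ℚ := dartLabel lo ro
      have hφ := fun d hd => hL.apply_faceNext h d hd
      have hit : ∀ (k : ℕ) (d : Dart), d.1 ∈ w → φ ((faceNext w)^[k] d) = φ d := by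
        intro k
        induction k with
        | zero => intro d _; rfl
        | succ k ih =>
          intro d hd
          rw [Function.iterate_succ_apply, ih _ (h.faceNext_mem hd)]
          exact hφ d hd
      -- Labels are constant along face boundaries (`hit`), so the choice of a dart is immaterial.
      let g : Face w → ℚ := fun f => φ f.2.choose
      have hgF : ∀ (d : Dart) (hd : d.1 ∈ w), g ⟨faceOf w d, d, hd, rfl⟩ = φ d := by
        intro d hd
        have hF : ∃ d' : Dart, d'.1 ∈ w ∧ faceOf w d = {e | SameFace w d' e} := ⟨d, hd, rfl⟩
        have hs := hF.choose_spec
        have : d ∈ {e | SameFace w hF.choose e} := by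
          rw [← hs.2]; exact ⟨0, rfl⟩
        obtain ⟨k, hk⟩ := this
        have h2 := hit k _ hs.1
        rw [hk] at h2
        exact h2.symm
      refine ⟨g, fun e => ?_⟩
      rw [hgF (e.1, true) e.2, hgF (e.1, false) e.2, ← hv' e, ← (hd e.1 e.2).2]
      rfl
  · intro f hf
    have := constant (fun p => f (cr p)) (fun p => (hf p).symm)
    intro x y
    obtain ⟨p, rfl⟩ := hVsurj x
    obtain ⟨q, rfl⟩ := hVsurj y
    exact this p q
  · intro g hg
    -- If the two sides of every edge carry equal labels, the four corners at a crossing agree, and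
    -- the label persists along the curve.
    have h1 : ∀ p, g (l (nx p)) = g (l p) := by
      intro p
      have := cornerBoth (fun p => g (l p) = g (l (pv p))) (fun p hl => by
        obtain ⟨c1, c2, c3, c4⟩ := corner g p hl
        have g1 := hg p
        have g2 := hg (mt p)
        have g3 := hg (pv p)
        have g4 := hg (pv (mt p))
        constructor
        · linarith
        · linarith) (nx p)
      rwa [hpv] at this
    have h2 := constant (fun p => g (l p)) h1
    have h3 : ∀ F, ∃ p, g F = g (l p) := by
      rintro ⟨F, ⟨p, b⟩, hp, rfl⟩
      cases b
      · exact ⟨⟨p, hp⟩, (hg ⟨p, hp⟩).symm⟩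
      · exact ⟨⟨p, hp⟩, rfl⟩
    intro x y
    obtain ⟨p, hp⟩ := h3 x
    obtain ⟨q, hq⟩ := h3 y
    rw [hp, hq]
    exact h2 p q
  · intro g x
    obtain ⟨p, rfl⟩ := hVsurj x
    rw [hsum, hsum']
    refine cornerBoth (fun p => g (l p) - g (r p) + (g (l (mt p)) - g (r (mt p))) =
      g (l (pv p)) - g (r (pv p)) + (g (l (pv (mt p))) - g (r (pv (mt p))))) (fun p hl => ?_) p
    obtain ⟨c1, c2, c3, c4⟩ := corner g p hl
    rw [hmt]
    constructor <;> linarith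

theorem IsGaussWord.isKnotDiagram_of_exact (h : IsGaussWord w) (hE : Exact w) :
    IsKnotDiagram w :=
  h.isKnotDiagram fun hne => (h.euler hne).2.2 hE

theorem IsKnotDiagram.exact (h : IsKnotDiagram w) : Exact w := by
  rcases eq_or_ne w [] with rfl | hne
  · intro i o a _ _
    -- The empty word has no darts, so Euler's formula is not available; the inside and the outside
    -- of the circle are labelled by hand.
    exact ⟨a, 0, 0, 0, 0, 0, ⟨rfl, rfl, by simp⟩, by simp, by simp⟩
  · exact (h.isGaussWord.euler hne).2.1 (h.planar hne)

/-- A word is planar if its faces can carry sufficiently many different labels. -/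
theorem IsGaussWord.isKnotDiagram_of_labelling (h : IsGaussWord w) {A : Type*} {a b : A}
    {li lo ri ro : Passage → A} (hL : IsFaceLabelling w a b li lo ri ro) (S : Finset A)
    (hS : ∀ s ∈ S, ∃ p ∈ w, lo p = s ∨ ro p = s) (hcard : crossingCount w + 2 ≤ S.card) :
    IsKnotDiagram w := by
  -- One half of Euler's formula holds in every genus, so it remains to exhibit enough faces.
  refine h.isKnotDiagram fun hne => le_antisymm (h.euler hne).1 (hcard.trans ?_)
  let φ : Dart → A := dartLabel lo ro
  have hit : ∀ (k : ℕ) (d : Dart), d.1 ∈ w → φ ((faceNext w)^[k] d) = φ d := by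
    intro k
    induction k with
    | zero => intro d _; rfl
    | succ k ih =>
      intro d hd
      rw [Function.iterate_succ_apply, ih _ (h.faceNext_mem hd)]
      exact hL.apply_faceNext h d hd
  have hex : ∀ s : S, ∃ d : Dart, d.1 ∈ w ∧ φ d = s := by
    rintro ⟨s, hs⟩
    obtain ⟨p, hp, h1 | h1⟩ := hS s hs
    · exact ⟨(p, true), hp, h1⟩
    · exact ⟨(p, false), hp, h1⟩
  choose d hd hds using hex
  have hinj : Function.Injective fun s : S => (⟨faceOf w (d s), _, hd s, rfl⟩ : Face w) := by
    intro s t hst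
    have hst' : faceOf w (d s) = faceOf w (d t) := congrArg Subtype.val hst
    have : d t ∈ faceOf w (d s) := by rw [hst']; exact ⟨0, rfl⟩
    obtain ⟨k, hk⟩ := this
    have := hit k _ (hd s)
    rw [hk, hds, hds] at this
    exact Subtype.ext this.symm
  have := Nat.card_le_card_of_injective _ hinj
  rw [Nat.card_eq_fintype_card, Fintype.card_coe] at this
  exact this

end

section

/-! ## Reidemeister moves preserve exactness -/

variable {w w' u v : Word}

theorem IsGaussWord.perm (h : IsGaussWord w) (hp : w.Perm w') : IsGaussWord w' :=
  ⟨(hp.map _).nodup_iff.1 h.nodup, fun p hm => hp.subset (h.mate_mem p (hp.symm.subset hm))⟩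

theorem IsGaussWord.of_perm_append (h : IsGaussWord w) (hp : w.Perm (u ++ v))
    (hu : ∀ p ∈ u, p.mate ∈ u) : IsGaussWord v := by
  have h' := h.perm hp
  refine ⟨?_, fun q hq => ?_⟩
  · have := h'.nodup
    rw [List.map_append] at this
    exact (List.nodup_append.1 this).2.1
  · rcases List.mem_append.1 (h'.mate_mem q (List.mem_append_right _ hq)) with hm | hm
    · have h1 := hu _ hm
      rw [Passage.mate_mate] at h1
      exact absurd rfl ((List.nodup_append.1 h'.nodup_word).2.2 q h1 q hq)
    · exact hm

theorem IsGaussWord.crossing_ne (h : IsGaussWord w) (hp : w.Perm (u ++ v))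
    (hu : ∀ p ∈ u, p.mate ∈ u) {p q : Passage} (hpu : p ∈ u) (hq : q ∈ v) :
    q.crossing ≠ p.crossing := fun hc => by
  have h' := h.perm hp
  have hd := (List.nodup_append.1 h'.nodup_word).2.2
  rcases h'.eq_or_eq_mate (List.mem_append_right _ hq) (List.mem_append_left _ hpu) hc with rfl | rfl
  · exact hd _ hpu _ hq rfl
  · exact hd _ (hu _ hpu) _ hq rfl

theorem perm_kink (l₁ l₂ : Word) (p q : Passage) :
    (l₁ ++ [p, q] ++ l₂).Perm ([p, q] ++ (l₁ ++ l₂)) :=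
  List.perm_iff_count.2 fun a => by simp only [List.count_append]; omega

theorem perm_bigon (l₁ l₂ l₃ : Word) (p q r s : Passage) :
    (l₁ ++ [p, q] ++ l₂ ++ [r, s] ++ l₃).Perm ([p, q, r, s] ++ (l₁ ++ l₂ ++ l₃)) :=
  List.perm_iff_count.2 fun a => by
    simp only [List.count_append, List.count_cons, List.count_nil]; omega

theorem perm_triangle (l₁ l₂ l₃ l₄ : Word) (a₁ a₂ b₁ b₂ c₁ c₂ : Passage) :
    (l₁ ++ [a₁, a₂] ++ l₂ ++ [b₁, b₂] ++ l₃ ++ [c₁, c₂] ++ l₄).Perm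
      ([a₁, a₂, b₁, b₂, c₁, c₂] ++ (l₁ ++ l₂ ++ l₃ ++ l₄)) :=
  List.perm_iff_count.2 fun a => by
    simp only [List.count_append, List.count_cons, List.count_nil]; omega

theorem perm_triangle_swap (l₁ l₂ l₃ l₄ : Word) (a₁ a₂ b₁ b₂ c₁ c₂ : Passage) :
    (l₁ ++ [a₁, a₂] ++ l₂ ++ [b₁, b₂] ++ l₃ ++ [c₁, c₂] ++ l₄).Perm
      (l₁ ++ [a₂, a₁] ++ l₂ ++ [b₂, b₁] ++ l₃ ++ [c₂, c₁] ++ l₄) :=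
  List.perm_iff_count.2 fun a => by
    simp only [List.count_append, List.count_cons, List.count_nil]; omega

theorem IsGaussWord.remove_kink {l₁ l₂ : Word} {p : Passage}
    (h : IsGaussWord (l₁ ++ [p, p.mate] ++ l₂)) : IsGaussWord (l₁ ++ l₂) :=
  h.of_perm_append (perm_kink ..) (by simp)

theorem IsGaussWord.remove_bigon {l₁ l₂ l₃ : Word} {p q : Passage}
    (h : IsGaussWord (l₁ ++ [p, q] ++ l₂ ++ [p.mate, q.mate] ++ l₃)) :
    IsGaussWord (l₁ ++ l₂ ++ l₃) :=
  h.of_perm_append (perm_bigon ..) (by simp)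

/-- A circulation on the smaller word extends over the kink, and the resulting labels restrict,
because the corners force the same labels beside the strand before and after the kink (`key`). -/
theorem Exact.remove_kink {l₁ l₂ : Word} {p : Passage}
    (hg : IsGaussWord (l₁ ++ [p, p.mate] ++ l₂)) (h : Exact (l₁ ++ [p, p.mate] ++ l₂)) :
    Exact (l₁ ++ l₂) := by
  intro i o a hpath hk
  have hne : ∀ q ∈ l₁ ++ l₂, q.crossing ≠ p.crossing := fun q hq =>
    hg.crossing_ne (perm_kink ..) (by simp) (by simp) hq
  obtain ⟨c, h1, h2⟩ := path_append.1 hpath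
  -- The strand carries `c` past the kink; Kirchhoff's rule leaves the value on the loop free, and
  -- `c` is taken there as well.
  let i' : Passage → ℚ := fun s => if s.crossing = p.crossing then c else i s
  let o' : Passage → ℚ := fun s => if s.crossing = p.crossing then c else o s
  have hi' : ∀ q ∈ l₁ ++ l₂, i' q = i q := fun q hq => if_neg (hne q hq)
  have ho' : ∀ q ∈ l₁ ++ l₂, o' q = o q := fun q hq => if_neg (hne q hq)
  have hi'' : ∀ q ∈ l₁ ++ l₂, i' q.mate = i q.mate := fun q hq => if_neg (hne q hq)
  have ho'' : ∀ q ∈ l₁ ++ l₂, o' q.mate = o q.mate := fun q hq => if_neg (hne q hq)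
  have vip : i' p = c := if_pos rfl
  have vop : o' p = c := if_pos rfl
  have vip' : i' p.mate = c := if_pos rfl
  have vop' : o' p.mate = c := if_pos rfl
  simp only [List.mem_append] at hi' ho' hi'' ho''
  obtain ⟨x, y, li, lo, ri, ro, ⟨hl, hr, hc⟩, hxy, hd⟩ := h i' o' a (by
    simp only [path_append, path_cons, path_nil]
    refine ⟨c, ⟨c, h1.congr (fun q hq => hi' q (.inl hq)) (fun q hq => ho' q (.inl hq)), ?_⟩,
      h2.congr (fun q hq => hi' q (.inr hq)) (fun q hq => ho' q (.inr hq))⟩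
    simp [vip, vop, vip', vop']) (by
    intro q hq
    simp only [List.mem_append, List.mem_cons, List.not_mem_nil, or_false] at hq
    rcases hq with (hq | rfl | rfl) | hq
    · rw [hi' q (.inl hq), hi'' q (.inl hq), ho' q (.inl hq), ho'' q (.inl hq)]
      exact hk q (by simp [hq])
    · rw [vip, vop, vip', vop']
    · rw [Passage.mate_mate, vip, vop, vip', vop']
    · rw [hi' q (.inr hq), hi'' q (.inr hq), ho' q (.inr hq), ho'' q (.inr hq)]
      exact hk q (by simp [hq]))
  simp only [path_append, path_cons, path_nil] at hl hr
  obtain ⟨_, ⟨_, hl1, e1, e2, rfl⟩, hl2⟩ := hl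
  obtain ⟨_, ⟨_, hr1, e3, e4, rfl⟩, hr2⟩ := hr
  obtain ⟨d1, d2⟩ := hd p (by simp)
  obtain ⟨d3, d4⟩ := hd p.mate (by simp)
  rw [vip] at d1
  rw [vop] at d2
  rw [vip'] at d3
  rw [vop'] at d4
  have key : li p = lo p.mate ∧ ri p = ro p.mate := by
    by_cases hl : p.crossedToLeft = true
    · obtain ⟨c1, c2, c3, c4⟩ := hc p (by simp) hl
      constructor <;> linarith
    · obtain ⟨c1, c2, c3, c4⟩ := hc p.mate (by simp) (by simpa using hl)
      rw [Passage.mate_mate] at c1 c2 c3 c4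
      constructor <;> linarith
  refine ⟨x, y, li, lo, ri, ro, ⟨?_, ?_, fun q hq => ?_⟩, hxy, fun q hq => ?_⟩
  · exact path_append.2 ⟨_, hl1, by rw [← e1, key.1]; exact hl2⟩
  · exact path_append.2 ⟨_, hr1, by rw [← e3, key.2]; exact hr2⟩
  · exact hc q (by simp only [List.mem_append] at hq ⊢; tauto)
  · rw [List.mem_append] at hq
    rw [← hi' q hq, ← ho' q hq]
    exact hd q (by simp only [List.mem_append] at hq ⊢; tauto)

/-- As for a kink: each strand keeps its value through the bigon, `c` on the one and `d` on the
other. Opposite signs with the same strand on top mean that the strands cross in opposite directions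
at `p` and `q`, so that the outer labels match again. -/
theorem Exact.remove_bigon {l₁ l₂ l₃ : Word} {p q : Passage}
    (hg : IsGaussWord (l₁ ++ [p, q] ++ l₂ ++ [p.mate, q.mate] ++ l₃))
    (h : Exact (l₁ ++ [p, q] ++ l₂ ++ [p.mate, q.mate] ++ l₃)) (ho : p.isOver = q.isOver)
    (hs : p.positive ≠ q.positive) : Exact (l₁ ++ l₂ ++ l₃) := by
  intro i o a hpath hk
  have hmates : ∀ s ∈ [p, q, p.mate, q.mate], s.mate ∈ [p, q, p.mate, q.mate] := by simp
  have hnep : ∀ s ∈ l₁ ++ l₂ ++ l₃, s.crossing ≠ p.crossing := fun s hs =>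
    hg.crossing_ne (perm_bigon ..) hmates (by simp) hs
  have hneq : ∀ s ∈ l₁ ++ l₂ ++ l₃, s.crossing ≠ q.crossing := fun s hs =>
    hg.crossing_ne (perm_bigon ..) hmates (by simp) hs
  obtain ⟨d, h12, h3⟩ := path_append.1 hpath
  obtain ⟨c, h1, h2⟩ := path_append.1 h12
  let f : (Passage → ℚ) → Passage → ℚ := fun g s =>
    if s.crossing = p.crossing ∨ s.crossing = q.crossing then (if s.isOver = p.isOver then c else d)
    else g s
  have hf : ∀ g, ∀ s ∈ l₁ ++ l₂ ++ l₃, f g s = g s := fun g s hs =>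
    if_neg (by simp [hnep s hs, hneq s hs])
  have hf' : ∀ g, ∀ s ∈ l₁ ++ l₂ ++ l₃, f g s.mate = g s.mate := fun g s hs =>
    if_neg (by simp [hnep s hs, hneq s hs])
  have vp : ∀ g, f g p = c := fun g => by simp [f]
  have vq : ∀ g, f g q = c := fun g => by simp [f, ho]
  have vp' : ∀ g, f g p.mate = d := fun g => by simp [f]
  have vq' : ∀ g, f g q.mate = d := fun g => by simp [f, ho]
  simp only [List.mem_append] at hf hf'
  obtain ⟨x, y, li, lo, ri, ro, ⟨hl, hr, hc⟩, hxy, hd⟩ := h (f i) (f o) a (by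
    simp only [path_append, path_cons, path_nil]
    refine ⟨d, ⟨d, ⟨c, ⟨c, h1.congr ?_ ?_, ?_⟩, h2.congr ?_ ?_⟩, ?_⟩, h3.congr ?_ ?_⟩
    any_goals intro s hs; exact hf _ s (by tauto)
    · simp [vp, vq]
    · simp [vp', vq']) (by
    intro s hs
    simp only [List.mem_append, List.mem_cons, List.not_mem_nil, or_false] at hs
    by_cases hm : (s ∈ l₁ ∨ s ∈ l₂) ∨ s ∈ l₃
    · rw [hf _ s hm, hf _ s hm, hf' _ s hm, hf' _ s hm]
      exact hk s (by simpa [or_assoc] using hm)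
    · have : s = p ∨ s = q ∨ s = p.mate ∨ s = q.mate := by tauto
      rcases this with rfl | rfl | rfl | rfl <;> simp [vp, vq, vp', vq'])
  simp only [path_append, path_cons, path_nil] at hl hr
  obtain ⟨_, ⟨_, ⟨_, ⟨_, hl1, e1, e2, rfl⟩, hl2⟩, e3, e4, rfl⟩, hl3⟩ := hl
  obtain ⟨_, ⟨_, ⟨_, ⟨_, hr1, e5, e6, rfl⟩, hr2⟩, e7, e8, rfl⟩, hr3⟩ := hr
  obtain ⟨d1, d2⟩ := hd p (by simp)
  obtain ⟨d3, d4⟩ := hd p.mate (by simp)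
  obtain ⟨d5, d6⟩ := hd q (by simp)
  obtain ⟨d7, d8⟩ := hd q.mate (by simp)
  simp only [vp, vq, vp', vq'] at d1 d2 d3 d4 d5 d6 d7 d8
  have key : (li p = lo q ∧ ri p = ro q) ∧ li p.mate = lo q.mate ∧ ri p.mate = ro q.mate := by
    by_cases hcl : p.crossedToLeft = true
    · have hcl' : q.mate.crossedToLeft = true := by
        revert ho hs hcl
        rcases p with ⟨_, _ | _, _ | _⟩ <;> rcases q with ⟨_, _ | _, _ | _⟩ <;>
          simp [Passage.crossedToLeft]
      obtain ⟨c1, c2, c3, c4⟩ := hc p (by simp) hcl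
      obtain ⟨c5, c6, c7, c8⟩ := hc q.mate (by simp) hcl'
      rw [Passage.mate_mate] at c5 c6 c7 c8
      refine ⟨⟨?_, ?_⟩, ?_, ?_⟩ <;> linarith
    · have hcl' : q.crossedToLeft = true := by
        revert ho hs hcl
        rcases p with ⟨_, _ | _, _ | _⟩ <;> rcases q with ⟨_, _ | _, _ | _⟩ <;>
          simp [Passage.crossedToLeft]
      obtain ⟨c1, c2, c3, c4⟩ := hc p.mate (by simp) (by simpa using hcl)
      obtain ⟨c5, c6, c7, c8⟩ := hc q (by simp) hcl'
      rw [Passage.mate_mate] at c1 c2 c3 c4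
      refine ⟨⟨?_, ?_⟩, ?_, ?_⟩ <;> linarith
  obtain ⟨⟨k1, k2⟩, k3, k4⟩ := key
  refine ⟨x, y, li, lo, ri, ro, ⟨?_, ?_, fun s hs => ?_⟩, hxy, fun s hs => ?_⟩
  · rw [← k1, e1] at hl2
    rw [← k3, e3] at hl3
    exact path_append.2 ⟨_, path_append.2 ⟨_, hl1, hl2⟩, hl3⟩
  · rw [← k2, e5] at hr2
    rw [← k4, e7] at hr3
    exact path_append.2 ⟨_, path_append.2 ⟨_, hr1, hr2⟩, hr3⟩
  · exact hc s (by simp only [List.mem_append] at hs ⊢; tauto)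
  · simp only [List.mem_append] at hs
    rw [← hf i s hs, ← hf o s hs]
    exact hd s (by simp only [List.mem_append] at hs ⊢; tauto)

end

/-! ### Third moves preserve exactness -/

section

variable {w w' : Word}

/-- Values prescribed at the six passages through three crossings. -/
def onTriangle (t x y : Passage) (vt vt' vx vx' vy vy' : ℚ) (g : Passage → ℚ) (s : Passage) : ℚ :=
  if s.crossing = t.crossing then (if s.isOver = t.isOver then vt else vt')
  else if s.crossing = x.crossing then (if s.isOver = x.isOver then vx else vx')
  else if s.crossing = y.crossing then (if s.isOver = y.isOver then vy else vy')
  else g s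

section onTriangle
variable {t x y : Passage} (vt vt' vx vx' vy vy' : ℚ) (g : Passage → ℚ)

theorem onTriangle_t : onTriangle t x y vt vt' vx vx' vy vy' g t = vt := by simp [onTriangle]

theorem onTriangle_t_mate : onTriangle t x y vt vt' vx vx' vy vy' g t.mate = vt' := by
  simp [onTriangle]

theorem onTriangle_x (htx : x.crossing ≠ t.crossing) :
    onTriangle t x y vt vt' vx vx' vy vy' g x = vx := by simp [onTriangle, htx]

theorem onTriangle_x_mate (htx : x.crossing ≠ t.crossing) :
    onTriangle t x y vt vt' vx vx' vy vy' g x.mate = vx' := by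
  simp [onTriangle, htx]

theorem onTriangle_y (hty : y.crossing ≠ t.crossing) (hxy : y.crossing ≠ x.crossing) :
    onTriangle t x y vt vt' vx vx' vy vy' g y = vy := by
  simp [onTriangle, hty, hxy]

theorem onTriangle_y_mate (hty : y.crossing ≠ t.crossing) (hxy : y.crossing ≠ x.crossing) :
    onTriangle t x y vt vt' vx vx' vy vy' g y.mate = vy' := by
  simp [onTriangle, hty, hxy]

theorem onTriangle_of_ne {s : Passage} (h1 : s.crossing ≠ t.crossing)
    (h2 : s.crossing ≠ x.crossing) (h3 : s.crossing ≠ y.crossing) :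
    onTriangle t x y vt vt' vx vx' vy vy' g s = g s := by
  simp [onTriangle, h1, h2, h3]

end onTriangle

set_option maxHeartbeats 2000000 in
/-- The words `w` and `w'` consist of three edges of a triangle, in the two opposite orders, and
of a common remainder, which is the relation `R` on the edge values between the pieces. -/
theorem Exact.slide_of_frame {t x y : Passage} {rest : Word}
    {R : (Passage → ℚ) → (Passage → ℚ) → ℚ → ℚ → ℚ → ℚ → ℚ → ℚ → ℚ → Prop}
    (hR : ∀ {i o i' o' a s₀ s₁ s₂ s₃ s₄ s₅}, R i o a s₀ s₁ s₂ s₃ s₄ s₅ →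
      (∀ q ∈ rest, i' q = i q) → (∀ q ∈ rest, o' q = o q) → R i' o' a s₀ s₁ s₂ s₃ s₄ s₅)
    (hw : ∀ i o a, Path i o a w a ↔ ∃ s₀ s₁ s₂ s₃ s₄ s₅, R i o a s₀ s₁ s₂ s₃ s₄ s₅ ∧
      Path i o s₀ [t, x] s₁ ∧ Path i o s₂ [t.mate, y] s₃ ∧ Path i o s₄ [x.mate, y.mate] s₅)
    (hw' : ∀ i o a, Path i o a w' a ↔ ∃ s₀ s₁ s₂ s₃ s₄ s₅, R i o a s₀ s₁ s₂ s₃ s₄ s₅ ∧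
      Path i o s₀ [x, t] s₁ ∧ Path i o s₂ [y, t.mate] s₃ ∧ Path i o s₄ [y.mate, x.mate] s₅)
    (hp : w.Perm ([t, x, t.mate, y, x.mate, y.mate] ++ rest))
    (hp' : w'.Perm ([t, x, t.mate, y, x.mate, y.mate] ++ rest))
    (hg : IsGaussWord w) (ht : t.crossedToLeft = true) (hx : x.crossedToLeft = true)
    (hy : y.crossedToLeft = true) (htx : x.crossing ≠ t.crossing)
    (hty : y.crossing ≠ t.crossing) (hxy : y.crossing ≠ x.crossing) (h : Exact w) : Exact w' := by
  intro i o a hpath hk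
  have hm : ∀ s, s ∈ w ↔ (s = t ∨ s = x ∨ s = t.mate ∨ s = y ∨ s = x.mate ∨ s = y.mate) ∨
      s ∈ rest := fun s => by
    rw [hp.mem_iff]; simp only [List.mem_append, List.mem_cons, List.not_mem_nil, or_false]
  have hm' : ∀ s, s ∈ w' ↔ (s = t ∨ s = x ∨ s = t.mate ∨ s = y ∨ s = x.mate ∨ s = y.mate) ∨
      s ∈ rest := fun s => by
    rw [hp'.mem_iff]; simp only [List.mem_append, List.mem_cons, List.not_mem_nil, or_false]
  have hmates : ∀ s ∈ [t, x, t.mate, y, x.mate, y.mate],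
      s.mate ∈ [t, x, t.mate, y, x.mate, y.mate] := by simp
  have off : ∀ {vt vt' vx vx' vy vy' g}, ∀ s ∈ rest,
      onTriangle t x y vt vt' vx vx' vy vy' g s = g s := fun s hs =>
    onTriangle_of_ne _ _ _ _ _ _ _ (hg.crossing_ne hp hmates (by simp) hs)
      (hg.crossing_ne hp hmates (by simp) hs) (hg.crossing_ne hp hmates (by simp) hs)
  have off' : ∀ {vt vt' vx vx' vy vy' g}, ∀ s ∈ rest,
      onTriangle t x y vt vt' vx vx' vy vy' g s.mate = g s.mate := fun s hs =>
    onTriangle_of_ne _ _ _ _ _ _ _ (hg.crossing_ne hp hmates (q := s) (by simp) hs)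
      (hg.crossing_ne hp hmates (q := s) (by simp) hs)
      (hg.crossing_ne hp hmates (q := s) (by simp) hs)
  have kt := hk t ((hm' _).2 (by tauto))
  have kx := hk x ((hm' _).2 (by tauto))
  have ky := hk y ((hm' _).2 (by tauto))
  obtain ⟨s₀, s₁, s₂, s₃, s₄, s₅, hRw, ha, hb, hc⟩ := (hw' _ _ _).1 hpath
  simp only [path_cons, path_nil] at ha hb hc
  obtain ⟨rfl, ha, rfl⟩ := ha
  obtain ⟨rfl, hb, rfl⟩ := hb
  obtain ⟨rfl, hc, rfl⟩ := hc
  -- Values for the sides of the other triangle: on each strand the old and the new middle value add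
  -- up to the incoming plus the outgoing one. Kirchhoff's rule determines them only up to a
  -- circulation round the triangle; this choice treats the strands alike.
  obtain ⟨ma, hma⟩ : ∃ m, m = i x + o t - i t := ⟨_, rfl⟩
  obtain ⟨mb, hmb⟩ : ∃ m, m = i y + o t.mate - i t.mate := ⟨_, rfl⟩
  obtain ⟨mc, hmc⟩ : ∃ m, m = i y.mate + o x.mate - i x.mate := ⟨_, rfl⟩
  obtain ⟨x₀, y₀, li, lo, ri, ro, ⟨hl, hr, hcor⟩, hxy₀, hd⟩ :=
    h (onTriangle t x y (i x) (i y) ma (i y.mate) mb mc i)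
      (onTriangle t x y ma mb (o t) mc (o t.mate) (o x.mate) o) a
      ((hw _ _ _).2 ⟨_, _, _, _, _, _, hR hRw off off, by
        simp only [path_cons, path_nil, onTriangle_t, onTriangle_t_mate, onTriangle_x _ _ _ _ _ _ _ htx,
          onTriangle_x_mate _ _ _ _ _ _ _ htx, onTriangle_y _ _ _ _ _ _ _ hty hxy, onTriangle_y_mate _ _ _ _ _ _ _ hty hxy, and_self]⟩) (by
      intro s hs
      rcases (hm s).1 hs with (rfl | rfl | rfl | rfl | rfl | rfl) | hs'
      all_goals try simp only [onTriangle_t, onTriangle_t_mate, onTriangle_x _ _ _ _ _ _ _ htx,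
          onTriangle_x_mate _ _ _ _ _ _ _ htx, onTriangle_y _ _ _ _ _ _ _ hty hxy, onTriangle_y_mate _ _ _ _ _ _ _ hty hxy,
          Passage.mate_mate]
      any_goals linarith
      rw [off s hs', off s hs', off' s hs', off' s hs']
      exact hk s ((hm' s).2 (.inr hs')))
  obtain ⟨_, _, _, _, _, _, hRl, hla, hlb, hlc⟩ := (hw _ _ _).1 hl
  obtain ⟨_, _, _, _, _, _, hRr, hra, hrb, hrc⟩ := (hw _ _ _).1 hr
  simp only [path_cons, path_nil] at hla hlb hlc hra hrb hrc
  obtain ⟨rfl, la, rfl⟩ := hla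
  obtain ⟨rfl, lb, rfl⟩ := hlb
  obtain ⟨rfl, lc, rfl⟩ := hlc
  obtain ⟨rfl, ra, rfl⟩ := hra
  obtain ⟨rfl, rb, rfl⟩ := hrb
  obtain ⟨rfl, rc, rfl⟩ := hrc
  have dt := hd t ((hm _).2 (by tauto))
  have dt' := hd t.mate ((hm _).2 (by tauto))
  have dx := hd x ((hm _).2 (by tauto))
  have dx' := hd x.mate ((hm _).2 (by tauto))
  have dy := hd y ((hm _).2 (by tauto))
  have dy' := hd y.mate ((hm _).2 (by tauto))
  simp only [onTriangle_t, onTriangle_t_mate, onTriangle_x _ _ _ _ _ _ _ htx, onTriangle_x_mate _ _ _ _ _ _ _ htx,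
    onTriangle_y _ _ _ _ _ _ _ hty hxy, onTriangle_y_mate _ _ _ _ _ _ _ hty hxy] at dt dt' dx dx' dy dy'
  obtain ⟨ct1, ct2, ct3, ct4⟩ := hcor t ((hm _).2 (by tauto)) ht
  obtain ⟨cx1, cx2, cx3, cx4⟩ := hcor x ((hm _).2 (by tauto)) hx
  obtain ⟨cy1, cy2, cy3, cy4⟩ := hcor y ((hm _).2 (by tauto)) hy
  -- Outside the triangle all face labels are kept. The new triangle is labelled from across each of
  -- its sides, as `ro y.mate - i t`, `ri x.mate + i t.mate` or `ri t - i x.mate`; these three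
  -- numbers agree.
  refine ⟨x₀, y₀,
    onTriangle t x y (ro y.mate) (ri x.mate + i t.mate) (li t) (ri t) (li t.mate) (li x.mate) li,
    onTriangle t x y (lo x) (lo y) (ro y.mate) (lo y.mate) (ri x.mate + i t.mate) (ri t) lo,
    onTriangle t x y (ro y.mate - i t) (ri x.mate) (ri t) (ri t - i x.mate) (ri t.mate)
      (ri x.mate) ri,
    onTriangle t x y (ro x) (ro y) (ro y.mate - i t) (ro y.mate) (ri x.mate) (ri t - i x.mate) ro,
    ⟨(hw' _ _ _).2 ⟨_, _, _, _, _, _, hR hRl off off, ?_⟩,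
     (hw' _ _ _).2 ⟨_, _, _, _, _, _, hR hRr off off, ?_⟩, ?_⟩, hxy₀, ?_⟩
  · simp only [path_cons, path_nil, onTriangle_t, onTriangle_t_mate, onTriangle_x _ _ _ _ _ _ _ htx,
      onTriangle_x_mate _ _ _ _ _ _ _ htx, onTriangle_y _ _ _ _ _ _ _ hty hxy, onTriangle_y_mate _ _ _ _ _ _ _ hty hxy, and_self]
  · simp only [path_cons, path_nil, onTriangle_t, onTriangle_t_mate, onTriangle_x _ _ _ _ _ _ _ htx,
      onTriangle_x_mate _ _ _ _ _ _ _ htx, onTriangle_y _ _ _ _ _ _ _ hty hxy, onTriangle_y_mate _ _ _ _ _ _ _ hty hxy, and_self]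
  · intro s hs hsl
    rcases (hm' s).1 hs with (rfl | rfl | rfl | rfl | rfl | rfl) | hs'
    any_goals simp [ht, hx, hy] at hsl
    all_goals simp only [Corners, onTriangle_t, onTriangle_t_mate, onTriangle_x _ _ _ _ _ _ _ htx,
      onTriangle_x_mate _ _ _ _ _ _ _ htx, onTriangle_y _ _ _ _ _ _ _ hty hxy, onTriangle_y_mate _ _ _ _ _ _ _ hty hxy]
    · refine ⟨?_, ?_, ?_, ?_⟩ <;> first | trivial | linarith
    · refine ⟨?_, ?_, ?_, ?_⟩ <;> first | trivial | linarith
    · refine ⟨?_, ?_, ?_, ?_⟩ <;> first | trivial | linarith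
    · simp only [off s hs', off' s hs']
      exact hcor s ((hm s).2 (.inr hs')) hsl
  · intro s hs
    rcases (hm' s).1 hs with (rfl | rfl | rfl | rfl | rfl | rfl) | hs'
    all_goals try simp only [onTriangle_t, onTriangle_t_mate, onTriangle_x _ _ _ _ _ _ _ htx,
      onTriangle_x_mate _ _ _ _ _ _ _ htx, onTriangle_y _ _ _ _ _ _ _ hty hxy, onTriangle_y_mate _ _ _ _ _ _ _ hty hxy]
    any_goals constructor <;> linarith
    have := hd s ((hm s).2 (.inr hs'))
    simpa only [off s hs'] using this

/-- A third move: a strand is pulled across the crossing `t`. -/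
theorem Exact.slide {l₁ l₂ l₃ l₄ : Word} {t x y : Passage}
    (hg : IsGaussWord (l₁ ++ [t, x] ++ l₂ ++ [t.mate, y] ++ l₃ ++ [x.mate, y.mate] ++ l₄))
    (ht : t.crossedToLeft = true) (hx : x.crossedToLeft = true)
    (hy : y.crossedToLeft = true) (htx : x.crossing ≠ t.crossing)
    (hty : y.crossing ≠ t.crossing) (hxy : y.crossing ≠ x.crossing)
    (h : Exact (l₁ ++ [t, x] ++ l₂ ++ [t.mate, y] ++ l₃ ++ [x.mate, y.mate] ++ l₄)) :
    Exact (l₁ ++ [x, t] ++ l₂ ++ [y, t.mate] ++ l₃ ++ [y.mate, x.mate] ++ l₄) := by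
  refine Exact.slide_of_frame (rest := l₁ ++ l₂ ++ l₃ ++ l₄)
    (R := fun i o a s₀ s₁ s₂ s₃ s₄ s₅ => Path i o a l₁ s₀ ∧ Path i o s₁ l₂ s₂ ∧
      Path i o s₃ l₃ s₄ ∧ Path i o s₅ l₄ a) ?_ ?_ ?_ ?_ ?_ hg ht hx hy htx hty hxy h
  · rintro i o i' o' a s₀ s₁ s₂ s₃ s₄ s₅ ⟨h1, h2, h3, h4⟩ hi ho
    refine ⟨h1.congr ?_ ?_, h2.congr ?_ ?_, h3.congr ?_ ?_, h4.congr ?_ ?_⟩ <;> intro q hq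
    any_goals exact hi q (by simp [hq])
    all_goals exact ho q (by simp [hq])
  · intro i o a
    simp only [path_append]
    constructor
    · rintro ⟨s₅, ⟨s₄, ⟨s₃, ⟨s₂, ⟨s₁, ⟨s₀, h1, h2⟩, h3⟩, h4⟩, h5⟩, h6⟩, h7⟩
      exact ⟨s₀, s₁, s₂, s₃, s₄, s₅, ⟨h1, h3, h5, h7⟩, h2, h4, h6⟩
    · rintro ⟨s₀, s₁, s₂, s₃, s₄, s₅, ⟨h1, h3, h5, h7⟩, h2, h4, h6⟩
      exact ⟨s₅, ⟨s₄, ⟨s₃, ⟨s₂, ⟨s₁, ⟨s₀, h1, h2⟩, h3⟩, h4⟩, h5⟩, h6⟩, h7⟩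
  · intro i o a
    simp only [path_append]
    constructor
    · rintro ⟨s₅, ⟨s₄, ⟨s₃, ⟨s₂, ⟨s₁, ⟨s₀, h1, h2⟩, h3⟩, h4⟩, h5⟩, h6⟩, h7⟩
      exact ⟨s₀, s₁, s₂, s₃, s₄, s₅, ⟨h1, h3, h5, h7⟩, h2, h4, h6⟩
    · rintro ⟨s₀, s₁, s₂, s₃, s₄, s₅, ⟨h1, h3, h5, h7⟩, h2, h4, h6⟩
      exact ⟨s₅, ⟨s₄, ⟨s₃, ⟨s₂, ⟨s₁, ⟨s₀, h1, h2⟩, h3⟩, h4⟩, h5⟩, h6⟩, h7⟩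
  · exact perm_triangle ..
  · exact (perm_triangle_swap ..).symm.trans (perm_triangle ..)

/-- The same, when the two strands that cross at `t` are met in the other order. -/
theorem Exact.slide' {l₁ l₂ l₃ l₄ : Word} {t x y : Passage}
    (hg : IsGaussWord (l₁ ++ [t.mate, y] ++ l₂ ++ [t, x] ++ l₃ ++ [x.mate, y.mate] ++ l₄))
    (ht : t.crossedToLeft = true) (hx : x.crossedToLeft = true)
    (hy : y.crossedToLeft = true) (htx : x.crossing ≠ t.crossing)
    (hty : y.crossing ≠ t.crossing) (hxy : y.crossing ≠ x.crossing)
    (h : Exact (l₁ ++ [t.mate, y] ++ l₂ ++ [t, x] ++ l₃ ++ [x.mate, y.mate] ++ l₄)) :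
    Exact (l₁ ++ [y, t.mate] ++ l₂ ++ [x, t] ++ l₃ ++ [y.mate, x.mate] ++ l₄) := by
  have hperm : ([t.mate, y, t, x, x.mate, y.mate] ++ (l₁ ++ l₂ ++ l₃ ++ l₄)).Perm
      ([t, x, t.mate, y, x.mate, y.mate] ++ (l₁ ++ l₂ ++ l₃ ++ l₄)) :=
    List.perm_iff_count.2 fun a => by simp only [List.count_append, List.count_cons]; omega
  refine Exact.slide_of_frame (rest := l₁ ++ l₂ ++ l₃ ++ l₄)
    (R := fun i o a s₀ s₁ s₂ s₃ s₄ s₅ => Path i o a l₁ s₂ ∧ Path i o s₃ l₂ s₀ ∧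
      Path i o s₁ l₃ s₄ ∧ Path i o s₅ l₄ a) ?_ ?_ ?_ ?_ ?_ hg ht hx hy htx hty hxy h
  · rintro i o i' o' a s₀ s₁ s₂ s₃ s₄ s₅ ⟨h1, h2, h3, h4⟩ hi ho
    refine ⟨h1.congr ?_ ?_, h2.congr ?_ ?_, h3.congr ?_ ?_, h4.congr ?_ ?_⟩ <;> intro q hq
    any_goals exact hi q (by simp [hq])
    all_goals exact ho q (by simp [hq])
  · intro i o a
    simp only [path_append]
    constructor
    · rintro ⟨s₅, ⟨s₄, ⟨s₁, ⟨s₀, ⟨s₃, ⟨s₂, h1, h4⟩, h3⟩, h2⟩, h5⟩, h6⟩, h7⟩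
      exact ⟨s₀, s₁, s₂, s₃, s₄, s₅, ⟨h1, h3, h5, h7⟩, h2, h4, h6⟩
    · rintro ⟨s₀, s₁, s₂, s₃, s₄, s₅, ⟨h1, h3, h5, h7⟩, h2, h4, h6⟩
      exact ⟨s₅, ⟨s₄, ⟨s₁, ⟨s₀, ⟨s₃, ⟨s₂, h1, h4⟩, h3⟩, h2⟩, h5⟩, h6⟩, h7⟩
  · intro i o a
    simp only [path_append]
    constructor
    · rintro ⟨s₅, ⟨s₄, ⟨s₁, ⟨s₀, ⟨s₃, ⟨s₂, h1, h4⟩, h3⟩, h2⟩, h5⟩, h6⟩, h7⟩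
      exact ⟨s₀, s₁, s₂, s₃, s₄, s₅, ⟨h1, h3, h5, h7⟩, h2, h4, h6⟩
    · rintro ⟨s₀, s₁, s₂, s₃, s₄, s₅, ⟨h1, h3, h5, h7⟩, h2, h4, h6⟩
      exact ⟨s₅, ⟨s₄, ⟨s₁, ⟨s₀, ⟨s₃, ⟨s₂, h1, h4⟩, h3⟩, h2⟩, h5⟩, h6⟩, h7⟩
  · exact (perm_triangle ..).trans hperm
  · exact ((perm_triangle_swap ..).symm.trans (perm_triangle ..)).trans hperm

end

/-! ## Sequences of simplifying moves -/

/-- If `w` is a knot diagram then `k` moves on knot diagrams, away from the base point, transform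
`w` into `v`. -/
def Reduces (k : ℕ) (w v : Word) : Prop :=
  IsKnotDiagram w → IsKnotDiagram v ∧
    ∀ {k₀ : ℕ} {w₀ : PlaneWord} {s : Bool}, PlaneReach k₀ w₀ ⟨w, s⟩ → PlaneReach (k₀ + k) w₀ ⟨v, s⟩

theorem Reduces.refl (w : Word) : Reduces 0 w w := fun h => ⟨h, fun hr => hr⟩

theorem Reduces.trans {k m : ℕ} {w v u : Word} (h₁ : Reduces k w v) (h₂ : Reduces m v u) :
    Reduces (k + m) w u := fun hw => by
  obtain ⟨hv, r₁⟩ := h₁ hw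
  obtain ⟨hu, r₂⟩ := h₂ hv
  exact ⟨hu, fun hr => by rw [← add_assoc]; exact r₂ (r₁ hr)⟩

theorem Reduces.congr {k k' : ℕ} {w w' v v' : Word} (h : Reduces k w v) (hk : k = k')
    (hw : w = w') (hv : v = v') : Reduces k' w' v' := by subst hk hw hv; exact h

/-- Planarity of the new word follows from exactness, so only the Gauss condition and exactness have
to be carried through a move. -/
theorem Reduces.of_move {w v : Word} (hm : Move w v)
    (h : IsGaussWord w → Exact w → IsGaussWord v ∧ Exact v) : Reduces 1 w v := fun hw => by
  obtain ⟨hg, he⟩ := h hw.isGaussWord hw.exact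
  have hv := hg.isKnotDiagram_of_exact he
  exact ⟨hv, fun hr => hr.move (.inl hm) hv⟩

theorem reduces_kink (l₁ l₂ : Word) (p : Passage) :
    Reduces 1 (l₁ ++ [p, p.mate] ++ l₂) (l₁ ++ l₂) :=
  .of_move (.r1 ..) fun hg he => ⟨hg.remove_kink, he.remove_kink hg⟩

theorem reduces_bigon (l₁ l₂ l₃ : Word) {p q : Passage} (ho : p.isOver = q.isOver)
    (hs : p.positive ≠ q.positive) :
    Reduces 1 (l₁ ++ [p, q] ++ l₂ ++ [p.mate, q.mate] ++ l₃) (l₁ ++ l₂ ++ l₃) :=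
  .of_move (.r2_parallel _ _ _ _ _ ho hs) fun hg he => ⟨hg.remove_bigon, he.remove_bigon hg ho hs⟩

/-- The third strand is below both others, so whichever strand is over at `t` is the top one. -/
theorem isTriangle_slide {t x y : Passage} (ht : t.crossedToLeft = true)
    (hx : x.crossedToLeft = true) (hy : y.crossedToLeft = true) (htx : x.crossing ≠ t.crossing)
    (hty : y.crossing ≠ t.crossing) (hxy : y.crossing ≠ x.crossing) (hxo : x.isOver = true)
    (hyo : y.isOver = true) : IsTriangle t x t.mate y x.mate y.mate := by
  obtain ⟨ct, ot, st⟩ := t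
  obtain ⟨cx, ox, sx⟩ := x
  obtain ⟨cy, oy, sy⟩ := y
  simp only [Passage.crossedToLeft, beq_iff_eq] at *
  subst hxo hyo hx hy ht
  constructor <;> simp [Passage.mate, Passage.crossedToLeft, htx, hty, hxy, htx.symm, hty.symm,
    hxy.symm]

theorem isTriangle_slide' {t x y : Passage} (ht : t.crossedToLeft = true)
    (hx : x.crossedToLeft = true) (hy : y.crossedToLeft = true) (htx : x.crossing ≠ t.crossing)
    (hty : y.crossing ≠ t.crossing) (hxy : y.crossing ≠ x.crossing) (hxo : x.isOver = true)
    (hyo : y.isOver = true) : IsTriangle t.mate y t x x.mate y.mate := by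
  obtain ⟨ct, ot, st⟩ := t
  obtain ⟨cx, ox, sx⟩ := x
  obtain ⟨cy, oy, sy⟩ := y
  simp only [Passage.crossedToLeft, beq_iff_eq] at *
  subst hxo hyo hx hy ht
  constructor <;> simp [Passage.mate, Passage.crossedToLeft, htx, hty, hxy, htx.symm, hty.symm,
    hxy.symm]

theorem reduces_slide (l₁ l₂ l₃ l₄ : Word) {t x y : Passage} (ht : t.crossedToLeft = true)
    (hx : x.crossedToLeft = true) (hy : y.crossedToLeft = true) (htx : x.crossing ≠ t.crossing)
    (hty : y.crossing ≠ t.crossing) (hxy : y.crossing ≠ x.crossing) (hxo : x.isOver = true)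
    (hyo : y.isOver = true) :
    Reduces 1 (l₁ ++ [t, x] ++ l₂ ++ [t.mate, y] ++ l₃ ++ [x.mate, y.mate] ++ l₄)
      (l₁ ++ [x, t] ++ l₂ ++ [y, t.mate] ++ l₃ ++ [y.mate, x.mate] ++ l₄) :=
  .of_move (.r3 _ _ _ _ _ _ _ _ _ _ (isTriangle_slide ht hx hy htx hty hxy hxo hyo))
    fun hg he => ⟨hg.perm (perm_triangle_swap ..), he.slide hg ht hx hy htx hty hxy⟩

theorem reduces_slide' (l₁ l₂ l₃ l₄ : Word) {t x y : Passage} (ht : t.crossedToLeft = true)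
    (hx : x.crossedToLeft = true) (hy : y.crossedToLeft = true) (htx : x.crossing ≠ t.crossing)
    (hty : y.crossing ≠ t.crossing) (hxy : y.crossing ≠ x.crossing) (hxo : x.isOver = true)
    (hyo : y.isOver = true) :
    Reduces 1 (l₁ ++ [t.mate, y] ++ l₂ ++ [t, x] ++ l₃ ++ [x.mate, y.mate] ++ l₄)
      (l₁ ++ [y, t.mate] ++ l₂ ++ [x, t] ++ l₃ ++ [y.mate, x.mate] ++ l₄) :=
  .of_move (.r3 _ _ _ _ _ _ _ _ _ _ (isTriangle_slide' ht hx hy htx hty hxy hxo hyo))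
    fun hg he => ⟨hg.perm (perm_triangle_swap ..), he.slide' hg ht hx hy htx hty hxy⟩

/-! ### The explicit simplification of `D n` -/

@[simp] theorem top_mate (i : ℕ) (b : Bool) : (top i b).mate = top i !b := rfl

@[simp] theorem bottom_mate (i : ℕ) (b : Bool) : (bottom i b).mate = bottom i !b := rfl

@[simp] theorem left_mate (i : ℕ) (b : Bool) : (left i b).mate = left i !b := rfl

@[simp] theorem middle_mate (i : ℕ) (b : Bool) : (middle i b).mate = middle i !b := rfl

@[simp] theorem right_mate (i : ℕ) (b : Bool) : (right i b).mate = right i !b := rfl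

/-- The first strand of the upper twist, up to crossing number `a`. -/
def twistTop (a : ℕ) : Word := (List.range a).map fun i => top i (decide (Even i))

/-- The second strand of the upper twist, up to crossing number `a`. -/
def twistTop' (a : ℕ) : Word := (List.range a).map fun i => top i (decide (Odd i))

/-- The first strand of the lower twist, through `m` crossings from crossing number `k`. -/
def twistBottom (k m : ℕ) : Word := (List.range' k m).map fun i => bottom i (decide (Even i))

/-- The second strand of the lower twist, through `m` crossings from crossing number `k`. -/
def twistBottom' (k m : ℕ) : Word := (List.range' k m).map fun i => bottom i (decide (Odd i))

theorem twistTop_succ (a : ℕ) : twistTop (a + 1) = twistTop a ++ [top a (decide (Even a))] := by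
  simp [twistTop, List.range_succ]

theorem twistTop'_succ (a : ℕ) : twistTop' (a + 1) = twistTop' a ++ [top a (decide (Odd a))] := by
  simp [twistTop', List.range_succ]

theorem twistBottom_succ (k m : ℕ) :
    twistBottom k (m + 1) = bottom k (decide (Even k)) :: twistBottom (k + 1) m := by
  simp [twistBottom, List.range'_succ]

theorem twistBottom'_succ (k m : ℕ) :
    twistBottom' k (m + 1) = bottom k (decide (Odd k)) :: twistBottom' (k + 1) m := by
  simp [twistBottom', List.range'_succ]

/-- A horizontal strand under the two strands below the upper twist is pulled up under the
twist. -/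
theorem reduces_slide_twist (j a : ℕ) (pre X Y suf : Word) :
    Reduces a (pre ++ twistTop a ++ [middle j true] ++ X ++ twistTop' a ++ [right j true] ++ Y ++
        (if Odd a then [middle j false, right j false] else [right j false, middle j false]) ++ suf)
      (pre ++ [middle j true] ++ twistTop a ++ X ++ [right j true] ++ twistTop' a ++ Y ++
        [right j false, middle j false] ++ suf) := by
  induction a generalizing X Y with
  | zero => simpa [twistTop, twistTop'] using Reduces.refl _
  | succ a ih =>
    have ih' := ih ([top a (decide (Even a))] ++ X) ([top a (decide (Odd a))] ++ Y)
    -- The slide is stated for the passage through `t` that is crossed to the left. At the positive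
    -- crossing `top a` this is the over passage, which lies on the first strand for even `a` and on
    -- the second for odd `a`.
    rcases Nat.even_or_odd a with he | ho
    · have ho : ¬ Odd a := Nat.not_odd_iff_even.2 he
      refine ((reduces_slide (pre ++ twistTop a) (X ++ twistTop' a) Y suf (t := top a true)
        (x := middle j true) (y := right j true) rfl rfl rfl (by simp [top, middle])
        (by simp [top, right]) (by simp [middle, right]) rfl rfl).congr rfl rfl ?_ |>.trans
        ih').congr (add_comm _ _) ?_ ?_ <;>
      simp [twistTop_succ, twistTop'_succ, he, ho]
    · have he : ¬ Even a := Nat.not_even_iff_odd.2 ho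
      refine ((reduces_slide' (pre ++ twistTop a) (X ++ twistTop' a) Y suf (t := top a true)
        (x := right j true) (y := middle j true) rfl rfl rfl (by simp [top, right])
        (by simp [top, middle]) (by simp [middle, right]) rfl rfl).congr rfl rfl ?_ |>.trans
        ih').congr (add_comm _ _) ?_ ?_ <;>
      simp [twistTop_succ, twistTop'_succ, he, ho, Nat.odd_add_one]

/-- The diagram in which only the `j` lowest horizontal strands cross the vertical ones. -/
def partialD (n j : ℕ) (pre suf : Word) : Word :=
  pre ++ twistTop (2 * n - 1) ++ (List.range j).reverse.map (fun j => middle j true) ++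
  twistBottom 0 (2 * n) ++ (List.range j).map (fun j => left j true) ++ twistTop' (2 * n - 1) ++
  (List.range j).reverse.map (fun j => right j true) ++ twistBottom' 0 (2 * n) ++
  (List.range j).flatMap (fun j => [left j false, middle j false, right j false]) ++ suf

theorem D_eq_partialD (n : ℕ) : D n = partialD n n [] [] := by
  simp [D, partialD, twistTop, twistTop', twistBottom, twistBottom', List.range_eq_range']

/-- Since `2 n - 1` is odd, the third moves exchange `middle j` and `right j` on the horizontal
strand. Then `left j` and `right j` are neighbours on both strands and have opposite signs, so that
one second move cancels them, while `middle j` is left at the two outer ends. -/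
theorem reduces_partialD_succ {n : ℕ} (hn : 1 ≤ n) (j : ℕ) (pre suf : Word) :
    Reduces (2 * n) (partialD n (j + 1) pre suf)
      (partialD n j (pre ++ [middle j true]) (middle j false :: suf)) := by
  let M := (List.range j).reverse.map (fun j => middle j true)
  let R := (List.range j).reverse.map (fun j => right j true)
  let L := (List.range j).map (fun j => left j true)
  let H := (List.range j).flatMap (fun j => [left j false, middle j false, right j false])
  have hodd : Odd (2 * n - 1) := ⟨n - 1, by omega⟩
  have h1 := reduces_slide_twist j (2 * n - 1) pre (M ++ twistBottom 0 (2 * n) ++ L ++ [left j true])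
    (R ++ twistBottom' 0 (2 * n) ++ H ++ [left j false]) suf
  have h2 := reduces_bigon (pre ++ [middle j true] ++ twistTop (2 * n - 1) ++ M ++
    twistBottom 0 (2 * n) ++ L) (twistTop' (2 * n - 1) ++ R ++ twistBottom' 0 (2 * n) ++ H)
    (middle j false :: suf) (p := left j true) (q := right j true) rfl (by simp [left, right])
  refine ((h1.congr rfl rfl ?_).trans h2).congr (by omega) ?_ ?_
  · simp [M, R, L, H]
  · simp [M, R, L, H, partialD, hodd, List.range_succ]
  · simp [M, R, L, H, partialD]

theorem reduces_partialD {n : ℕ} (hn : 1 ≤ n) (j : ℕ) (pre suf : Word) :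
    Reduces (j * (2 * n)) (partialD n j pre suf)
      (partialD n 0 (pre ++ (List.range j).reverse.map (fun j => middle j true))
        ((List.range j).map (fun j => middle j false) ++ suf)) := by
  induction j generalizing pre suf with
  | zero => simpa using Reduces.refl _
  | succ j ih =>
    refine ((reduces_partialD_succ hn j pre suf).trans (ih _ _)).congr (by ring) rfl ?_
    simp [List.range_succ]

/-- The last remaining upper crossing meets the first remaining lower one in a bigon. They have
opposite signs, and the parity condition says that the same strand is over at both; it persists,
since each step lowers `a` and raises `k` by one. -/
theorem reduces_twists (pre suf : Word) (a k m : ℕ) (hak : Odd (a + k)) :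
    Reduces a (pre ++ twistTop a ++ twistBottom k (a + m) ++ twistTop' a ++
        twistBottom' k (a + m) ++ suf)
      (pre ++ twistBottom (k + a) m ++ twistBottom' (k + a) m ++ suf) := by
  induction a generalizing k with
  | zero => simpa [twistTop, twistTop'] using Reduces.refl _
  | succ a ih =>
    have h1 := ih (k + 1) (by rwa [show a + (k + 1) = a + 1 + k by ring])
    have hpar : Even a ↔ Even k := by
      rw [show a + 1 + k = (a + k) + 1 by ring, Nat.odd_add_one, Nat.not_odd_iff_even,
        Nat.even_add] at hak
      exact hak
    have h2 := reduces_bigon (pre ++ twistTop a) (twistBottom (k + 1) (a + m) ++ twistTop' a)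
      (twistBottom' (k + 1) (a + m) ++ suf) (p := top a (decide (Even a)))
      (q := bottom k (decide (Even k))) (by simp [top, bottom, hpar]) (by simp [top, bottom])
    have hd : ∀ c : ℕ, (!decide (Even c)) = decide (Odd c) := fun c => by
      by_cases h : Even c <;> simp [h, ← Nat.not_even_iff_odd]
    refine ((h2.congr rfl rfl ?_).trans h1).congr (add_comm _ _) ?_ ?_
    · simp
    · simp only [top_mate, bottom_mate, hd]
      simp [twistTop_succ, twistTop'_succ, add_right_comm a 1 m, twistBottom_succ,
        twistBottom'_succ]
    · simp [add_assoc, add_comm 1 a]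

/-- The kinks are nested, and the innermost one, whose two passages are adjacent, is always
removable. -/
theorem reduces_kinks (n : ℕ) :
    Reduces n ((List.range n).reverse.map (fun j => middle j true) ++
      (List.range n).map (fun j => middle j false)) [] := by
  suffices h : ∀ l : List ℕ, Reduces l.length (l.reverse.map (fun j => middle j true) ++
      l.map (fun j => middle j false)) [] by simpa using h (List.range n)
  intro l
  induction l with
  | nil => exact Reduces.refl _
  | cons j l ih =>
    refine ((reduces_kink (l.reverse.map (fun j => middle j true))
      (l.map (fun j => middle j false)) (middle j true)).trans ih).congr ?_ ?_ rfl
    · simp [add_comm]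
    · simp

/-- The lower twist has one crossing more than the upper one. The survivor has number `2 * n - 1`,
an odd number, so its under passage comes first, and its two passages are adjacent. -/
theorem reduces_D {n : ℕ} (hn : 1 ≤ n) : Reduces (2 * n ^ 2 + 3 * n) (D n) [] := by
  let pre := (List.range n).reverse.map (fun j => middle j true)
  let suf := (List.range n).map (fun j => middle j false)
  have h1 := reduces_partialD hn n [] []
  have hodd : Odd (2 * n - 1) := ⟨n - 1, by omega⟩
  have h2 := reduces_twists pre suf (2 * n - 1) 0 1 hodd
  have h3 := reduces_kink pre suf (bottom (2 * n - 1) false)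
  have hev : ¬ Even (2 * n - 1) := Nat.not_even_iff_odd.2 hodd
  refine ((((h1.congr rfl rfl ?_).trans h2).trans (h3.congr rfl ?_ rfl)).trans
    (reduces_kinks n)).congr ?_ (D_eq_partialD n).symm rfl
  · have : 2 * n - 1 + 1 = 2 * n := by omega
    simp [partialD, this, pre, suf]
  · simp [twistBottom, twistBottom', hodd, hev]
  · have : n * (2 * n) = 2 * n ^ 2 := by ring
    omega

/-! ## Distances -/

theorem PlaneIso.sphereIso {w v : PlaneWord} (h : PlaneIso w v) : SphereIso w.word v.word := by
  cases h with
  | rename f w s => exact .rename f w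
  | rebase u v x y s t h => simpa using SphereIso.rebase (u ++ [x]) (v ++ [y])

/-- Through this, the lower bound proved in the sphere serves the plane, and the moves found in the
plane serve the sphere. -/
theorem PlaneReach.sphereReach {k : ℕ} {w v : PlaneWord} (h : PlaneReach k w v) :
    SphereReach k w.word v.word := by
  induction h with
  | refl w hw => exact .refl _ hw
  | iso _ hi ih => exact ih.iso hi.sphereIso
  | move _ hm hu ih => exact ih.move hm hu

theorem planeReach_D {n : ℕ} (hn : 1 ≤ n) (h : IsKnotDiagram (D n)) :
    PlaneReach (2 * n ^ 2 + 3 * n) (planeD n) (planeU true) := by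
  have := ((reduces_D hn) h).2 (.refl (planeD n) h)
  rwa [zero_add] at this

/-! ## The diagrams are planar -/

theorem mem_D {n : ℕ} {p : Passage} : p ∈ D n ↔
    (∃ i < 2 * n - 1, ∃ b, p = top i b) ∨ (∃ i < 2 * n, ∃ b, p = bottom i b) ∨
    (∃ j < n, ∃ b, p = left j b) ∨ (∃ j < n, ∃ b, p = middle j b) ∨
    (∃ j < n, ∃ b, p = right j b) := by
  simp only [D, List.mem_append, List.mem_map, List.mem_range, List.mem_reverse, List.mem_flatMap,
    List.mem_cons, List.not_mem_nil, or_false]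
  constructor
  · rintro (((((((⟨i, hi, rfl⟩ | ⟨i, hi, rfl⟩) | ⟨i, hi, rfl⟩) | ⟨i, hi, rfl⟩) | ⟨i, hi, rfl⟩) |
      ⟨i, hi, rfl⟩) | ⟨i, hi, rfl⟩) | ⟨i, hi, rfl | rfl | rfl⟩)
    all_goals first
      | exact .inl ⟨i, hi, _, rfl⟩
      | exact .inr (.inl ⟨i, hi, _, rfl⟩)
      | exact .inr (.inr (.inl ⟨i, hi, _, rfl⟩))
      | exact .inr (.inr (.inr (.inl ⟨i, hi, _, rfl⟩)))
      | exact .inr (.inr (.inr (.inr ⟨i, hi, _, rfl⟩)))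
  · have key : ∀ i : ℕ, ∀ b : Bool, decide (Even i) = b ∨ decide (Odd i) = b := fun i b => by
      rcases Nat.even_or_odd i with h | h <;> have h' := h
      · rw [← Nat.not_odd_iff_even] at h'
        cases b <;> simp [h, h']
      · rw [← Nat.not_even_iff_odd] at h'
        cases b <;> simp [h, h']
    rintro (⟨i, hi, b, rfl⟩ | ⟨i, hi, b, rfl⟩ | ⟨i, hi, _ | _, rfl⟩ | ⟨i, hi, _ | _, rfl⟩ |
      ⟨i, hi, _ | _, rfl⟩)
    · rcases key i b with rfl | rfl
      · simp [hi, top]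
      · simp [hi, top]
    · rcases key i b with rfl | rfl
      · simp [hi, bottom]
      · simp [hi, bottom]
    all_goals simp [hi, left, middle, right]

theorem length_D (n : ℕ) : (D n).length = 2 * (2 * n - 1) + 10 * n := by
  simp [D, List.length_flatMap]
  ring

theorem isGaussWord_D (n : ℕ) : IsGaussWord (D n) := by
  constructor
  -- Repetitions are excluded by counting: all elements of `S` occur in the word, and `S` has as
  -- many elements as the word has letters.
  · let S : Finset (CrossingName × Bool) := ({0} ×ˢ Finset.range (2 * n - 1) ∪
      {1} ×ˢ Finset.range (2 * n) ∪ {2, 3, 4} ×ˢ Finset.range n) ×ˢ Finset.univ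
    have hS : S.card = 2 * (2 * n - 1) + 10 * n := by
      rw [Finset.card_product, Finset.card_union_of_disjoint, Finset.card_union_of_disjoint]
      · simp
        ring
      · exact Finset.disjoint_product.2 (.inl (by simp))
      · rw [Finset.disjoint_union_left]
        exact ⟨Finset.disjoint_product.2 (.inl (by simp)),
          Finset.disjoint_product.2 (.inl (by simp))⟩
    have hsub : S ⊆ ((D n).map fun p => (p.crossing, p.isOver)).toFinset := by
      rintro ⟨⟨c, i⟩, b⟩ hs
      simp only [S, Finset.mem_product, Finset.mem_union, Finset.mem_singleton, Finset.mem_range,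
        Finset.mem_insert, Finset.mem_univ, and_true] at hs
      rw [List.mem_toFinset, List.mem_map]
      rcases hs with (⟨rfl, hi⟩ | ⟨rfl, hi⟩) | ⟨rfl | rfl | rfl, hi⟩
      · exact ⟨top i b, mem_D.2 (.inl ⟨i, hi, b, rfl⟩), rfl⟩
      · exact ⟨bottom i b, mem_D.2 (.inr (.inl ⟨i, hi, b, rfl⟩)), rfl⟩
      · exact ⟨left i b, mem_D.2 (.inr (.inr (.inl ⟨i, hi, b, rfl⟩))), rfl⟩
      · exact ⟨middle i b, mem_D.2 (.inr (.inr (.inr (.inl ⟨i, hi, b, rfl⟩)))), rfl⟩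
      · exact ⟨right i b, mem_D.2 (.inr (.inr (.inr (.inr ⟨i, hi, b, rfl⟩)))), rfl⟩
    have hcard := Finset.card_le_card hsub
    rw [hS, ← length_D] at hcard
    rw [← Multiset.coe_nodup, ← Multiset.toFinset_card_eq_card_iff_nodup]
    refine le_antisymm (Multiset.toFinset_card_le _) ?_
    rw [Multiset.coe_card, List.length_map]
    exact hcard
  · intro p hp
    rw [mem_D] at hp ⊢
    rcases hp with ⟨i, hi, b, rfl⟩ | ⟨i, hi, b, rfl⟩ | ⟨i, hi, b, rfl⟩ | ⟨i, hi, b, rfl⟩ |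
      ⟨i, hi, b, rfl⟩
    · exact .inl ⟨i, hi, _, rfl⟩
    · exact .inr (.inl ⟨i, hi, _, rfl⟩)
    · exact .inr (.inr (.inl ⟨i, hi, _, rfl⟩))
    · exact .inr (.inr (.inr (.inl ⟨i, hi, _, rfl⟩)))
    · exact .inr (.inr (.inr (.inr ⟨i, hi, _, rfl⟩)))

theorem crossingCount_D {n : ℕ} (hn : 1 ≤ n) : crossingCount (D n) = 7 * n - 1 := by
  have h1 := (isGaussWord_D n).length_eq
  rw [length_D] at h1
  omega

/-! ### An explicit labelling of the faces of `D n` -/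

/-- The face between the two strands of the upper twist, after `i` crossings. -/
def topGap (n i : ℕ) : ℕ × ℕ := if i = 0 then (2, n) else if i = 2 * n - 1 then (1, n) else (3, i)

/-- The face between the two strands of the lower twist, after `i` crossings. -/
def bottomGap (n i : ℕ) : ℕ × ℕ := if i = 0 then (1, 0) else if i = 2 * n then (2, 0) else (4, i)

/-- The faces to the left and to the right of the first strand of the upper twist. -/
def topFaces (n i : ℕ) : (ℕ × ℕ) × (ℕ × ℕ) :=
  if Even i then ((2, n + 1), topGap n i) else (topGap n i, (0, n))

/-- The faces to the left and to the right of the second strand of the upper twist. -/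
def topFaces' (n i : ℕ) : (ℕ × ℕ) × (ℕ × ℕ) :=
  if Even i then (topGap n i, (0, n)) else ((2, n + 1), topGap n i)

/-- The faces to the left and to the right of the first strand of the lower twist. -/
def bottomFaces (n i : ℕ) : (ℕ × ℕ) × (ℕ × ℕ) :=
  if Even i then (bottomGap n i, (0, 0)) else ((2, 1), bottomGap n i)

/-- The faces to the left and to the right of the second strand of the lower twist. -/
def bottomFaces' (n i : ℕ) : (ℕ × ℕ) × (ℕ × ℕ) :=
  if Even i then ((2, 1), bottomGap n i) else (bottomGap n i, (0, 0))

/-- The faces to the left and to the right of the edge into a passage. The faces between the left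
and the middle strand are `(0, h)`, those between the middle and the right one `(1, h)`, for
`0 ≤ h ≤ n`. The faces to the left of the left strand are `(2, h)`, those to the right of the right
one `(2, h + 1)`. -/
def facesIn (n : ℕ) : Passage → (ℕ × ℕ) × (ℕ × ℕ)
  | ⟨(0, i), b, _⟩ => if b = decide (Even i) then topFaces n i else topFaces' n i
  | ⟨(1, i), b, _⟩ => if b = decide (Even i) then bottomFaces n i else bottomFaces' n i
  | ⟨(2, j), true, _⟩ => ((2, j), (0, j))
  | ⟨(2, j), false, _⟩ => ((2, j + 1), (2, j))
  | ⟨(3, j), true, _⟩ => ((1, j + 1), (0, j + 1))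
  | ⟨(3, j), false, _⟩ => ((0, j + 1), (0, j))
  | ⟨(_, j), true, _⟩ => ((2, j + 2), (1, j + 1))
  | ⟨(_, j), false, _⟩ => ((1, j + 1), (1, j))

/-- The faces to the left and to the right of the edge out of a passage. -/
def facesOut (n : ℕ) : Passage → (ℕ × ℕ) × (ℕ × ℕ)
  | ⟨(0, i), b, _⟩ => if b = decide (Even i) then topFaces n (i + 1) else topFaces' n (i + 1)
  | ⟨(1, i), b, _⟩ => if b = decide (Even i) then bottomFaces n (i + 1) else bottomFaces' n (i + 1)
  | ⟨(2, j), true, _⟩ => ((2, j + 1), (0, j + 1))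
  | ⟨(2, j), false, _⟩ => ((0, j + 1), (0, j))
  | ⟨(3, j), true, _⟩ => ((1, j), (0, j))
  | ⟨(3, j), false, _⟩ => ((1, j + 1), (1, j))
  | ⟨(_, j), true, _⟩ => ((2, j + 1), (1, j))
  | ⟨(_, j), false, _⟩ => ((2, j + 2), (2, j + 1))

theorem odd_iff_even_iff (i : ℕ) : (Odd i ↔ Even i) ↔ False := by
  rw [← Nat.not_even_iff_odd]
  tauto

theorem path_faces {n : ℕ} (hn : 1 ≤ n) :
    Path (facesIn n) (facesOut n) ((2, n + 1), (2, n)) (D n) ((2, n + 1), (2, n)) := by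
  have hodd : ¬ Even (2 * n - 1) := Nat.not_even_iff_odd.2 ⟨n - 1, by omega⟩
  have hne : 2 * n - 1 ≠ 0 := by omega
  have hne' : n ≠ 0 := by omega
  have t := path_map_range (i := facesIn n) (o := facesOut n) (fun i => top i (decide (Even i)))
    (topFaces n) (2 * n - 1) (by intro k _; simp [facesIn, facesOut, top])
  have t' := path_map_range (i := facesIn n) (o := facesOut n) (fun i => top i (decide (Odd i)))
    (topFaces' n) (2 * n - 1) (by intro k _; simp [facesIn, facesOut, top, odd_iff_even_iff])
  have b := path_map_range (i := facesIn n) (o := facesOut n) (fun i => bottom i (decide (Even i)))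
    (bottomFaces n) (2 * n) (by intro k _; simp [facesIn, facesOut, bottom])
  have b' := path_map_range (i := facesIn n) (o := facesOut n) (fun i => bottom i (decide (Odd i)))
    (bottomFaces' n) (2 * n) (by intro k _; simp [facesIn, facesOut, bottom, odd_iff_even_iff])
  have m := path_map_reverse_range (i := facesIn n) (o := facesOut n) (fun j => middle j true)
    (fun h => ((1, h), (0, h))) n (by intro k _; simp [facesIn, facesOut, middle])
  have r := path_map_reverse_range (i := facesIn n) (o := facesOut n) (fun j => right j true)
    (fun h => ((2, h + 1), (1, h))) n (by intro k _; simp [facesIn, facesOut, right])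
  have l := path_map_range (i := facesIn n) (o := facesOut n) (fun j => left j true)
    (fun h => ((2, h), (0, h))) n (by intro k _; simp [facesIn, facesOut, left])
  have h := path_flatMap_range (i := facesIn n) (o := facesOut n)
    (fun j => [left j false, middle j false, right j false])
    (fun h => ((2, h + 1), (2, h))) n (by
      intro k _; simp [facesIn, facesOut, left, middle, right])
  -- Evaluation at the ends of the pieces makes consecutive labels match; for instance the first
  -- upper strand ends at `((1, n), (0, n))`, where the middle vertical strand begins. This depends
  -- on the upper twist being odd and the lower one even.
  simp [topFaces, topFaces', bottomFaces, bottomFaces', topGap, bottomGap, hodd, hne, hne', -List.map_reverse] at t t' b b' m r l h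
  simp only [D, path_append]
  exact ⟨_, ⟨_, ⟨_, ⟨_, ⟨_, ⟨_, ⟨_, t, m⟩, b⟩, l⟩, t'⟩, r⟩, b'⟩, h⟩

theorem Path.comp {A B : Type*} (f : A → B) {i o : Passage → A} {a b : A} {w : Word}
    (h : Path i o a w b) : Path (f ∘ i) (f ∘ o) (f a) w (f b) := by
  induction w generalizing a with
  | nil => exact congrArg f h
  | cons p w ih => exact ⟨congrArg f h.1, ih h.2⟩

theorem isFaceLabelling_D {n : ℕ} (hn : 1 ≤ n) :
    IsFaceLabelling (D n) (2, n + 1) (2, n) (Prod.fst ∘ facesIn n) (Prod.fst ∘ facesOut n)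
      (Prod.snd ∘ facesIn n) (Prod.snd ∘ facesOut n) := by
  refine ⟨(path_faces hn).comp Prod.fst, (path_faces hn).comp Prod.snd, fun p hp hl => ?_⟩
  rcases mem_D.1 hp with ⟨i, hi, b, rfl⟩ | ⟨i, hi, b, rfl⟩ | ⟨i, hi, b, rfl⟩ | ⟨i, hi, b, rfl⟩ |
      ⟨i, hi, b, rfl⟩
  · obtain rfl : b = true := by simpa [top, Passage.crossedToLeft] using hl
    by_cases he : Even i
    · simp [Corners, facesIn, facesOut, top, Passage.mate, he, topFaces, topFaces', Nat.even_add_one]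
    · simp [Corners, facesIn, facesOut, top, Passage.mate, he, topFaces, topFaces', Nat.even_add_one]
  · obtain rfl : b = false := by simpa [bottom, Passage.crossedToLeft] using hl
    by_cases he : Even i
    · simp [Corners, facesIn, facesOut, bottom, Passage.mate, he, bottomFaces, bottomFaces', Nat.even_add_one]
    · simp [Corners, facesIn, facesOut, bottom, Passage.mate, he, bottomFaces, bottomFaces', Nat.even_add_one]
  · obtain rfl : b = false := by simpa [left, Passage.crossedToLeft] using hl
    simp [Corners, facesIn, facesOut, left, Passage.mate]
  · obtain rfl : b = true := by simpa [middle, Passage.crossedToLeft] using hl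
    simp [Corners, facesIn, facesOut, middle, Passage.mate]
  · obtain rfl : b = true := by simpa [right, Passage.crossedToLeft] using hl
    simp [Corners, facesIn, facesOut, right, Passage.mate]

/-- The labels of the faces. -/
def faceLabels (n : ℕ) : Finset (ℕ × ℕ) :=
  {0} ×ˢ Finset.range (n + 1) ∪ {1} ×ˢ Finset.range (n + 1) ∪ {2} ×ˢ Finset.range (n + 2) ∪
    {3} ×ˢ Finset.Ico 1 (2 * n - 1) ∪ {4} ×ˢ Finset.Ico 1 (2 * n)

theorem card_faceLabels {n : ℕ} (hn : 1 ≤ n) : (faceLabels n).card = 7 * n + 1 := by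
  have hd : ∀ (a b : ℕ) (s t : Finset ℕ), a ≠ b → Disjoint ({a} ×ˢ s) ({b} ×ˢ t) :=
    fun a b s t h => Finset.disjoint_product.2 (.inl (by simpa using h))
  rw [faceLabels, Finset.card_union_of_disjoint, Finset.card_union_of_disjoint,
    Finset.card_union_of_disjoint, Finset.card_union_of_disjoint]
  · simp
    omega
  all_goals
    try simp only [Finset.disjoint_union_left]
    repeat' apply And.intro
    all_goals exact hd _ _ _ _ (by norm_num)

/-- There are `7 n + 1` labels, two more than crossings; it remains to find an edge beside each of
them. -/
theorem isKnotDiagram_D {n : ℕ} (hn : 1 ≤ n) : IsKnotDiagram (D n) := by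
  refine (isGaussWord_D n).isKnotDiagram_of_labelling (isFaceLabelling_D hn) (faceLabels n) ?_
    (by rw [card_faceLabels hn, crossingCount_D hn]; omega)
  have hl : ∀ {j} b, j < n → left j b ∈ D n :=
    fun b hj => mem_D.2 (.inr (.inr (.inl ⟨_, hj, b, rfl⟩)))
  have hm : ∀ {j} b, j < n → middle j b ∈ D n :=
    fun b hj => mem_D.2 (.inr (.inr (.inr (.inl ⟨_, hj, b, rfl⟩))))
  have hr : ∀ {j} b, j < n → right j b ∈ D n :=
    fun b hj => mem_D.2 (.inr (.inr (.inr (.inr ⟨_, hj, b, rfl⟩))))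
  have ht : ∀ {j} b, j < 2 * n - 1 → top j b ∈ D n :=
    fun b hj => mem_D.2 (.inl ⟨_, hj, b, rfl⟩)
  have hb : ∀ {j} b, j < 2 * n → bottom j b ∈ D n :=
    fun b hj => mem_D.2 (.inr (.inl ⟨_, hj, b, rfl⟩))
  rintro ⟨c, h⟩ hs
  simp only [faceLabels, Finset.mem_union, Finset.mem_product, Finset.mem_singleton,
    Finset.mem_range, Finset.mem_Ico] at hs
  rcases hs with (((⟨rfl, hs⟩ | ⟨rfl, hs⟩) | ⟨rfl, hs⟩) | ⟨rfl, hs⟩) | ⟨rfl, hs⟩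
  · rcases h with _ | h
    · exact ⟨_, hl false (j := 0) (by omega), .inr rfl⟩
    · exact ⟨_, hl false (j := h) (by omega), .inl rfl⟩
  · rcases h with _ | h
    · exact ⟨_, hm false (j := 0) (by omega), .inr rfl⟩
    · exact ⟨_, hm false (j := h) (by omega), .inl rfl⟩
  · rcases h with _ | _ | h
    · refine ⟨_, hb (j := 2 * n - 1) true (by omega), .inr ?_⟩
      have hodd : ¬ Even (2 * n - 1) := Nat.not_even_iff_odd.2 ⟨n - 1, by omega⟩
      have : 2 * n - 1 + 1 = 2 * n := by omega
      have hne' : n ≠ 0 := by omega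
      simp [facesOut, bottom, hodd, this, bottomFaces', bottomGap, hne']
    · exact ⟨_, hr (j := 0) false (by omega), .inr rfl⟩
    · exact ⟨_, hr (j := h) false (by omega), .inl rfl⟩
  · obtain ⟨i, rfl⟩ : ∃ i, h = i + 1 := ⟨h - 1, by omega⟩
    refine ⟨_, ht (j := i) (decide (Even i)) (by omega), ?_⟩
    have : i + 1 ≠ 2 * n - 1 := by omega
    by_cases he : Even i <;>
      simp [facesOut, top, topFaces, topGap, this, he, Nat.even_add_one]
  · obtain ⟨i, rfl⟩ : ∃ i, h = i + 1 := ⟨h - 1, by omega⟩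
    refine ⟨_, hb (j := i) (decide (Even i)) (by omega), ?_⟩
    have : i + 1 ≠ 2 * n := by omega
    by_cases he : Even i <;>
      simp [facesOut, bottom, bottomFaces, bottomGap, this, he, Nat.even_add_one]

section

/-! ## An invariant that changes slowly under Reidemeister moves -/

/-- The order in which the passages through the crossings `c` (`true`) and `d` (`false`) follow one
another. -/
def pattern (c d : CrossingName) (w : Word) : List Bool :=
  (w.filter fun p => p.crossing = c ∨ p.crossing = d).map fun p => decide (p.crossing = c)

/-- Four passages through two crossings alternate. -/
def Alternating (l : List Bool) : Prop := l = [true, false, true, false] ∨ l = [false, true, false, true]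

instance (l : List Bool) : Decidable (Alternating l) := inferInstanceAs (Decidable (_ ∨ _))

/-- Whether the crossings `c` and `d` are interlaced. -/
def interlaced (w : Word) (c d : CrossingName) : ℤ := if Alternating (pattern c d w) then 1 else 0

/-- The sign of the crossing. -/
def Passage.sign (p : Passage) : ℤ := if p.positive then 1 else -1

/-- Four times the linking number of the two curves that arise when the crossing `c` is
smoothed. -/
def linking (w : Word) (c : CrossingName) : ℤ :=
  (w.map fun q => q.sign * interlaced w c q.crossing).sum

/-- A combination of the linking numbers of all smoothings. -/
def weight (w : Word) : ℤ := (w.map fun p => p.sign * (|linking w p.crossing| + 4)).sum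

variable {w w' u v : Word} {c d : CrossingName}

theorem pattern_append : pattern c d (u ++ v) = pattern c d u ++ pattern c d v := by
  simp [pattern]

theorem pattern_eq_nil (h : ∀ p ∈ w, p.crossing ≠ c ∧ p.crossing ≠ d) : pattern c d w = [] := by
  simp only [pattern, List.map_eq_nil_iff, List.filter_eq_nil_iff, decide_eq_true_eq, not_or]
  exact h

/-- The reason why the crossing of a kink is interlaced with no other. -/
theorem not_alternating_of_adjacent (l m : List Bool) (b : Bool) :
    ¬ Alternating (l ++ [b, b] ++ m) := by
  have : ∀ x y : Bool, l ++ [b, b] ++ m ≠ [x, !x, x, !x] := by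
    intro x y
    rcases l with _ | ⟨_, _ | ⟨_, _ | ⟨_, _ | ⟨_, l⟩⟩⟩⟩ <;> cases x <;> cases b <;> simp
  rintro (h | h)
  · exact this true true h
  · exact this false true h

theorem alternating_append_comm (l m : List Bool) : Alternating (l ++ m) → Alternating (m ++ l) := by
  intro h
  have hl : l.length + m.length = 4 := by rcases h with h | h <;> simpa using congrArg List.length h
  rcases l with _ | ⟨a, _ | ⟨b, _ | ⟨c, _ | ⟨d, l⟩⟩⟩⟩
  · simpa using h
  · obtain ⟨x, y, z, rfl⟩ := List.length_eq_three.1 (by simp at hl; omega : m.length = 3)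
    revert h; cases a <;> cases x <;> cases y <;> cases z <;> decide
  · obtain ⟨x, y, rfl⟩ := List.length_eq_two.1 (by simp at hl; omega : m.length = 2)
    revert h; cases a <;> cases b <;> cases x <;> cases y <;> decide
  · obtain ⟨x, rfl⟩ := List.length_eq_one_iff.1 (by simp at hl; omega : m.length = 1)
    revert h; cases a <;> cases b <;> cases c <;> cases x <;> decide
  · have hm : m.length = 0 := by simp at hl; omega
    rw [List.length_eq_zero_iff] at hm
    subst hm
    simpa using h

theorem interlaced_append_comm : interlaced (u ++ v) c d = interlaced (v ++ u) c d := by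
  simp only [interlaced, pattern_append]
  exact if_congr ⟨alternating_append_comm _ _, alternating_append_comm _ _⟩ rfl rfl

theorem interlaced_self : interlaced w c c = 0 := by
  refine if_neg fun h => ?_
  have hall : ∀ b ∈ pattern c c w, b = true := by simp [pattern]
  rcases h with h | h <;> rw [h] at hall <;> simp at hall

theorem interlaced_comm (hcd : c ≠ d) : interlaced w c d = interlaced w d c := by
  have h : pattern d c w = (pattern c d w).map not := by
    simp only [pattern, List.map_map]
    have : (w.filter fun p => p.crossing = d ∨ p.crossing = c) =
      w.filter fun p => p.crossing = c ∨ p.crossing = d := by simp only [or_comm]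
    rw [this]
    refine List.map_congr_left fun p hp => ?_
    rcases (by simpa using hp : p ∈ w ∧ (p.crossing = c ∨ p.crossing = d)).2 with h | h
    · simp [h, hcd]
    · simp [h, hcd.symm]
  have hinv : ∀ l : List Bool, Alternating l → Alternating (l.map not) := by
    rintro l (rfl | rfl) <;> simp [Alternating]
  refine if_congr ⟨fun hA => by rw [h]; exact hinv _ hA, fun hA => ?_⟩ rfl rfl
  have := hinv _ hA
  rw [h, List.map_map] at this
  simpa [Function.comp_def] using this

theorem interlaced_nonneg : 0 ≤ interlaced w c d ∧ interlaced w c d ≤ 1 := by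
  unfold interlaced; split_ifs <;> simp

/-! ### Change of names and base point -/

theorem weight_append_comm : weight (u ++ v) = weight (v ++ u) := by
  have h1 : ∀ c, linking (u ++ v) c = linking (v ++ u) c := by
    intro c
    simp only [linking, interlaced_append_comm (u := u)]
    exact (List.perm_append_comm.map _).sum_eq
  simp only [weight, h1]
  exact (List.perm_append_comm.map _).sum_eq

theorem weight_rename (f : Equiv.Perm CrossingName) (w : Word) : weight (rename f w) = weight w := by
  have hp : ∀ c d, pattern (f c) (f d) (rename f w) = pattern c d w := by
    intro c d
    simp only [pattern, rename, List.filter_map, List.map_map, Function.comp_def,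
      EmbeddingLike.apply_eq_iff_eq]
  have hi : ∀ c d, interlaced (rename f w) (f c) (f d) = interlaced w c d := fun c d => by
    simp only [interlaced, hp]
  have hl : ∀ c, linking (rename f w) (f c) = linking w c := fun c => by
    simp only [linking]
    conv_lhs => enter [1, 2]; rw [rename]
    simp only [List.map_map, Function.comp_def, hi]
    rfl
  simp only [weight]
  conv_lhs => enter [1, 2]; rw [rename]
  simp only [List.map_map, Function.comp_def, hl]
  rfl

/-! ### First move -/

theorem Passage.sign_mate (p : Passage) : p.mate.sign = p.sign := rfl

theorem Passage.abs_sign (p : Passage) : |p.sign| = 1 := by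
  unfold Passage.sign; split_ifs <;> simp

theorem linking_of_perm (hp : w.Perm (u ++ v)) : linking w c =
    (u.map fun q => q.sign * interlaced w c q.crossing).sum +
      (v.map fun q => q.sign * interlaced w c q.crossing).sum := by
  rw [linking, (hp.map _).sum_eq, List.map_append, List.sum_append]

theorem weight_of_perm (hp : w.Perm (u ++ v)) : weight w =
    (u.map fun p => p.sign * (|linking w p.crossing| + 4)).sum +
      (v.map fun p => p.sign * (|linking w p.crossing| + 4)).sum := by
  rw [weight, (hp.map _).sum_eq, List.map_append, List.sum_append]

theorem sum_map_congr {f g : Passage → ℤ} (h : ∀ p ∈ w, f p = g p) :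
    (w.map f).sum = (w.map g).sum := by rw [List.map_congr_left h]

/-- The crossing has linking number `0` and influences no other. Its two passages contribute `4`
each, up to sign; this is where the constant in `weight` attains the bound. -/
theorem abs_weight_sub_kink {l₁ l₂ : Word} {p : Passage}
    (hg : IsGaussWord (l₁ ++ [p, p.mate] ++ l₂)) :
    |weight (l₁ ++ [p, p.mate] ++ l₂) - weight (l₁ ++ l₂)| ≤ 8 := by
  set W := l₁ ++ [p, p.mate] ++ l₂ with hW
  have hperm : W.Perm ([p, p.mate] ++ (l₁ ++ l₂)) := perm_kink ..
  have hne : ∀ q ∈ l₁ ++ l₂, q.crossing ≠ p.crossing := fun q hq =>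
    hg.crossing_ne hperm (by simp) (by simp) hq
  have hold : ∀ c d, c ≠ p.crossing → d ≠ p.crossing →
      interlaced W c d = interlaced (l₁ ++ l₂) c d := by
    intro c d hc hd
    have : pattern c d [p, p.mate] = [] := pattern_eq_nil (by simp [hc.symm, hd.symm])
    simp only [hW, interlaced, pattern_append, this, List.append_nil]
  have hnew : ∀ d, interlaced W p.crossing d = 0 := by
    intro d
    have : pattern p.crossing d [p, p.mate] = [true, true] := by simp [pattern]
    simp only [hW, interlaced, pattern_append, this]
    exact if_neg (not_alternating_of_adjacent _ _ _)
  have hnew' : ∀ c, c ≠ p.crossing → interlaced W c p.crossing = 0 :=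
    fun c hc => by rw [interlaced_comm hc, hnew]
  have hlp : linking W p.crossing = 0 := by simp [linking, hnew]
  have hlq : ∀ c, c ≠ p.crossing →
      linking W c = linking (l₁ ++ l₂) c := by
    intro c hc
    rw [linking_of_perm hperm, linking,
      sum_map_congr (w := l₁ ++ l₂) fun q hq => by rw [hold c _ hc (hne q hq)]]
    simp [hnew' c hc]
  rw [weight_of_perm hperm, weight,
    sum_map_congr (w := l₁ ++ l₂) fun q hq => by rw [hlq _ (hne q hq)]]
  simp only [List.map_cons, List.map_nil, List.sum_cons, List.sum_nil, Passage.mate_crossing, hlp,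
    Passage.sign_mate]
  have := p.abs_sign
  rw [abs_eq one_pos.le] at this
  rcases this with h | h <;> simp [h]

/-! ### Second move -/

/-- The two crossings are interlaced with the same others and have opposite signs, so their effects
on other linking numbers cancel, as do their constants `4`. Their own values of `linking` differ
only through their interlacing with each other, by at most `4`, and each crossing counts twice in
`weight`. -/
theorem abs_weight_sub_bigon {l₁ l₂ l₃ : Word} {p q r s : Passage}
    (hrs : r = p.mate ∧ s = q.mate ∨ r = q.mate ∧ s = p.mate) (hs : p.positive ≠ q.positive)
    (hg : IsGaussWord (l₁ ++ [p, q] ++ l₂ ++ [r, s] ++ l₃)) :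
    |weight (l₁ ++ [p, q] ++ l₂ ++ [r, s] ++ l₃) - weight (l₁ ++ l₂ ++ l₃)| ≤ 8 := by
  have hsgn : q.sign = -p.sign := by
    revert hs; unfold Passage.sign; cases p.positive <;> cases q.positive <;> simp
  have hpq : p.crossing ≠ q.crossing := by
    intro hc
    rcases hg.eq_or_eq_mate (p := p) (q := q) (by simp) (by simp) hc with h | h <;>
      exact hs (by simp [h])
  set W := l₁ ++ [p, q] ++ l₂ ++ [r, s] ++ l₃ with hW
  have hperm : W.Perm ([p, q, p.mate, q.mate] ++ (l₁ ++ l₂ ++ l₃)) := by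
    rcases hrs with ⟨rfl, rfl⟩ | ⟨rfl, rfl⟩
    · exact perm_bigon ..
    · exact (perm_bigon ..).trans (.append_right _ (.cons _ (.cons _ (.swap _ _ _))))
  have hmates : ∀ s ∈ [p, q, p.mate, q.mate], s.mate ∈ [p, q, p.mate, q.mate] := by simp
  have hnep : ∀ s ∈ l₁ ++ l₂ ++ l₃, s.crossing ≠ p.crossing := fun s hs =>
    hg.crossing_ne hperm hmates (by simp) hs
  have hneq : ∀ s ∈ l₁ ++ l₂ ++ l₃, s.crossing ≠ q.crossing := fun s hs =>
    hg.crossing_ne hperm hmates (by simp) hs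
  have hrs' : r.crossing = p.crossing ∧ s.crossing = q.crossing ∨
      r.crossing = q.crossing ∧ s.crossing = p.crossing := by
    rcases hrs with ⟨rfl, rfl⟩ | ⟨rfl, rfl⟩ <;> simp
  have hold : ∀ c d, c ≠ p.crossing → c ≠ q.crossing → d ≠ p.crossing → d ≠ q.crossing →
      interlaced W c d = interlaced (l₁ ++ l₂ ++ l₃) c d := by
    intro c d hc hc' hd hd'
    have h1 : pattern c d [p, q] = [] :=
      pattern_eq_nil (by simp [hc.symm, hd.symm, hc'.symm, hd'.symm])
    have h2 : pattern c d [r, s] = [] := pattern_eq_nil (by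
      rcases hrs' with ⟨e1, e2⟩ | ⟨e1, e2⟩ <;>
      simp [e1, e2, hc.symm, hd.symm, hc'.symm, hd'.symm])
    simp only [hW, interlaced, pattern_append, h1, h2, List.append_nil]
  have hsame : ∀ c, c ≠ p.crossing → c ≠ q.crossing →
      interlaced W c p.crossing = interlaced W c q.crossing := by
    intro c hc hc'
    have hl : ∀ l : Word, (∀ s ∈ l, s ∈ l₁ ++ l₂ ++ l₃) →
        pattern c p.crossing l = pattern c q.crossing l := by
      intro l hl
      simp only [pattern]
      congr 1
      refine List.filter_congr fun s hs => ?_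
      simp [hnep s (hl s hs), hneq s (hl s hs)]
    have h1 : pattern c p.crossing [p, q] = pattern c q.crossing [p, q] := by
      simp [pattern, hpq, hpq.symm, hc.symm, hc'.symm]
    have h2 : pattern c p.crossing [r, s] = pattern c q.crossing [r, s] := by
      rcases hrs' with ⟨e1, e2⟩ | ⟨e1, e2⟩ <;>
      simp [pattern, e1, e2, hpq, hpq.symm, hc.symm, hc'.symm]
    simp only [hW, interlaced, pattern_append, h1, h2]
    rw [hl l₁ (by simp +contextual), hl l₂ (by simp +contextual), hl l₃ (by simp +contextual)]
  have hlink : ∀ c, c ≠ p.crossing → c ≠ q.crossing →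
      linking W c = linking (l₁ ++ l₂ ++ l₃) c := by
    intro c hc hc'
    rw [linking_of_perm hperm, linking,
      sum_map_congr (w := l₁ ++ l₂ ++ l₃) fun s hs => by rw [hold c _ hc hc' (hnep s hs) (hneq s hs)]]
    simp [hsame c hc hc', hsgn, Passage.sign_mate]
  have hdiff : |linking W p.crossing - linking W q.crossing| ≤ 4 := by
    have e : ((l₁ ++ l₂ ++ l₃).map fun s => s.sign * interlaced W p.crossing s.crossing).sum =
        ((l₁ ++ l₂ ++ l₃).map fun s => s.sign * interlaced W q.crossing s.crossing).sum :=
      sum_map_congr fun s hs => by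
        rw [interlaced_comm (hnep s hs).symm, interlaced_comm (hneq s hs).symm,
          hsame _ (hnep s hs) (hneq s hs)]
    rw [linking_of_perm hperm, linking_of_perm (c := q.crossing) hperm, e]
    simp only [List.map_cons, List.map_nil, List.sum_cons, List.sum_nil, Passage.mate_crossing,
      Passage.sign_mate, interlaced_self, interlaced_comm hpq, hsgn]
    have h1 := interlaced_nonneg (w := W) (c := q.crossing) (d := p.crossing)
    have := p.abs_sign
    rw [abs_eq one_pos.le] at this
    rw [abs_le]
    rcases this with h | h <;> rw [h] <;> constructor <;> linarith
  rw [weight_of_perm hperm, weight,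
    sum_map_congr (w := l₁ ++ l₂ ++ l₃) fun s hs => by rw [hlink _ (hnep s hs) (hneq s hs)]]
  simp only [List.map_cons, List.map_nil, List.sum_cons, List.sum_nil, Passage.mate_crossing,
      Passage.sign_mate, hsgn]
  have h1 := (abs_abs_sub_abs_le _ _).trans hdiff
  rw [abs_le] at h1 ⊢
  have := p.abs_sign
  rw [abs_eq one_pos.le] at this
  rcases this with h | h <;> rw [h] <;> constructor <;> linarith

end

section

variable {w w' u v : Word} {c d : CrossingName}

/-! ### Third move -/

/-- The sign that belongs to a truth value. -/
def boolSign (b : Bool) : ℤ := if b then 1 else -1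

/-- Two passages, in one order or the other. -/
def inOrder (x : Bool) (p q : Passage) : Word := if x then [p, q] else [q, p]

/-- A word with three strands on which the passages `p`, `q`, `r` and their mates lie. -/
def triangleWord (l₁ l₂ l₃ l₄ : Word) (p q r : Passage) (x y z : Bool) : Word :=
  l₁ ++ inOrder x p q ++ l₂ ++ inOrder y p.mate r ++ l₃ ++ inOrder z q.mate r.mate ++ l₄

section
variable {l₁ l₂ l₃ l₄ : Word} {p q r : Passage}

theorem perm_triangleWord (l₁ l₂ l₃ l₄ : Word) (p q r : Passage) (x y z : Bool) :
    (triangleWord l₁ l₂ l₃ l₄ p q r x y z).Perm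
      ([p, q, r, p.mate, q.mate, r.mate] ++ (l₁ ++ l₂ ++ l₃ ++ l₄)) :=
  List.perm_iff_count.2 fun a => by
    cases x <;> cases y <;> cases z <;>
    simp only [triangleWord, inOrder, List.count_append, List.count_cons, List.count_nil, if_true,
      Bool.false_eq_true, if_false] <;> omega

/-- Exchanging two neighbours is invisible unless both are recorded in the pattern. Hence a third
move affects only the interlacing of its own three crossings with one another. -/
theorem pattern_inOrder {x y : Bool} (h : ¬ ((p.crossing = c ∨ p.crossing = d) ∧
    (q.crossing = c ∨ q.crossing = d))) :
    pattern c d (inOrder x p q) = pattern c d (inOrder y p q) := by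
  have : ∀ x, pattern c d (inOrder x p q) = pattern c d [p, q] := by
    intro x
    cases x
    · by_cases h1 : p.crossing = c ∨ p.crossing = d
      · have h2 : ¬ (q.crossing = c ∨ q.crossing = d) := fun h2 => h ⟨h1, h2⟩
        simp [inOrder, pattern, h1, h2]
      · by_cases h2 : q.crossing = c ∨ q.crossing = d <;> simp [inOrder, pattern, h1, h2]
    · rfl
  rw [this, this]

theorem interlaced_triangleWord_of_ne (hpq : p.crossing ≠ q.crossing)
    (hpr : p.crossing ≠ r.crossing) (hqr : q.crossing ≠ r.crossing) (hp : c ≠ p.crossing)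
    (hq : c ≠ q.crossing) (hr : c ≠ r.crossing) (x y z x' y' z' : Bool) :
    interlaced (triangleWord l₁ l₂ l₃ l₄ p q r x y z) c d =
      interlaced (triangleWord l₁ l₂ l₃ l₄ p q r x' y' z') c d := by
  have h : ∀ s t : Passage, s.crossing ≠ t.crossing → s.crossing ≠ c → t.crossing ≠ c →
      ¬ ((s.crossing = c ∨ s.crossing = d) ∧ (t.crossing = c ∨ t.crossing = d)) := by
    rintro s t h1 h2 h3 ⟨h4 | h4, h5 | h5⟩
    exacts [h2 h4, h2 h4, h3 h5, h1 (h4.trans h5.symm)]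
  simp only [interlaced, triangleWord, pattern_append]
  rw [pattern_inOrder (y := x') (h p q hpq hp.symm hq.symm),
    pattern_inOrder (y := y') (h p.mate r hpr hp.symm hr.symm),
    pattern_inOrder (y := z') (h q.mate r.mate hqr hq.symm hr.symm)]

/-- The three mutual interlacings are independent, each governed by the order on one strand, so a
third move flips all of them. The negation for `p` and `r` comes from the cyclic order of the three
strands. -/
theorem interlaced_triangleWord (hpq : p.crossing ≠ q.crossing)
    (hpr : p.crossing ≠ r.crossing) (hqr : q.crossing ≠ r.crossing)
    (hl : ∀ s ∈ l₁ ++ l₂ ++ l₃ ++ l₄, s.crossing ≠ p.crossing ∧ s.crossing ≠ q.crossing ∧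
      s.crossing ≠ r.crossing) (x y z : Bool) :
    interlaced (triangleWord l₁ l₂ l₃ l₄ p q r x y z) p.crossing q.crossing = x.toNat ∧
    interlaced (triangleWord l₁ l₂ l₃ l₄ p q r x y z) p.crossing r.crossing = (!y).toNat ∧
    interlaced (triangleWord l₁ l₂ l₃ l₄ p q r x y z) q.crossing r.crossing = z.toNat := by
  simp only [List.mem_append] at hl
  have hnil : ∀ c d, (c = p.crossing ∨ c = q.crossing ∨ c = r.crossing) →
      (d = p.crossing ∨ d = q.crossing ∨ d = r.crossing) → ∀ l : Word, (∀ s ∈ l, ((s ∈ l₁ ∨ s ∈ l₂) ∨ s ∈ l₃) ∨ s ∈ l₄) →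
      pattern c d l = [] := by
    intro c d hc hd l hll
    refine pattern_eq_nil fun s hs => ?_
    obtain ⟨h1, h2, h3⟩ := hl s (hll s hs)
    rcases hc with rfl | rfl | rfl <;> rcases hd with rfl | rfl | rfl <;> simp [h1, h2, h3]
  simp only [interlaced, triangleWord, pattern_append]
  refine ⟨?_, ?_, ?_⟩ <;>
  · rw [hnil _ _ (by simp) (by simp) l₁ (by tauto), hnil _ _ (by simp) (by simp) l₂ (by tauto),
      hnil _ _ (by simp) (by simp) l₃ (by tauto), hnil _ _ (by simp) (by simp) l₄ (by tauto)]
    cases x <;> cases y <;> cases z <;>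
    simp [inOrder, pattern, Alternating, hpq, hpr, hqr, hpq.symm, hpr.symm, hqr.symm]

/-- The flips change `linking` at each of the three crossings by twice a sum or difference of two
signs. By `hsides` at least two of these changes vanish; the third is at most `4`, and is counted
twice. -/
theorem abs_weight_sub_triangleWord {x y z : Bool}
    (hg : IsGaussWord (triangleWord l₁ l₂ l₃ l₄ p q r x y z)) (hpq : p.crossing ≠ q.crossing)
    (hpr : p.crossing ≠ r.crossing) (hqr : q.crossing ≠ r.crossing)
    (hsides : (q.sign * boolSign x = r.sign * boolSign y ∧
        p.sign * boolSign x = -(r.sign * boolSign z)) ∨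
      (q.sign * boolSign x = r.sign * boolSign y ∧ p.sign * boolSign y = q.sign * boolSign z) ∨
      (p.sign * boolSign x = -(r.sign * boolSign z) ∧
        p.sign * boolSign y = q.sign * boolSign z)) :
    |weight (triangleWord l₁ l₂ l₃ l₄ p q r x y z) -
      weight (triangleWord l₁ l₂ l₃ l₄ p q r (!x) (!y) (!z))| ≤ 8 := by
  set W := triangleWord l₁ l₂ l₃ l₄ p q r x y z with hW
  set W' := triangleWord l₁ l₂ l₃ l₄ p q r (!x) (!y) (!z) with hW'
  have hperm : W.Perm _ := perm_triangleWord l₁ l₂ l₃ l₄ p q r x y z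
  have hperm' : W'.Perm _ := perm_triangleWord l₁ l₂ l₃ l₄ p q r (!x) (!y) (!z)
  have hmates : ∀ s ∈ [p, q, r, p.mate, q.mate, r.mate],
      s.mate ∈ [p, q, r, p.mate, q.mate, r.mate] := by simp
  have hne : ∀ s ∈ l₁ ++ l₂ ++ l₃ ++ l₄, s.crossing ≠ p.crossing ∧ s.crossing ≠ q.crossing ∧
      s.crossing ≠ r.crossing := fun s hs =>
    ⟨hg.crossing_ne hperm hmates (by simp) hs, hg.crossing_ne hperm hmates (by simp) hs,
      hg.crossing_ne hperm hmates (by simp) hs⟩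
  have hsame : ∀ s ∈ l₁ ++ l₂ ++ l₃ ++ l₄, ∀ d,
      interlaced W s.crossing d = interlaced W' s.crossing d := fun s hs d => by
    obtain ⟨h1, h2, h3⟩ := hne s hs
    exact interlaced_triangleWord_of_ne hpq hpr hqr h1 h2 h3 ..
  have hlink : ∀ s ∈ l₁ ++ l₂ ++ l₃ ++ l₄, linking W s.crossing = linking W' s.crossing := by
    intro s hs
    simp only [linking, hsame s hs]
    exact ((hperm.trans hperm'.symm).map _).sum_eq
  have hrest : ∀ c, c = p.crossing ∨ c = q.crossing ∨ c = r.crossing →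
      ((l₁ ++ l₂ ++ l₃ ++ l₄).map fun s => s.sign * interlaced W c s.crossing).sum =
      ((l₁ ++ l₂ ++ l₃ ++ l₄).map fun s => s.sign * interlaced W' c s.crossing).sum := by
    intro c hc
    refine sum_map_congr fun s hs => ?_
    obtain ⟨h1, h2, h3⟩ := hne s hs
    have : c ≠ s.crossing := by rcases hc with rfl | rfl | rfl; exacts [h1.symm, h2.symm, h3.symm]
    rw [interlaced_comm this, hsame s hs, interlaced_comm this]
  obtain ⟨i1, i2, i3⟩ := interlaced_triangleWord hpq hpr hqr hne x y z
  obtain ⟨j1, j2, j3⟩ := interlaced_triangleWord hpq hpr hqr hne (!x) (!y) (!z)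
  rw [← hW] at i1 i2 i3
  rw [← hW'] at j1 j2 j3
  have key : ∀ b : Bool, (b.toNat : ℤ) - (!b).toNat = boolSign b := by decide
  have kx := key x
  have ky := key y
  have kz := key z
  have dp : linking W p.crossing - linking W' p.crossing =
      2 * (q.sign * boolSign x - r.sign * boolSign y) := by
    rw [linking_of_perm hperm, linking_of_perm (c := p.crossing) hperm', hrest _ (by simp)]
    simp only [List.map_cons, List.map_nil, List.sum_cons, List.sum_nil, Passage.mate_crossing,
      Passage.sign_mate, interlaced_self, i1, i2, j1, j2, Bool.not_not]
    rw [← kx, ← ky]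
    ring
  have dq : linking W q.crossing - linking W' q.crossing =
      2 * (p.sign * boolSign x + r.sign * boolSign z) := by
    rw [linking_of_perm hperm, linking_of_perm (c := q.crossing) hperm', hrest _ (by simp)]
    simp only [List.map_cons, List.map_nil, List.sum_cons, List.sum_nil, Passage.mate_crossing,
      Passage.sign_mate, interlaced_self, interlaced_comm hpq.symm, i1, i3, j1, j3]
    rw [← kx, ← kz]
    ring
  have dr : linking W r.crossing - linking W' r.crossing =
      2 * (- (p.sign * boolSign y) + q.sign * boolSign z) := by
    rw [linking_of_perm hperm, linking_of_perm (c := r.crossing) hperm', hrest _ (by simp)]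
    simp only [List.map_cons, List.map_nil, List.sum_cons, List.sum_nil, Passage.mate_crossing,
      Passage.sign_mate, interlaced_self, interlaced_comm hpr.symm, interlaced_comm hqr.symm,
      i2, i3, j2, j3, Bool.not_not]
    rw [← ky, ← kz]
    ring
  have hw : weight W - weight W' =
      2 * (p.sign * (|linking W p.crossing| - |linking W' p.crossing|) +
        q.sign * (|linking W q.crossing| - |linking W' q.crossing|) +
        r.sign * (|linking W r.crossing| - |linking W' r.crossing|)) := by
    rw [weight_of_perm hperm, weight_of_perm hperm',
      sum_map_congr (w := l₁ ++ l₂ ++ l₃ ++ l₄) fun s hs => by rw [hlink s hs]]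
    simp only [List.map_cons, List.map_nil, List.sum_cons, List.sum_nil, Passage.mate_crossing,
      Passage.sign_mate]
    ring
  have bound : ∀ (a b c : ℤ), |a - b| ≤ 4 → |c| = 1 → |2 * (c * (|a| - |b|))| ≤ 8 := by
    intro a b c h hc
    rw [abs_mul, abs_mul, hc]
    have := (abs_abs_sub_abs_le a b).trans h
    norm_num
    linarith
  have unit : ∀ b : Bool, |boolSign b| = 1 := by decide
  have four : ∀ a b : ℤ, |a| = 1 → |b| = 1 → |2 * (a + b)| ≤ 4 := by
    intro a b ha hb
    rw [abs_mul]
    have := abs_add_le a b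
    norm_num
    linarith
  have sp := p.abs_sign
  have sq := q.abs_sign
  have sr := r.abs_sign
  have mul1 : ∀ a b : ℤ, |a| = 1 → |b| = 1 → |a * b| = 1 := fun a b ha hb => by
    rw [abs_mul, ha, hb]; rfl
  rw [hw]
  rcases hsides with ⟨e1, e2⟩ | ⟨e1, e2⟩ | ⟨e1, e2⟩
  · rw [e1, sub_self, mul_zero, sub_eq_zero] at dp
    rw [e2, neg_add_cancel, mul_zero, sub_eq_zero] at dq
    rw [dp, dq]
    simp only [sub_self, mul_zero, zero_add]
    refine bound _ _ _ ?_ sr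
    rw [dr]
    exact four _ _ (by rw [abs_neg]; exact mul1 _ _ sp (unit _)) (mul1 _ _ sq (unit _))
  · rw [e1, sub_self, mul_zero, sub_eq_zero] at dp
    rw [e2, neg_add_cancel, mul_zero, sub_eq_zero] at dr
    rw [dp, dr]
    simp only [sub_self, mul_zero, zero_add, add_zero]
    refine bound _ _ _ ?_ sq
    rw [dq]
    exact four _ _ (mul1 _ _ sp (unit _)) (mul1 _ _ sr (unit _))
  · rw [e1, neg_add_cancel, mul_zero, sub_eq_zero] at dq
    rw [e2, neg_add_cancel, mul_zero, sub_eq_zero] at dr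
    rw [dq, dr]
    simp only [sub_self, mul_zero, add_zero]
    refine bound _ _ _ ?_ sp
    rw [dp, sub_eq_add_neg]
    exact four _ _ (mul1 _ _ sq (unit _)) (by rw [abs_neg]; exact mul1 _ _ sr (unit _))

/-- Smoothing the crossing of the top and the middle strand leaves a bottom strand that passes below
everything, so this smoothing changes by an isotopy; likewise for the middle and the bottom strand,
with the top strand passing above. Hence two of the three linking numbers are preserved. Here this
is a finite check over orders, levels and signs. -/
theorem IsTriangle.signs {x y z : Bool} (hpq : p.crossing ≠ q.crossing)
    (hpr : p.crossing ≠ r.crossing) (hqr : q.crossing ≠ r.crossing)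
    (h : IsTriangle (if x then p else q) (if x then q else p) (if y then p.mate else r)
      (if y then r else p.mate) (if z then q.mate else r.mate) (if z then r.mate else q.mate)) :
    (q.sign * boolSign x = r.sign * boolSign y ∧ p.sign * boolSign x = -(r.sign * boolSign z)) ∨
    (q.sign * boolSign x = r.sign * boolSign y ∧ p.sign * boolSign y = q.sign * boolSign z) ∨
    (p.sign * boolSign x = -(r.sign * boolSign z) ∧
      p.sign * boolSign y = q.sign * boolSign z) := by
  obtain ⟨-, -, ha, hb, hc, ht⟩ := h
  obtain ⟨cp, op, sp⟩ := p
  obtain ⟨cq, oq, sq⟩ := q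
  obtain ⟨cr, or, sr⟩ := r
  simp only at hpq hpr hqr
  have hpq' := hpq.symm
  have hpr' := hpr.symm
  have hqr' := hqr.symm
  have es : ∀ c o s, (⟨c, o, s⟩ : Passage).sign = boolSign s := fun c o s => by cases s <;> rfl
  have h1 : ∀ b : Bool, ¬ (b = !b) := by decide
  have h2 : ∀ b : Bool, ¬ ((!b) = b) := by decide
  cases x <;> cases y <;> cases z <;>
  · simp only [Passage.mate, Passage.crossedToLeft, List.mem_cons, List.not_mem_nil, or_false,
      Passage.mk.injEq, hpq, hpr, hqr, hpq', hpr', hqr', false_and, and_false, or_true,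
      and_true, if_true, Bool.false_eq_true, if_false, Bool.not_not, h1, h2,
      iff_true, iff_false]
      at ha hb hc ht
    clear h1 h2
    simp only [es]
    clear es hpq hpr hqr hpq' hpr' hqr'
    revert op oq or sp sq sr
    decide

/-- No edge joins the two passages of one crossing, so any two edges share exactly one: `p` lies on
the first and second edge, `q` on the first and third, `r` on the second and third. Their orders
along the edges give eight cases. -/
theorem IsTriangle.exists_inOrder {a₁ a₂ b₁ b₂ c₁ c₂ : Passage}
    (h : IsTriangle a₁ a₂ b₁ b₂ c₁ c₂) (hn : [a₁, a₂, b₁, b₂, c₁, c₂].Nodup) :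
    ∃ p q r : Passage, ∃ x y z : Bool, a₁ = (if x then p else q) ∧ a₂ = (if x then q else p) ∧
      b₁ = (if y then p.mate else r) ∧ b₂ = (if y then r else p.mate) ∧
      c₁ = (if z then q.mate else r.mate) ∧ c₂ = (if z then r.mate else q.mate) := by
  obtain ⟨hm, ⟨na, nb, nc⟩, -, -, -, -⟩ := h
  have h1 := hm a₁ (by simp)
  have h2 := hm a₂ (by simp)
  have h3 := hm b₁ (by simp)
  have h4 := hm b₂ (by simp)
  have h5 := hm c₁ (by simp)
  have h6 := hm c₂ (by simp)
  clear hm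
  simp only [List.mem_cons, List.not_mem_nil, or_false, List.nodup_cons, not_or, List.nodup_nil,
    and_true, not_false_eq_true] at h1 h2 h3 h4 h5 h6 hn
  have m1 := a₁.mate_mate
  have m2 := a₂.mate_mate
  have m3 := b₁.mate_mate
  have m4 := b₂.mate_mate
  have m5 := c₁.mate_mate
  have m6 := c₂.mate_mate
  have n1 := a₁.mate_ne
  have n2 := a₂.mate_ne
  have n3 := b₁.mate_ne
  have n4 := b₂.mate_ne
  have n5 := c₁.mate_ne
  have n6 := c₂.mate_ne
  have key : (a₁.mate = b₁ ∧ a₂.mate = c₁ ∧ b₂.mate = c₂) ∨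
      (a₁.mate = b₁ ∧ a₂.mate = c₂ ∧ b₂.mate = c₁) ∨
      (a₁.mate = b₂ ∧ a₂.mate = c₁ ∧ b₁.mate = c₂) ∨
      (a₁.mate = b₂ ∧ a₂.mate = c₂ ∧ b₁.mate = c₁) ∨
      (a₂.mate = b₁ ∧ a₁.mate = c₁ ∧ b₂.mate = c₂) ∨
      (a₂.mate = b₁ ∧ a₁.mate = c₂ ∧ b₂.mate = c₁) ∨
      (a₂.mate = b₂ ∧ a₁.mate = c₁ ∧ b₁.mate = c₂) ∨
      (a₂.mate = b₂ ∧ a₁.mate = c₂ ∧ b₁.mate = c₁) := by grind (splits := 30)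
  rcases key with ⟨e1, e2, e3⟩ | ⟨e1, e2, e3⟩ | ⟨e1, e2, e3⟩ | ⟨e1, e2, e3⟩ | ⟨e1, e2, e3⟩ |
    ⟨e1, e2, e3⟩ | ⟨e1, e2, e3⟩ | ⟨e1, e2, e3⟩
  · exact ⟨a₁, a₂, b₂, true, true, true, by simp [e1, e2, e3]⟩
  · exact ⟨a₁, a₂, b₂, true, true, false, by simp [e1, e2, e3]⟩
  · exact ⟨a₁, a₂, b₁, true, false, true, by simp [e1, e2, e3]⟩
  · exact ⟨a₁, a₂, b₁, true, false, false, by simp [e1, e2, e3]⟩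
  · exact ⟨a₂, a₁, b₂, false, true, true, by simp [e1, e2, e3]⟩
  · exact ⟨a₂, a₁, b₂, false, true, false, by simp [e1, e2, e3]⟩
  · exact ⟨a₂, a₁, b₁, false, false, true, by simp [e1, e2, e3]⟩
  · exact ⟨a₂, a₁, b₁, false, false, false, by simp [e1, e2, e3]⟩

theorem abs_weight_sub_triangle {a₁ a₂ b₁ b₂ c₁ c₂ : Passage}
    (h : IsTriangle a₁ a₂ b₁ b₂ c₁ c₂)
    (hg : IsGaussWord (l₁ ++ [a₁, a₂] ++ l₂ ++ [b₁, b₂] ++ l₃ ++ [c₁, c₂] ++ l₄)) :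
    |weight (l₁ ++ [a₁, a₂] ++ l₂ ++ [b₁, b₂] ++ l₃ ++ [c₁, c₂] ++ l₄) -
      weight (l₁ ++ [a₂, a₁] ++ l₂ ++ [b₂, b₁] ++ l₃ ++ [c₂, c₁] ++ l₄)| ≤ 8 := by
  have hperm := perm_triangle l₁ l₂ l₃ l₄ a₁ a₂ b₁ b₂ c₁ c₂
  have hn := (List.nodup_append.1 (hg.perm hperm).nodup_word).1
  obtain ⟨p, q, r, x, y, z, rfl, rfl, rfl, rfl, rfl, rfl⟩ := h.exists_inOrder hn
  have hseg : ∀ (x : Bool) (p q : Passage),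
      [if x then p else q, if x then q else p] = inOrder x p q ∧
      [if x then q else p, if x then p else q] = inOrder (!x) p q := by
    intro x p q; cases x <;> simp [inOrder]
  have hW : l₁ ++ [if x then p else q, if x then q else p] ++ l₂ ++
      [if y then p.mate else r, if y then r else p.mate] ++ l₃ ++
      [if z then q.mate else r.mate, if z then r.mate else q.mate] ++ l₄ =
      triangleWord l₁ l₂ l₃ l₄ p q r x y z := by
    rw [(hseg x p q).1, (hseg y p.mate r).1, (hseg z q.mate r.mate).1, triangleWord]
  have hW' : l₁ ++ [if x then q else p, if x then p else q] ++ l₂ ++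
      [if y then r else p.mate, if y then p.mate else r] ++ l₃ ++
      [if z then r.mate else q.mate, if z then q.mate else r.mate] ++ l₄ =
      triangleWord l₁ l₂ l₃ l₄ p q r (!x) (!y) (!z) := by
    rw [(hseg x p q).2, (hseg y p.mate r).2, (hseg z q.mate r.mate).2, triangleWord]
  rw [hW] at hg
  rw [hW, hW']
  have hp := perm_triangleWord l₁ l₂ l₃ l₄ p q r x y z
  have hn' := (List.nodup_append.1 (hg.perm hp).nodup_word).1
  have hmem : ∀ s ∈ [p, q, r, p.mate, q.mate, r.mate], s ∈ triangleWord l₁ l₂ l₃ l₄ p q r x y z :=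
    fun s hs => hp.symm.subset (List.mem_append_left _ hs)
  simp only [List.mem_cons, List.not_mem_nil, or_false, List.nodup_cons, not_or, List.nodup_nil,
    and_true, not_false_eq_true] at hn'
  have hpq : p.crossing ≠ q.crossing := fun hc => by
    rcases hg.eq_or_eq_mate (hmem p (by simp)) (hmem q (by simp)) hc with h | h <;> simp [h] at hn'
  have hpr : p.crossing ≠ r.crossing := fun hc => by
    rcases hg.eq_or_eq_mate (hmem p (by simp)) (hmem r (by simp)) hc with h | h <;> simp [h] at hn'
  have hqr : q.crossing ≠ r.crossing := fun hc => by
    rcases hg.eq_or_eq_mate (hmem q (by simp)) (hmem r (by simp)) hc with h | h <;> simp [h] at hn'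
  exact abs_weight_sub_triangleWord hg hpq hpr hqr (h.signs hpq hpr hqr)

end

/-! ### Lower bounds -/

theorem Move.abs_weight_sub_le (h : Move w v) (hg : IsGaussWord w) :
    |weight w - weight v| ≤ 8 := by
  cases h with
  | r1 l₁ l₂ p => exact abs_weight_sub_kink hg
  | r2_parallel l₁ l₂ l₃ p q ho hs => exact abs_weight_sub_bigon (.inl ⟨rfl, rfl⟩) hs hg
  | r2_antiparallel l₁ l₂ l₃ p q ho hs => exact abs_weight_sub_bigon (.inr ⟨rfl, rfl⟩) hs hg
  | r3 l₁ l₂ l₃ l₄ a₁ a₂ b₁ b₂ c₁ c₂ ht => exact abs_weight_sub_triangle ht hg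

theorem SphereIso.isGaussWord (h : SphereIso w v) (hg : IsGaussWord w) : IsGaussWord v := by
  cases h with
  | rename f w =>
    refine ⟨?_, fun p hp => ?_⟩
    · have : (KnotDiag.rename f w).map (fun p => (p.crossing, p.isOver)) =
          (w.map fun p => (p.crossing, p.isOver)).map (Prod.map f id) := by
        simp [KnotDiag.rename]
      rw [this]
      exact hg.nodup.map (f.injective.prodMap Function.injective_id)
    · obtain ⟨q, hq, rfl⟩ := List.mem_map.1 hp
      exact List.mem_map.2 ⟨q.mate, hg.mate_mem q hq, rfl⟩
  | rebase u v => exact hg.perm List.perm_append_comm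

theorem SphereIso.weight_eq (h : SphereIso w v) : weight v = weight w := by
  cases h with
  | rename f w => exact weight_rename f w
  | rebase u v => exact weight_append_comm

/-- The Gauss condition is carried along because the bound for the next move needs it. -/
theorem SphereReach.abs_weight_sub_le {k : ℕ} (h : SphereReach k w v) :
    IsGaussWord v ∧ |weight w - weight v| ≤ 8 * k := by
  induction h with
  | refl w hw => exact ⟨hw.isGaussWord, by simp⟩
  | iso _ hi ih => exact ⟨hi.isGaussWord ih.1, by rw [hi.weight_eq]; exact ih.2⟩
  | move _ hm hu ih =>
    refine ⟨hu.isGaussWord, ?_⟩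
    have hstep := hm.elim (fun h => h.abs_weight_sub_le ih.1) fun h => by
      rw [abs_sub_comm]; exact h.abs_weight_sub_le hu.isGaussWord
    refine (abs_sub_le _ _ _).trans ((add_le_add ih.2 hstep).trans ?_)
    push_cast
    linarith

theorem SphereReach.le_of_weight {k m : ℕ} (h : SphereReach k w U) (hw : weight w = 8 * m) :
    m ≤ k := by
  have := h.abs_weight_sub_le.2
  rw [hw, show weight U = 0 from rfl, sub_zero, abs_of_nonneg (by positivity)] at this
  exact_mod_cast (mul_le_mul_iff_right₀ (by norm_num)).1 this

end

/-! ## The invariant of the diagrams -/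

section
variable {w : Word} {pos : Passage → ℕ}

theorem IsGaussWord.filter_perm {p q : Passage} (hg : IsGaussWord w) (hp : p ∈ w) (hq : q ∈ w)
    (hpq : p.crossing ≠ q.crossing) :
    (w.filter fun r => r.crossing = p.crossing ∨ r.crossing = q.crossing).Perm
      [p, p.mate, q, q.mate] := by
  refine (List.perm_ext_iff_of_nodup (hg.nodup_word.filter _) ?_).2 fun r => ?_
  · have h1 : ∀ a b : Passage, a.crossing ≠ b.crossing → a ≠ b := fun a b h e => h (e ▸ rfl)
    simp [h1 p q hpq, h1 p q.mate hpq, h1 p.mate q hpq, h1 p.mate q.mate hpq,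
      p.mate_ne.symm, q.mate_ne.symm]
  · simp only [List.mem_filter, decide_eq_true_eq, List.mem_cons, List.not_mem_nil, or_false]
    constructor
    · rintro ⟨hr, h | h⟩
      · rcases hg.eq_or_eq_mate hp hr h.symm with h | h <;> simp [h]
      · rcases hg.eq_or_eq_mate hq hr h.symm with h | h <;> simp [h]
    · rintro (rfl | rfl | rfl | rfl)
      exacts [⟨hp, .inl rfl⟩, ⟨hg.mate_mem _ hp, .inl rfl⟩, ⟨hq, .inr rfl⟩,
        ⟨hg.mate_mem _ hq, .inr rfl⟩]

theorem filter_eq_of_sorted (hs : w.Pairwise fun p q => pos p < pos q) {f : Passage → Bool}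
    {l l' : Word} (hf : (w.filter f).Perm l) (hl : l'.Perm l)
    (hl' : l'.Pairwise fun p q => pos p < pos q) : w.filter f = l' :=
  (hf.trans hl.symm).eq_of_pairwise (fun _ _ _ _ h h' => absurd h h'.asymm) (hs.filter _) hl'

/-- Numbers increasing along the word turn interlacing into inequalities between four positions,
which `omega` can decide for a whole family of crossings at once. -/
theorem IsGaussWord.interlaced_eq {p q : Passage} (hg : IsGaussWord w)
    (hs : w.Pairwise fun p q => pos p < pos q) (hp : p ∈ w) (hq : q ∈ w)
    (hpq : p.crossing ≠ q.crossing) (hp' : pos p < pos p.mate) (hq' : pos q < pos q.mate) :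
    interlaced w p.crossing q.crossing =
      if (pos p < pos q ∧ pos q < pos p.mate ∧ pos p.mate < pos q.mate) ∨
        (pos q < pos p ∧ pos p < pos q.mate ∧ pos q.mate < pos p.mate) then 1 else 0 := by
  have hf := hg.filter_perm hp hq hpq
  have inj : ∀ a ∈ w, ∀ b ∈ w, a ≠ b → pos a ≠ pos b := fun a ha b hb hab h =>
    hab (List.inj_on_of_nodup_map (List.pairwise_map.2 (hs.imp ne_of_lt)) ha hb h)
  have h1 : ∀ a b : Passage, a.crossing ≠ b.crossing → a ≠ b := fun a b h e => h (e ▸ rfl)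
  have n1 := inj p hp q hq (h1 _ _ hpq)
  have n2 := inj p hp q.mate (hg.mate_mem _ hq) (h1 _ _ hpq)
  have n3 := inj p.mate (hg.mate_mem _ hp) q hq (h1 _ _ hpq)
  have n4 := inj p.mate (hg.mate_mem _ hp) q.mate (hg.mate_mem _ hq) (h1 _ _ hpq)
  have ev : ∀ l' : Word, l'.Perm [p, p.mate, q, q.mate] →
      l'.Pairwise (fun p q => pos p < pos q) → interlaced w p.crossing q.crossing =
        if Alternating (l'.map fun r => decide (r.crossing = p.crossing)) then 1 else 0 := by
    intro l' h h'
    rw [interlaced, pattern, filter_eq_of_sorted hs hf h h']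
  have hqp := hpq.symm
  have : (pos p < pos q ∧ pos q < pos p.mate ∧ pos p.mate < pos q.mate) ∨
      (pos q < pos p ∧ pos p < pos q.mate ∧ pos q.mate < pos p.mate) ∨
      (pos p < pos q ∧ pos q.mate < pos p.mate) ∨ (pos q < pos p ∧ pos p.mate < pos q.mate) ∨
      pos p.mate < pos q ∨ pos q.mate < pos p := by omega
  rcases this with h | h | h | h | h | h
  · rw [ev [p, q, p.mate, q.mate] (by grind) (by simp; omega), eq_comm, if_pos (.inl h)]
    simp [Alternating, hqp]
  · rw [ev [q, p, q.mate, p.mate] (by grind) (by simp; omega), eq_comm, if_pos (.inr h)]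
    simp [Alternating, hqp]
  · rw [ev [p, q, q.mate, p.mate] (by grind) (by simp; omega), eq_comm, if_neg (by omega)]
    simp [Alternating, hqp]
  · rw [ev [q, p, p.mate, q.mate] (by grind) (by simp; omega), eq_comm, if_neg (by omega)]
    simp [Alternating, hqp]
  · rw [ev [p, p.mate, q, q.mate] (by grind) (by simp; omega), eq_comm, if_neg (by omega)]
    simp [Alternating, hqp]
  · rw [ev [q, q.mate, p, p.mate] (by grind) (by simp; omega), eq_comm, if_neg (by omega)]
    simp [Alternating, hqp]

/-- The positions increase along the word, from at least `a` to less than `b`. -/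
def SortedIn (pos : Passage → ℕ) (a b : ℕ) (w : Word) : Prop :=
  (∀ p ∈ w, a ≤ pos p ∧ pos p < b) ∧ w.Pairwise fun p q => pos p < pos q

theorem SortedIn.append {a b c : ℕ} {u v : Word} (hu : SortedIn pos a b u)
    (hv : SortedIn pos b c v) (hab : a ≤ b) (hbc : b ≤ c) : SortedIn pos a c (u ++ v) := by
  refine ⟨fun p hp => ?_, List.pairwise_append.2 ⟨hu.2, hv.2, fun p hp q hq => ?_⟩⟩
  · rcases List.mem_append.1 hp with h | h
    · have := hu.1 p h; omega
    · have := hv.1 p h; omega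
  · have := hu.1 p hp; have := hv.1 q hq; omega

theorem sortedIn_map_range {a b n : ℕ} (f : ℕ → Passage)
    (h : ∀ k < n, a ≤ pos (f k) ∧ pos (f k) < b)
    (hf : ∀ j k, j < k → k < n → pos (f j) < pos (f k)) :
    SortedIn pos a b ((List.range n).map f) := by
  refine ⟨by simpa using h, List.pairwise_map.2 ?_⟩
  exact List.pairwise_lt_range.imp_of_mem fun _ hk hjk => hf _ _ hjk (List.mem_range.1 hk)

theorem sortedIn_map_reverse_range {a b n : ℕ} (f : ℕ → Passage)
    (h : ∀ k < n, a ≤ pos (f k) ∧ pos (f k) < b)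
    (hf : ∀ j k, j < k → k < n → pos (f k) < pos (f j)) :
    SortedIn pos a b ((List.range n).reverse.map f) := by
  refine ⟨by simpa using h, List.pairwise_map.2 (List.pairwise_reverse.2 ?_)⟩
  exact List.pairwise_lt_range.imp_of_mem fun _ hk hjk => hf _ _ hjk (List.mem_range.1 hk)

theorem sortedIn_flatMap_range {a b n : ℕ} (f : ℕ → Word)
    (h : ∀ k < n, SortedIn pos (a + b * k) (a + b * (k + 1)) (f k)) :
    SortedIn pos a (a + b * n) ((List.range n).flatMap f) := by
  induction n with
  | zero => simp [SortedIn]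
  | succ n ih =>
    rw [List.range_succ, List.flatMap_append, List.flatMap_singleton]
    exact (ih fun k hk => h k (by omega)).append (h n (by omega)) (by omega)
      (by rw [mul_add]; omega)

end

/-! ### Interlaced pairs and linking numbers in `D n` -/

/-- Numbers that increase along the word `D n`. -/
def position (n : ℕ) : Passage → ℕ
  | ⟨(0, i), b, _⟩ => if b = decide (Even i) then i else 16 * n + i
  | ⟨(1, i), b, _⟩ => if b = decide (Even i) then 8 * n + i else 24 * n + i
  | ⟨(2, j), true, _⟩ => 12 * n + j
  | ⟨(2, j), false, _⟩ => 28 * n + 3 * j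
  | ⟨(3, j), true, _⟩ => 4 * n + (n - j)
  | ⟨(3, j), false, _⟩ => 28 * n + 3 * j + 1
  | ⟨(_, j), true, _⟩ => 20 * n + (n - j)
  | ⟨(_, j), false, _⟩ => 28 * n + 3 * j + 2

theorem sorted_D (n : ℕ) : (D n).Pairwise fun p q => position n p < position n q := by
  -- Only the order of the positions matters; each piece before the horizontal strands gets its own
  -- interval of length `4 n`, which is ample.
  have t : SortedIn (position n) 0 (4 * n)
      ((List.range (2 * n - 1)).map fun i => top i (decide (Even i))) :=
    sortedIn_map_range _ (by intro k hk; simp [position, top]; omega)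
      (by intro j k hj hk; simpa [position, top])
  have m : SortedIn (position n) (4 * n) (8 * n)
      ((List.range n).reverse.map fun j => middle j true) :=
    sortedIn_map_reverse_range _ (by intro k hk; simp [position, middle]; omega)
      (by intro j k hj hk; simp [position, middle]; omega)
  have b : SortedIn (position n) (8 * n) (12 * n)
      ((List.range (2 * n)).map fun i => bottom i (decide (Even i))) :=
    sortedIn_map_range _ (by intro k hk; simp [position, bottom]; omega)
      (by intro j k hj hk; simpa [position, bottom])
  have l : SortedIn (position n) (12 * n) (16 * n)
      ((List.range n).map fun j => left j true) :=
    sortedIn_map_range _ (by intro k hk; simp [position, left]; omega)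
      (by intro j k hj hk; simpa [position, left])
  have t' : SortedIn (position n) (16 * n) (20 * n)
      ((List.range (2 * n - 1)).map fun i => top i (decide (Odd i))) :=
    sortedIn_map_range _ (by intro k hk; simp [position, top, odd_iff_even_iff]; omega)
      (by intro j k hj hk; simpa [position, top, odd_iff_even_iff])
  have r : SortedIn (position n) (20 * n) (24 * n)
      ((List.range n).reverse.map fun j => right j true) :=
    sortedIn_map_reverse_range _ (by intro k hk; simp [position, right]; omega)
      (by intro j k hj hk; simp [position, right]; omega)
  have b' : SortedIn (position n) (24 * n) (28 * n)
      ((List.range (2 * n)).map fun i => bottom i (decide (Odd i))) :=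
    sortedIn_map_range _ (by intro k hk; simp [position, bottom, odd_iff_even_iff]; omega)
      (by intro j k hj hk; simpa [position, bottom, odd_iff_even_iff])
  have h : SortedIn (position n) (28 * n) (28 * n + 3 * n)
      ((List.range n).flatMap fun j => [left j false, middle j false, right j false]) :=
    sortedIn_flatMap_range _ (by
      intro k hk; simp [SortedIn, position, left, middle, right]; omega)
  have h1 := t.append m (by omega) (by omega)
  have h2 := h1.append b (by omega) (by omega)
  have h3 := h2.append l (by omega) (by omega)
  have h4 := h3.append t' (by omega) (by omega)
  have h5 := h4.append r (by omega) (by omega)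
  have h6 := h5.append b' (by omega) (by omega)
  exact (h6.append h (by omega) (by omega)).2

/-- The crossings of `D n`. -/
def IsCrossing (n : ℕ) (c : CrossingName) : Prop :=
  c.1 = 0 ∧ c.2 < 2 * n - 1 ∨ c.1 = 1 ∧ c.2 < 2 * n ∨ (c.1 = 2 ∨ c.1 = 3 ∨ c.1 = 4) ∧ c.2 < n

/-- The position of the first passage through a crossing. -/
def firstPosition (n : ℕ) : CrossingName → ℕ
  | (0, i) => i
  | (1, i) => 8 * n + i
  | (2, j) => 12 * n + j
  | (3, j) => 4 * n + (n - j)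
  | (_, j) => 20 * n + (n - j)

/-- The position of the second passage through a crossing. -/
def secondPosition (n : ℕ) : CrossingName → ℕ
  | (0, i) => 16 * n + i
  | (1, i) => 24 * n + i
  | (2, j) => 28 * n + 3 * j
  | (3, j) => 28 * n + 3 * j + 1
  | (_, j) => 28 * n + 3 * j + 2

theorem IsCrossing.exists_passage {n : ℕ} {c : CrossingName} (hc : IsCrossing n c) :
    ∃ p ∈ D n, p.crossing = c ∧ position n p = firstPosition n c ∧
      position n p.mate = secondPosition n c ∧ position n p < position n p.mate := by
  obtain ⟨k, i⟩ := c
  simp only [IsCrossing] at hc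
  rcases hc with ⟨rfl, hi⟩ | ⟨rfl, hi⟩ | ⟨rfl | rfl | rfl, hi⟩
  · refine ⟨top i (decide (Even i)), mem_D.2 (.inl ⟨i, hi, _, rfl⟩), rfl, ?_⟩
    simp [position, top, Passage.mate, firstPosition, secondPosition]
    omega
  · refine ⟨bottom i (decide (Even i)), mem_D.2 (.inr (.inl ⟨i, hi, _, rfl⟩)), rfl, ?_⟩
    simp [position, bottom, Passage.mate, firstPosition, secondPosition]
    omega
  · refine ⟨left i true, mem_D.2 (.inr (.inr (.inl ⟨i, hi, _, rfl⟩))), rfl, rfl, rfl, ?_⟩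
    simp [position, left, Passage.mate]
    omega
  · refine ⟨middle i true, mem_D.2 (.inr (.inr (.inr (.inl ⟨i, hi, _, rfl⟩)))), rfl, rfl, rfl, ?_⟩
    simp [position, middle, Passage.mate]
    omega
  · refine ⟨right i true, mem_D.2 (.inr (.inr (.inr (.inr ⟨i, hi, _, rfl⟩)))), rfl, rfl, rfl, ?_⟩
    simp [position, right, Passage.mate]
    omega

theorem interlaced_D {n : ℕ} {c d : CrossingName} (hc : IsCrossing n c) (hd : IsCrossing n d) :
    interlaced (D n) c d =
      if (firstPosition n c < firstPosition n d ∧ firstPosition n d < secondPosition n c ∧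
          secondPosition n c < secondPosition n d) ∨
        (firstPosition n d < firstPosition n c ∧ firstPosition n c < secondPosition n d ∧
          secondPosition n d < secondPosition n c) then 1 else 0 := by
  by_cases hcd : c = d
  · subst hcd
    rw [interlaced_self, if_neg (by omega)]
  · obtain ⟨p, hp, rfl, h1, h2, h3⟩ := hc.exists_passage
    obtain ⟨q, hq, rfl, h4, h5, h6⟩ := hd.exists_passage
    rw [(isGaussWord_D n).interlaced_eq (sorted_D n) hp hq hcd h3 h6, h1, h2, h4, h5]

/-- Both passages through a crossing contribute equally, whence the factor `2`; the signs are those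
of the five families. -/
theorem sum_map_D (n : ℕ) (h : CrossingName → ℤ) :
    ((D n).map fun p => p.sign * h p.crossing).sum =
      2 * (∑ i ∈ Finset.range (2 * n - 1), h (0, i) - ∑ i ∈ Finset.range (2 * n), h (1, i) -
        ∑ j ∈ Finset.range n, h (2, j) + ∑ j ∈ Finset.range n, h (3, j) +
        ∑ j ∈ Finset.range n, h (4, j)) := by
  have hr : ∀ (m : ℕ) (f : ℕ → ℤ), ((List.range m).map f).sum = ∑ i ∈ Finset.range m, f i :=
    fun m f => rfl
  have hf : ∀ m, (((List.range m).flatMap fun j => [left j false, middle j false, right j false]).map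
      fun p => p.sign * h p.crossing).sum = - ∑ j ∈ Finset.range m, h (2, j) +
        ∑ j ∈ Finset.range m, h (3, j) + ∑ j ∈ Finset.range m, h (4, j) := by
    intro m
    induction m with
    | zero => simp
    | succ m ih =>
      rw [List.range_succ, List.flatMap_append, List.map_append, List.sum_append, ih]
      simp only [Finset.sum_range_succ, List.flatMap_singleton, List.map_cons, List.map_nil,
        List.sum_cons, List.sum_nil, Passage.sign, left, middle, right]
      simp
      ring
  simp only [D, List.map_append, List.sum_append, hf]
  simp only [List.map_map, List.map_reverse,
    List.sum_reverse, hr, Function.comp_def, Passage.sign, top, bottom, left, middle, right,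
    if_true, Bool.false_eq_true, if_false, one_mul, neg_one_mul, Finset.sum_neg_distrib]
  ring

theorem sum_range_ite_le {n j : ℕ} (h : j ≤ n) :
    ∑ k ∈ Finset.range n, (if j ≤ k then 1 else 0 : ℤ) = n - j := by
  induction n, h using Nat.le_induction with
  | base => simp +contextual
  | succ n hn ih => rw [Finset.sum_range_succ, ih, if_pos hn]; push_cast; ring

theorem sum_range_ite_lt {n j : ℕ} (h : j ≤ n) :
    ∑ k ∈ Finset.range n, (if k < j then 1 else 0 : ℤ) = j := by
  have h1 := sum_range_ite_le h
  have h2 : ∑ k ∈ Finset.range n, ((if k < j then 1 else 0 : ℤ) + if j ≤ k then 1 else 0) = n := by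
    rw [Finset.sum_congr rfl (g := fun _ => 1) fun k _ => by split_ifs <;> omega]
    simp
  rw [Finset.sum_add_distrib] at h2
  linarith

theorem sum_range_ite_ne {n j : ℕ} (h : j < n) :
    ∑ k ∈ Finset.range n, (if k ≠ j then 1 else 0 : ℤ) = n - 1 := by
  have h1 := sum_range_ite_lt h.le
  have h2 := sum_range_ite_le (Nat.succ_le_of_lt h)
  rw [Finset.sum_congr rfl (g := fun k => (if k < j then 1 else 0 : ℤ) + if j + 1 ≤ k then 1 else 0)
    fun k _ => by split_ifs <;> omega, Finset.sum_add_distrib, h1, h2]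
  push_cast
  ring

/-- The predicates `t`, `b`, `l`, `m`, `r` pick out, in each family, the crossings interlaced with
`c`; what remains is to count them with signs. -/
theorem linking_D {n : ℕ} {c : CrossingName} {t b l m r : ℕ → Prop} [DecidablePred t]
    [DecidablePred b] [DecidablePred l] [DecidablePred m] [DecidablePred r]
    (hc : IsCrossing n c)
    (h : ∀ d, IsCrossing n d → ((firstPosition n c < firstPosition n d ∧
      firstPosition n d < secondPosition n c ∧ secondPosition n c < secondPosition n d) ∨
        (firstPosition n d < firstPosition n c ∧ firstPosition n c < secondPosition n d ∧
          secondPosition n d < secondPosition n c) ↔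
      d.1 = 0 ∧ t d.2 ∨ d.1 = 1 ∧ b d.2 ∨ d.1 = 2 ∧ l d.2 ∨ d.1 = 3 ∧ m d.2 ∨ d.1 = 4 ∧ r d.2)) :
    linking (D n) c = 2 * (∑ i ∈ Finset.range (2 * n - 1), (if t i then 1 else 0) -
      ∑ i ∈ Finset.range (2 * n), (if b i then 1 else 0) -
      ∑ j ∈ Finset.range n, (if l j then 1 else 0) + ∑ j ∈ Finset.range n, (if m j then 1 else 0) +
      ∑ j ∈ Finset.range n, (if r j then 1 else 0)) := by
  have key : ∀ d, IsCrossing n d → interlaced (D n) c d =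
      if d.1 = 0 ∧ t d.2 ∨ d.1 = 1 ∧ b d.2 ∨ d.1 = 2 ∧ l d.2 ∨ d.1 = 3 ∧ m d.2 ∨ d.1 = 4 ∧ r d.2
      then 1 else 0 := fun d hd => by
    rw [interlaced_D hc hd]
    exact if_congr (h d hd) rfl rfl
  have e0 : ∑ i ∈ Finset.range (2 * n - 1), interlaced (D n) c (0, i) =
      ∑ i ∈ Finset.range (2 * n - 1), if t i then 1 else 0 :=
    Finset.sum_congr rfl fun i hi => by
      rw [key _ (by simpa [IsCrossing] using hi)]
      simp
  have e1 : ∑ i ∈ Finset.range (2 * n), interlaced (D n) c (1, i) =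
      ∑ i ∈ Finset.range (2 * n), if b i then 1 else 0 :=
    Finset.sum_congr rfl fun i hi => by
      rw [key _ (by simpa [IsCrossing] using hi)]
      simp
  have e2 : ∑ i ∈ Finset.range n, interlaced (D n) c (2, i) =
      ∑ i ∈ Finset.range n, if l i then 1 else 0 :=
    Finset.sum_congr rfl fun i hi => by
      rw [key _ (by simpa [IsCrossing] using hi)]
      simp
  have e3 : ∑ i ∈ Finset.range n, interlaced (D n) c (3, i) =
      ∑ i ∈ Finset.range n, if m i then 1 else 0 :=
    Finset.sum_congr rfl fun i hi => by
      rw [key _ (by simpa [IsCrossing] using hi)]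
      simp
  have e4 : ∑ i ∈ Finset.range n, interlaced (D n) c (4, i) =
      ∑ i ∈ Finset.range n, if r i then 1 else 0 :=
    Finset.sum_congr rfl fun i hi => by
      rw [key _ (by simpa [IsCrossing] using hi)]
      simp
  rw [linking, sum_map_D n (interlaced (D n) c), e0, e1, e2, e3, e4]

/-- Linking number `-1`: the other `2 n - 2` upper crossings against all `2 n` lower ones, while the
left and the middle family cancel. -/
theorem linking_top {n i : ℕ} (hi : i < 2 * n - 1) : linking (D n) (0, i) = -4 := by
  rw [linking_D (t := (· ≠ i)) (b := fun _ => True) (l := fun _ => True) (m := fun _ => True)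
    (r := fun _ => False) (.inl ⟨rfl, hi⟩), sum_range_ite_ne hi]
  · simp
    zify [show 1 ≤ 2 * n by omega]
    ring
  · rintro ⟨_, j⟩ hd
    simp only [IsCrossing] at hd
    rcases hd with ⟨rfl, hj⟩ | ⟨rfl, hj⟩ | ⟨rfl | rfl | rfl, hj⟩ <;>
      simp [firstPosition, secondPosition] <;> omega

theorem linking_bottom {n i : ℕ} (hi : i < 2 * n) : linking (D n) (1, i) = 0 := by
  rw [linking_D (t := fun _ => True) (b := (· ≠ i)) (l := fun _ => True) (m := fun _ => False)
    (r := fun _ => True) (.inr (.inl ⟨rfl, hi⟩)), sum_range_ite_ne hi]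
  · simp
    zify [show 1 ≤ 2 * n by omega]
    ring
  · rintro ⟨_, j⟩ hd
    simp only [IsCrossing] at hd
    rcases hd with ⟨rfl, hj⟩ | ⟨rfl, hj⟩ | ⟨rfl | rfl | rfl, hj⟩ <;>
      simp [firstPosition, secondPosition] <;> omega

theorem linking_left {n i : ℕ} (hi : i < n) : linking (D n) (2, i) = 0 := by
  rw [linking_D (t := fun _ => True) (b := fun _ => True) (l := (· ≠ i)) (m := (· < i))
    (r := (i ≤ ·)) (.inr (.inr ⟨.inl rfl, hi⟩)), sum_range_ite_ne hi, sum_range_ite_lt hi.le,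
    sum_range_ite_le hi.le]
  · simp
    zify [show 1 ≤ 2 * n by omega]
    ring
  · rintro ⟨_, j⟩ hd
    simp only [IsCrossing] at hd
    rcases hd with ⟨rfl, hj⟩ | ⟨rfl, hj⟩ | ⟨rfl | rfl | rfl, hj⟩ <;>
      simp [firstPosition, secondPosition] <;> omega

/-- Linking number `n`: all `2 n - 1` upper crossings count and no lower one does, and the right
family exceeds the left one by one. -/
theorem linking_middle {n i : ℕ} (hi : i < n) : linking (D n) (3, i) = 4 * n := by
  rw [linking_D (t := fun _ => True) (b := fun _ => False) (l := (i + 1 ≤ ·)) (m := fun _ => False)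
    (r := (i ≤ ·)) (.inr (.inr ⟨.inr (.inl rfl), hi⟩)), sum_range_ite_le hi.le,
    sum_range_ite_le (Nat.succ_le_of_lt hi)]
  · simp
    zify [show 1 ≤ 2 * n by omega]
    ring
  · rintro ⟨_, j⟩ hd
    simp only [IsCrossing] at hd
    rcases hd with ⟨rfl, hj⟩ | ⟨rfl, hj⟩ | ⟨rfl | rfl | rfl, hj⟩ <;>
      simp [firstPosition, secondPosition] <;> omega

/-- Linking number `-n`: here only the `2 n` lower crossings count, since the left and the middle
family cancel. -/
theorem linking_right {n i : ℕ} (hi : i < n) : linking (D n) (4, i) = -(4 * n) := by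
  rw [linking_D (t := fun _ => False) (b := fun _ => True) (l := (· < i + 1)) (m := (· < i + 1))
    (r := fun _ => False) (.inr (.inr ⟨.inr (.inr rfl), hi⟩)),
    sum_range_ite_lt (Nat.succ_le_of_lt hi)]
  · simp
    ring
  · rintro ⟨_, j⟩ hd
    simp only [IsCrossing] at hd
    rcases hd with ⟨rfl, hj⟩ | ⟨rfl, hj⟩ | ⟨rfl | rfl | rfl, hj⟩ <;>
      simp [firstPosition, secondPosition] <;> omega

/-- Twice `8 (2 n - 1) - 4 (2 n) - 4 n + 2 n (4 n + 4)`; the last term comes from the middle and the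
right family. -/
theorem weight_D {n : ℕ} (hn : 1 ≤ n) : weight (D n) = 8 * (2 * n ^ 2 + 3 * n - 2 : ℕ) := by
  have h4 : |4 * (n : ℤ)| = 4 * n := abs_of_nonneg (by positivity)
  have e0 : ∑ i ∈ Finset.range (2 * n - 1), (|linking (D n) (0, i)| + 4) =
      ∑ i ∈ Finset.range (2 * n - 1), (4 + 4 : ℤ) :=
    Finset.sum_congr rfl fun i hi => by rw [linking_top (Finset.mem_range.1 hi)]; rfl
  have e1 : ∑ i ∈ Finset.range (2 * n), (|linking (D n) (1, i)| + 4) =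
      ∑ i ∈ Finset.range (2 * n), (0 + 4 : ℤ) :=
    Finset.sum_congr rfl fun i hi => by rw [linking_bottom (Finset.mem_range.1 hi)]; rfl
  have e2 : ∑ i ∈ Finset.range n, (|linking (D n) (2, i)| + 4) =
      ∑ i ∈ Finset.range n, (0 + 4 : ℤ) :=
    Finset.sum_congr rfl fun i hi => by rw [linking_left (Finset.mem_range.1 hi)]; rfl
  have e3 : ∑ i ∈ Finset.range n, (|linking (D n) (3, i)| + 4) =
      ∑ i ∈ Finset.range n, (4 * n + 4 : ℤ) :=
    Finset.sum_congr rfl fun i hi => by rw [linking_middle (Finset.mem_range.1 hi), h4]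
  have e4 : ∑ i ∈ Finset.range n, (|linking (D n) (4, i)| + 4) =
      ∑ i ∈ Finset.range n, (4 * n + 4 : ℤ) :=
    Finset.sum_congr rfl fun i hi => by rw [linking_right (Finset.mem_range.1 hi), abs_neg, h4]
  rw [weight, sum_map_D n fun c => |linking (D n) c| + 4, e0, e1, e2, e3, e4]
  simp only [Finset.sum_const, Finset.card_range, nsmul_eq_mul]
  have : 1 ≤ n ^ 2 := Nat.one_le_pow _ _ hn
  push_cast [Nat.cast_sub (show 1 ≤ 2 * n by omega), Nat.cast_sub (show 2 ≤ 2 * n ^ 2 + 3 * n by omega)]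
  ring

end KnotDiag

theorem theorem1 (n : ℕ) (hn : 1 ≤ n) :
    KnotDiag.IsKnotDiagram (KnotDiag.D n) ∧
    KnotDiag.crossingCount (KnotDiag.D n) = 7 * n - 1 ∧
    ((2 * n ^ 2 + 3 * n - 2 : ℕ) : ℕ∞) ≤ KnotDiag.sphereDist (KnotDiag.D n) KnotDiag.U ∧
    KnotDiag.sphereDist (KnotDiag.D n) KnotDiag.U ≤ ((2 * n ^ 2 + 3 * n : ℕ) : ℕ∞) ∧
    (∀ s : Bool, ((2 * n ^ 2 + 3 * n - 2 : ℕ) : ℕ∞) ≤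
      KnotDiag.planeDist (KnotDiag.planeD n) (KnotDiag.planeU s)) ∧
    KnotDiag.planeDist (KnotDiag.planeD n) (KnotDiag.planeU true) ≤
      ((2 * n ^ 2 + 3 * n : ℕ) : ℕ∞) := by
  have hD := KnotDiag.isKnotDiagram_D hn
  have hw := KnotDiag.weight_D hn
  have hr := KnotDiag.planeReach_D hn hD
  exact ⟨hD, KnotDiag.crossingCount_D hn,
    le_iInf₂ fun k h => Nat.cast_le.2 (h.le_of_weight hw),
    iInf₂_le (2 * n ^ 2 + 3 * n) hr.sphereReach,
    -- The weight does not see the unbounded face, so the bound holds for both orientations of the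
    -- circle.
    fun s => le_iInf₂ fun k h => Nat.cast_le.2 (h.sphereReach.le_of_weight hw),
    iInf₂_le (2 * n ^ 2 + 3 * n) hr⟩
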